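/- Let $n\ge 2$, let $k\in\{2,3,\dots\}\cup\{\infty\}$, and let $\gamma$ be a strictly convex closed $C^{k+1}$ hypersurface of the hyperplane $\{x\in\mathbb R^n: x^n=1\}$ (the boundary of a compact strictly convex body with nonempty interior in that hyperplane) whose second fundamental form is nondegenerate at every point; the case $k=2$ is that of a $C^3$ convex cone. Let $K=\{tp: p\in\gamma,\ t>0\}$ be the cone over $\gamma$, and let $n_p$ be the inward unit normal vector to $K$ at $p\in K$. Identify the oriented line with unit direction $v$ whose point closest to the origin is $Q$ with $(v,Q)\in TS^{n-1}=\{(v,Q)\in\mathbb R^n\times\mathbb R^n:\|v\|=1,\ \langle v,Q\rangle=0\}$. Let $\Psi\subset TS^{n-1}$ be the set of oriented lines that intersect $K$ transversally. Let $\mu:\Psi\to\Psi$ be the extended billiard map: a line that leaves the region bounded by $K$ through a point $p\in K$ (i.e. $\langle v,n_p\rangle<0$) is sent to the oriented line through $p$ with direction $v-2\langle v,n_p\rangle n_p$, and every other line of $\Psi$ (those that meet $K$ once before escaping to infinity) is fixed. The billiard trajectory of $x\in\Psi$ is the set of all $y\in\Psi$ such that $\mu^i(x)=y$ or $\mu^i(y)=x$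 for some $i\ge 0$. Put $$\Delta_0=\{(v,Q)\in TS^{n-1}: v\in K,\ \langle n_v,Q\rangle>0\},\qquad \Delta=\bigcup_{m\ge 0}\mu^{-m}(\Delta_0)\subset\Psi .$$ Then $\Delta$ is a $C^k$ submanifold of $TS^{n-1}$ of codimension one, $\Psi\setminus\Delta$ is open in $TS^{n-1}$ and dense in $\Psi$, and there are functions $I_1,\dots,I_{2n-1}:\Psi\to\mathbb R$ such that: 1. every $I_j$ is continuous on $\Psi$ and $I_j(\mu(x))=I_j(x)$ for all $x\in\Psi$; 2. $I_{2n-1}=I$, where $I(x)=\sum_{1\le i<j\le n}(p^iv^j-p^jv^i)^2$ for a line $x$ with direction $v$ and any point $p$ on it; 3. on $\Psi\setminus\Delta$ the map $\mathcal I=(I_1,\dots,I_{2n-1})$ is a $C^k$ immersion into $\mathbb R^{2n-1}$ (in particular all $I_j$ are $C^k$ there); 4. each point in the image of $\mathcal I:\Psi\to\mathbb R^{2n-1}$ determines a unique billiard trajectory: for every $x\in\Psi$ the level set $\{y\in\Psi:\mathcal I(y)=\mathcal I(x)\}$ is exactly the billiard trajectory of $x$; 5. in $\Psi\setminus\Delta$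 the first $2n-2$ integrals suffice: for every $x\in\Psi\setminus\Delta$ the set of $y\in\Psi\setminus\Delta$ with $I_j(y)=I_j(x)$ for $j=1,\dots,2n-2$ is exactly the billiard trajectory of $x$. -/

import Mathlib

noncomputable section

namespace ConeBilliard

/-- Euclidean space `ℝⁿ`. -/
abbrev E (n : ℕ) : Type := EuclideanSpace ℝ (Fin n)

/-! ### The cone -/

/-- `γ ⊆ ℝᵈ` is a strictly convex closed `C^m` hypersurface with nondegenerate second fundamental
form: it is the boundary of a compact strictly convex body, and near each of its points `q` it is
the regular zero set of a `C^m` function `h` such that the second fundamental form at `q`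
(which equals `-D²h(q) / ‖∇h(q)‖` on the tangent space `ker Dh(q)`) is nondegenerate. -/
structure IsStrictlyConvexHypersurface {d : ℕ} (m : ℕ∞) (γ : Set (E d)) : Prop where
  strictConvex : ∃ C : Set (E d),
    IsCompact C ∧ StrictConvex ℝ C ∧ (interior C).Nonempty ∧ γ = frontier C
  nondegenerate : ∀ q ∈ γ, ∃ (U : Set (E d)) (h : E d → ℝ),
    IsOpen U ∧ q ∈ U ∧ ContDiffOn ℝ m h U ∧ γ ∩ U = {y ∈ U | h y = 0} ∧ fderiv ℝ h q ≠ 0 ∧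
    ∀ w, fderiv ℝ h q w = 0 →
      (∀ u, fderiv ℝ h q u = 0 → fderiv ℝ (fderiv ℝ h) q w u = 0) → w = 0

/-- The identification of `ℝᵈ` with the hyperplane `{x | xⁿ = 1}` of `ℝⁿ`, where `n = d + 1`. -/
def lift {d : ℕ} (y : E d) : E (d + 1) :=
  WithLp.toLp 2 (Fin.snoc (α := fun _ => ℝ) (fun i => y i) 1)

/-- The cone `K = {t p | p ∈ γ, t > 0}` over `γ ⊆ {xⁿ = 1}`; the vertex is not included. -/
def cone {d : ℕ} (γ : Set (E d)) : Set (E (d + 1)) :=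
  {p | ∃ t : ℝ, 0 < t ∧ ∃ q ∈ γ, p = t • lift q}

/-- `ν` is the inward unit normal vector to the hypersurface `K` at `p`: a unit vector orthogonal
to the tangent space `T_p K` and pointing into the interior of the convex hull of `K`. -/
def IsInwardUnitNormal {n : ℕ} (K : Set (E n)) (p ν : E n) : Prop :=
  ‖ν‖ = 1 ∧ (∀ w ∈ tangentConeAt ℝ K p, inner ℝ w ν = 0) ∧
    ∃ ε : ℝ, 0 < ε ∧ ∀ s : ℝ, 0 < s → s < ε → p + s • ν ∈ interior (convexHull ℝ K)

/-- The inward unit normal vector `n_p` to `K` at `p`. -/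
def inwardNormal {n : ℕ} (K : Set (E n)) (p : E n) : E n :=
  Classical.epsilon (IsInwardUnitNormal K p)

/-! ### Oriented lines -/

/-- The space `TSⁿ⁻¹` of oriented lines in `ℝⁿ`: the pair `(v, Q)` is the line with unit direction
vector `v` whose point closest to the origin is `Q`. -/
def orientedLines (n : ℕ) : Set (E n × E n) :=
  {x | ‖x.1‖ = 1 ∧ inner ℝ x.1 x.2 = 0}

/-- The points of the oriented line `x = (v, Q)`. -/
def line {n : ℕ} (x : E n × E n) : Set (E n) :=
  {p | ∃ t : ℝ, p = x.2 + t • x.1}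

/-- The oriented line through `p` with unit direction vector `v`. -/
def lineThrough {n : ℕ} (p v : E n) : E n × E n :=
  (v, p - inner ℝ p v • v)

/-- The tangent space of `TSⁿ⁻¹ = {‖v‖² = 1, ⟪v, Q⟫ = 0} ⊆ ℝⁿ × ℝⁿ` at `x`. -/
def tangentTS {n : ℕ} (x : E n × E n) : Set (E n × E n) :=
  {w | inner ℝ x.1 w.1 = 0 ∧ inner ℝ w.1 x.2 + inner ℝ x.1 w.2 = 0}

/-- `I = ∑_{i<j} (pⁱ vʲ - pʲ vⁱ)²`, for a point `p` and a velocity vector `v`. -/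
def angularIntegral {n : ℕ} (p v : E n) : ℝ :=
  ∑ i : Fin n, ∑ j ∈ Finset.Ioi i, (p i * v j - p j * v i) ^ 2

/-! ### The billiard inside the cone -/

/-- The phase space `Ψ`: oriented lines that intersect `K` transversally. -/
def phaseSpace {n : ℕ} (K : Set (E n)) : Set (E n × E n) :=
  {x ∈ orientedLines n | ∃ p ∈ K, p ∈ line x ∧ x.1 ∉ tangentConeAt ℝ K p}

/-- The line `x` leaves the region bounded by `K` through the point `p` of `K`. -/
def IsExitPoint {n : ℕ} (K : Set (E n)) (x : E n × E n) (p : E n) : Prop :=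
  p ∈ K ∧ p ∈ line x ∧ inner ℝ x.1 (inwardNormal K p) < 0

/-- The reflection of a vector in the tangent hyperplane with unit normal vector `ν`. -/
def reflectVector {n : ℕ} (ν v : E n) : E n :=
  v - (2 * inner ℝ v ν) • ν

open Classical in
/-- The extended billiard map `μ`. A line of `Ψ` with an exit point (that is, a line that meets the
cone twice, or that comes from infinity and meets it once) is reflected at this point by the law of
equal angles; the other lines of `Ψ` (those that meet the cone once before escaping to infinity)
are fixed. -/
def billiardMap {n : ℕ} (K : Set (E n)) (x : E n × E n) : E n × E n :=
  if h : ∃ p, IsExitPoint K x p then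
    lineThrough h.choose (reflectVector (inwardNormal K h.choose) x.1)
  else x

/-- The billiard trajectory through the line `x`: all lines of `Ψ` that `μ` reaches from `x`, and
all those from which `μ` reaches `x`. -/
def trajectory {n : ℕ} (K : Set (E n)) (x : E n × E n) : Set (E n × E n) :=
  {y ∈ phaseSpace K | ∃ i : ℕ, (billiardMap K)^[i] x = y ∨ (billiardMap K)^[i] y = x}

/-- `Δ₀`, the common boundary of the set of lines that meet the cone twice and the set of lines
that meet it once before escaping to infinity: the direction `v` lies on `K` and
`⟪n_v, Q⟫ > 0`. -/
def Delta0 {n : ℕ} (K : Set (E n)) : Set (E n × E n) :=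
  {x ∈ orientedLines n | x.1 ∈ K ∧ 0 < inner ℝ (inwardNormal K x.1) x.2}

/-- `Δ = ⋃ₘ μ⁻ᵐ(Δ₀)`, as a subset of `Ψ`. -/
def Delta {n : ℕ} (K : Set (E n)) : Set (E n × E n) :=
  {x ∈ phaseSpace K | ∃ m : ℕ, (billiardMap K)^[m] x ∈ Delta0 K}

/-! ### Smooth maps and submanifolds -/

/-- `F` is a `C^k` immersion on the (relatively open) subset `S` of `TSⁿ⁻¹`: near each point of `S`
it is the restriction of a `C^k` map `G` of the ambient space `ℝⁿ × ℝⁿ`, and its differential is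
injective on the tangent space of `TSⁿ⁻¹`. -/
def IsImmersionOn {n N : ℕ} (k : ℕ∞) (F : E n × E n → E N) (S : Set (E n × E n)) : Prop :=
  ∀ x ∈ S, ∃ (U : Set (E n × E n)) (G : E n × E n → E N),
    IsOpen U ∧ x ∈ U ∧ ContDiffOn ℝ k G U ∧ Set.EqOn G F (S ∩ U) ∧
    ∀ w ∈ tangentTS x, fderiv ℝ G x w = 0 → w = 0

/-- `S` is an (embedded) `C^k` submanifold of codimension one of `TSⁿ⁻¹`: near each of its points it
is the zero set of a `C^k` function whose differential on the tangent space of `TSⁿ⁻¹` is nonzero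
at that point. -/
def IsCodimOneSubmanifold {n : ℕ} (k : ℕ∞) (S : Set (E n × E n)) : Prop :=
  S ⊆ orientedLines n ∧ ∀ x ∈ S, ∃ (U : Set (E n × E n)) (h : E n × E n → ℝ),
    IsOpen U ∧ x ∈ U ∧ ContDiffOn ℝ k h U ∧ S ∩ U = {y ∈ orientedLines n ∩ U | h y = 0} ∧
    ∃ w ∈ tangentTS x, fderiv ℝ h x w ≠ 0

end ConeBilliard

end

noncomputable section

set_option maxSynthPendingDepth 3
set_option linter.unusedSectionVars false

/-! ### Concave homogeneous functions that vanish on a cone -/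

namespace ConeBilliard

open Filter Topology Set
open scoped ContDiff

/-! Write the solid cone as `{G ≥ 0}` with `G` concave, homogeneous of degree one and of class
`C^(k+1)` off an axis; for a convex body `C` and an interior point `c` one takes height minus the
gauge of `C - c` (`coneFunction`). Euler's identity makes `∇G(p)` orthogonal to `p` for every `p` in
`K`, so the reflection at `p` fixes `p`. It therefore acts on a line `(v, Q)` by one linear
reflection applied to both `v` and `Q`, and it keeps the time parameter. Hence `‖Q‖²`, which is the
integral `I`, is preserved, and the map `bounce` is reversible, injective and `C^k`.

The core is that every trajectory has finitely many reflections (`exists_iterate_nonneg`). Let `δ i`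
be the distance between successive reflection points after radial projection to height one, and let
`b i` be the height of the reflection point times the normal component of the outgoing velocity. The
sum of the `δ i` is bounded by the angle swept out, hence by a constant. The estimates of
`exists_pairing_le`, which use three derivatives and the nondegenerate second fundamental form, give
`b i ≤ (1 + C δ i) b (i+1)` and `b i ≤ M δ i`. The first keeps `b` away from zero, the second then
keeps `δ` away from zero, against summability.

So each trajectory ends in a final line, whose direction satisfies `G v ≥ 0`. By injectivity of
`bounce` the final line determines the trajectory (`trajectory_boundary`), and functions of it are
integrals. `Δ` consists of the lines whose final direction lies on `K`. There the final line jumps: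
a nearby line may undergo one more reflection, far away, and in the limit `(v, Q)` is replaced by
its mirror image in the tangent plane along `v` (`bounce_near_asymptotic`). Thus a continuous
function of the final line stays continuous across `Δ` as soon as it is invariant under this mirror
(`continuousOn_comp_finalLine`).

The integrals are `2d` coordinates together with `‖Q‖²`: the slope of `v`, and the horizontal part
of `Q` with its component along the horizontal normal multiplied by one minus a cutoff that is `1`
exactly when `G v = 0`. For `G v > 0` these `2d` coordinates determine the line and have injective
differential. For `G v = 0` they lose the normal component, which is what mirror invariance demands;
`‖Q‖²` leaves only the two mirror images, and the sign condition `DG(v) Q > 0` selects one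
(`eq_of_asymptoticData_eq`). -/

/-- `G` is a concave, positively homogeneous function whose superlevel set `{G ≥ 0}` is a solid
strictly convex cone. Here `ℓ` is a linear functional that is positive on this cone, `e` is an axis
along which `G` grows with unit speed, and `G` is of class `C^m` off the axis (where `G = ℓ`). -/
structure IsConcaveConeFunction {V : Type*} [NormedAddCommGroup V] [InnerProductSpace ℝ V]
    (m : ℕ∞ω) (G : V → ℝ) (ℓ : V →L[ℝ] ℝ) (e : V) : Prop where
  three_le : 3 ≤ m
  map_smul : ∀ t : ℝ, 0 ≤ t → ∀ x, G (t • x) = t * G x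
  superadd : ∀ x y, G x + G y ≤ G (x + y)
  continuous : Continuous G
  add_axis : ∀ (x : V) (r : ℝ), G (x + r • e) = G x + r
  le_height : ∀ x, G x ≤ ℓ x
  height_pos : ∀ x, x ≠ 0 → 0 ≤ G x → 0 < ℓ x
  contDiffAt : ∀ x, G x ≠ ℓ x → ContDiffAt ℝ m G x
  strict : ∀ p q, G p = 0 → G q = 0 → ℓ p = ℓ q → p ≠ q → 0 < G (p + q)

/-- A concave cone function whose second derivative is nondegenerate transversally to the rulings
of the boundary `{G = 0}` of the cone. -/
structure IsConeFunction {V : Type*} [NormedAddCommGroup V] [InnerProductSpace ℝ V]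
    (m : ℕ∞ω) (G : V → ℝ) (ℓ : V →L[ℝ] ℝ) (e : V) : Prop
    extends IsConcaveConeFunction m G ℓ e where
  hess : ∀ p, p ≠ 0 → G p = 0 → ∀ u, ℓ u = 0 → fderiv ℝ G p u = 0 →
    fderiv ℝ (fderiv ℝ G) p u u = 0 → u = 0

namespace IsConcaveConeFunction

variable {V : Type*} [NormedAddCommGroup V] [InnerProductSpace ℝ V]
  {m : ℕ∞ω} {G : V → ℝ} {ℓ : V →L[ℝ] ℝ} {e : V}

theorem map_zero (hG : IsConcaveConeFunction m G ℓ e) : G 0 = 0 := by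
  simpa using hG.map_smul 0 le_rfl 0

theorem map_axis (hG : IsConcaveConeFunction m G ℓ e) (r : ℝ) : G (r • e) = r := by
  simpa [hG.map_zero] using hG.add_axis 0 r

theorem m_ne_zero (hG : IsConcaveConeFunction m G ℓ e) : m ≠ 0 := by
  have := hG.three_le
  rintro rfl
  simp at this

theorem differentiableAt (hG : IsConcaveConeFunction m G ℓ e) {x : V} (hx : G x ≠ ℓ x) :
    DifferentiableAt ℝ G x :=
  (hG.contDiffAt x hx).differentiableAt hG.m_ne_zero

theorem ne_height (hG : IsConcaveConeFunction m G ℓ e) {p : V} (hp : p ≠ 0) (h0 : G p = 0) :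
    G p ≠ ℓ p := by
  have := hG.height_pos p hp h0.ge
  rw [h0]; exact this.ne

theorem eventually_ne_height (hG : IsConcaveConeFunction m G ℓ e) {p : V} (hp : G p ≠ ℓ p) :
    ∀ᶠ x in 𝓝 p, G x ≠ ℓ x :=
  (isOpen_ne_fun hG.continuous ℓ.continuous).mem_nhds hp

theorem hasDerivAt_line (hG : IsConcaveConeFunction m G ℓ e) {p v : V} {t : ℝ}
    (h : G (p + t • v) ≠ ℓ (p + t • v)) :
    HasDerivAt (fun s : ℝ => G (p + s • v)) (fderiv ℝ G (p + t • v) v) t := by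
  have h1 : HasDerivAt (fun s : ℝ => p + s • v) v t := by
    simpa using ((hasDerivAt_id t).smul_const v).const_add p
  exact (hG.differentiableAt h).hasFDerivAt.comp_hasDerivAt t h1

theorem fderiv_self (hG : IsConcaveConeFunction m G ℓ e) {x : V} (hx : G x ≠ ℓ x) :
    fderiv ℝ G x x = G x := by
  have h1 : HasDerivAt (fun s : ℝ => G (0 + s • x)) (fderiv ℝ G x x) 1 := by
    simpa using hG.hasDerivAt_line (p := 0) (v := x) (t := 1) (by simpa using hx)
  have h2 : HasDerivAt (fun s : ℝ => s * G x) (G x) 1 := by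
    simpa using (hasDerivAt_id (1 : ℝ)).mul_const (G x)
  refine h1.unique (h2.congr_of_eventuallyEq ?_)
  filter_upwards [lt_mem_nhds (show (0 : ℝ) < 1 by norm_num)] with s hs
  rw [zero_add, hG.map_smul s hs.le]

/-- Superadditivity and homogeneity bound every forward difference quotient of `G` at `x` along `y`
below by `G y`. This is the form in which concavity is used nearly everywhere. -/
theorem le_fderiv (hG : IsConcaveConeFunction m G ℓ e) {x : V} (hx : G x ≠ ℓ x) (y : V) :
    G y ≤ fderiv ℝ G x y := by
  have h1 : HasDerivAt (fun s : ℝ => G (x + s • y)) (fderiv ℝ G x y) 0 := by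
    simpa using hG.hasDerivAt_line (p := x) (v := y) (t := 0) (by simpa using hx)
  have h2 := h1.hasDerivWithinAt (s := Ioi 0)
  rw [hasDerivWithinAt_iff_tendsto_slope' (by simp)] at h2
  refine ge_of_tendsto h2 ?_
  filter_upwards [self_mem_nhdsWithin] with s hs
  have hs' : (0 : ℝ) < s := hs
  have := hG.superadd x (s • y)
  rw [hG.map_smul s hs'.le] at this
  rw [slope_def_field, sub_zero, le_div_iff₀ hs']
  simp only [zero_smul, add_zero]
  linarith

theorem fderiv_axis (hG : IsConcaveConeFunction m G ℓ e) {x : V} (hx : G x ≠ ℓ x) :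
    fderiv ℝ G x e = 1 := by
  have h1 := hG.le_fderiv hx ((1 : ℝ) • e)
  have h2 := hG.le_fderiv hx ((-1 : ℝ) • e)
  rw [hG.map_axis] at h1 h2
  simp at h1 h2
  linarith

theorem fderiv_smul (hG : IsConcaveConeFunction m G ℓ e) {t : ℝ} (ht : 0 < t) (x : V) :
    fderiv ℝ G (t • x) = fderiv ℝ G x := by
  have h1 : (fun y => G (t • y)) = t • G := by
    ext y; simp [hG.map_smul t ht.le]
  have h2 := fderiv_comp_smul (𝕜 := ℝ) (f := G) (x := x) t
  rw [h1, fderiv_const_smul_field] at h2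
  exact (smul_right_injective _ ht.ne' h2).symm

theorem le_fderiv_sub (hG : IsConcaveConeFunction m G ℓ e) {x : V} (hx : G x ≠ ℓ x) (y : V) :
    G y ≤ G x + fderiv ℝ G x (y - x) := by
  rw [map_sub, hG.fderiv_self hx]
  linarith [hG.le_fderiv hx y]

theorem fderiv_sub_nonpos (hG : IsConcaveConeFunction m G ℓ e) {x y : V} (hx : G x ≠ ℓ x)
    (hy : G y ≠ ℓ y) : (fderiv ℝ G y - fderiv ℝ G x) (y - x) ≤ 0 := by
  have h1 := hG.le_fderiv_sub hx y
  have h2 := hG.le_fderiv_sub hy x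
  rw [← neg_sub, map_neg] at h2
  simp only [sub_apply]
  linarith

/-- Since `DG(p) p = 0`, the pairing `DG(p) q` equals `DG(p) (p + q)`, which dominates `G (p + q)`;
strict convexity makes the latter positive. -/
theorem fderiv_pos_of_pos (hG : IsConcaveConeFunction m G ℓ e) {p q : V} (hp : p ≠ 0) (hp0 : G p = 0)
    (hq0 : G q = 0) (hℓ : ℓ p = ℓ q) (hpq : p ≠ q) : 0 < fderiv ℝ G p q := by
  have h1 := hG.strict p q hp0 hq0 hℓ hpq
  have h2 := hG.le_fderiv (hG.ne_height hp hp0) (p + q)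
  rw [map_add, hG.fderiv_self (hG.ne_height hp hp0), hp0] at h2
  linarith

theorem contDiffAt_fderiv (hG : IsConcaveConeFunction m G ℓ e) {x : V} (hx : G x ≠ ℓ x) :
    ContDiffAt ℝ 2 (fderiv ℝ G) x := by
  refine (hG.contDiffAt x hx).fderiv_right ?_
  have h : (2 : ℕ∞ω) + 1 = 3 := by norm_num
  rw [h]
  exact hG.three_le

theorem hasDerivAt_fderiv_line (hG : IsConcaveConeFunction m G ℓ e) {p v : V} {t : ℝ}
    (h : G (p + t • v) ≠ ℓ (p + t • v)) (w : V) :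
    HasDerivAt (fun s : ℝ => fderiv ℝ G (p + s • v) w)
      (fderiv ℝ (fderiv ℝ G) (p + t • v) v w) t := by
  have h1 : HasDerivAt (fun s : ℝ => p + s • v) v t := by
    simpa using ((hasDerivAt_id t).smul_const v).const_add p
  have h0 : HasFDerivAt (fderiv ℝ G) (fderiv ℝ (fderiv ℝ G) (p + t • v)) (p + t • v) :=
    ((hG.contDiffAt_fderiv h).differentiableAt two_ne_zero).hasFDerivAt
  have h2 : HasDerivAt (fun s : ℝ => fderiv ℝ G (p + s • v))
      (fderiv ℝ (fderiv ℝ G) (p + t • v) v) t := h0.comp_hasDerivAt t h1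
  exact (ContinuousLinearMap.apply ℝ ℝ w).hasFDerivAt.comp_hasDerivAt t h2

theorem hess_nonpos (hG : IsConcaveConeFunction m G ℓ e) {x : V} (hx : G x ≠ ℓ x) (u : V) :
    fderiv ℝ (fderiv ℝ G) x u u ≤ 0 := by
  have h1 : HasDerivAt (fun s : ℝ => fderiv ℝ G (x + s • u) u)
      (fderiv ℝ (fderiv ℝ G) x u u) 0 := by
    have := hG.hasDerivAt_fderiv_line (p := x) (v := u) (t := 0)
      (by rwa [zero_smul, add_zero]) u
    rwa [zero_smul, add_zero] at this
  have h3 := h1.hasDerivWithinAt (s := Ioi 0)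
  rw [hasDerivWithinAt_iff_tendsto_slope' (by simp)] at h3
  refine le_of_tendsto h3 ?_
  have h4 : ∀ᶠ s in 𝓝[>] (0 : ℝ), G (x + s • u) ≠ ℓ (x + s • u) := by
    have hc : ContinuousAt (fun s : ℝ => x + s • u) 0 := by fun_prop
    have h0 : ∀ᶠ y in 𝓝 (x + (0 : ℝ) • u), G y ≠ ℓ y := by
      rw [zero_smul, add_zero]
      exact hG.eventually_ne_height hx
    exact nhdsWithin_le_nhds (hc.eventually h0)
  filter_upwards [self_mem_nhdsWithin, h4] with s hs hs2
  have hs' : (0 : ℝ) < s := hs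
  have h5 := hG.fderiv_sub_nonpos hx hs2
  rw [slope_def_field, sub_zero, zero_smul, add_zero]
  refine div_nonpos_of_nonpos_of_nonneg ?_ hs'.le
  rw [add_sub_cancel_left, _root_.map_smul, smul_eq_mul, sub_apply] at h5
  nlinarith

section FiniteDim

variable [FiniteDimensional ℝ V]

/-- Compactness of the part of the unit sphere in the cone, and homogeneity. Norm and height are
thus comparable on the cone, which makes the section compact and later bounds the swept angle. -/
theorem exists_norm_le_height (hG : IsConcaveConeFunction m G ℓ e) :
    ∃ c : ℝ, 0 < c ∧ ∀ x, 0 ≤ G x → c * ‖x‖ ≤ ℓ x := by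
  have hK : IsCompact {x : V | x ∈ Metric.sphere (0 : V) 1 ∧ 0 ≤ G x} :=
    (isCompact_sphere (0 : V) 1).inter_right (isClosed_Ici.preimage hG.continuous)
  obtain ⟨c, hc, hc2⟩ : ∃ c : ℝ, 0 < c ∧ ∀ x ∈ {x : V | x ∈ Metric.sphere (0 : V) 1 ∧ 0 ≤ G x},
      c ≤ ℓ x := by
    refine hK.exists_forall_le' ℓ.continuous.continuousOn (a := 0) ?_
    rintro x ⟨hx1, hx2⟩
    refine hG.height_pos x ?_ hx2
    rintro rfl
    simp at hx1
  refine ⟨c, hc, fun x hx => ?_⟩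
  rcases eq_or_ne x 0 with rfl | hx0
  · simp
  have hn : 0 < ‖x‖ := norm_pos_iff.2 hx0
  have := hc2 (‖x‖⁻¹ • x) ⟨by simp [norm_smul, hn.ne'], by
    rw [hG.map_smul _ (by positivity)]; positivity⟩
  rw [_root_.map_smul, smul_eq_mul] at this
  calc c * ‖x‖ ≤ (‖x‖⁻¹ * ℓ x) * ‖x‖ := by gcongr
    _ = ℓ x := by field_simp

theorem isCompact_section (hG : IsConcaveConeFunction m G ℓ e) :
    IsCompact {x : V | G x = 0 ∧ ℓ x = 1} := by
  obtain ⟨c, hc, h⟩ := hG.exists_norm_le_height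
  refine Metric.isCompact_of_isClosed_isBounded ?_ ?_
  · exact (isClosed_eq hG.continuous continuous_const).inter
      (isClosed_eq ℓ.continuous continuous_const)
  · refine (Metric.isBounded_closedBall (x := (0 : V)) (r := c⁻¹)).subset ?_
    rintro x ⟨hx1, hx2⟩
    have := h x hx1.ge
    rw [mem_closedBall_zero_iff, ← one_div, le_div_iff₀ hc]
    linarith

end FiniteDim

end IsConcaveConeFunction

end ConeBilliard

/-! ### Second-order estimates for the pairing `DG(p) q` on the section of the cone -/

namespace ConeBilliard

open Filter Topology Set
open scoped ContDiff

/-- Taylor's formula with Lagrange remainder, at the left end, for a function that vanishes at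
both ends of the unit interval. -/
theorem exists_deriv_eq_neg_half_left {f f' f'' : ℝ → ℝ}
    (hf : ∀ s ∈ Icc (0 : ℝ) 1, HasDerivAt f (f' s) s)
    (hf' : ∀ s ∈ Icc (0 : ℝ) 1, HasDerivAt f' (f'' s) s) (h0 : f 0 = 0) (h1 : f 1 = 0) :
    ∃ ξ ∈ Icc (0 : ℝ) 1, f' 0 = -(f'' ξ) / 2 := by
  have hk : ∀ s ∈ Icc (0 : ℝ) 1,
      HasDerivAt (fun s => f s - f' 0 * (s - s ^ 2)) (f' s - f' 0 * (1 - 2 * s)) s := by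
    intro s hs
    have h2 : HasDerivAt (fun s : ℝ => s - s ^ 2) (1 - 2 * s) s := by
      convert! (hasDerivAt_id s).sub (hasDerivAt_pow 2 s) using 1
      simp
    exact (hf s hs).sub (h2.const_mul (f' 0))
  have hk' : ∀ s ∈ Icc (0 : ℝ) 1,
      HasDerivAt (fun s => f' s - f' 0 * (1 - 2 * s)) (f'' s + f' 0 * 2) s := by
    intro s hs
    have h2 : HasDerivAt (fun s : ℝ => 1 - 2 * s) (-2) s := by
      simpa using ((hasDerivAt_id s).const_mul 2).const_sub 1
    convert! (hf' s hs).sub (h2.const_mul (f' 0)) using 1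
    ring
  obtain ⟨a, ha, ha'⟩ := exists_hasDerivAt_eq_zero (a := (0 : ℝ)) (b := 1) one_pos
    (fun s hs => (hk s hs).continuousAt.continuousWithinAt) (by simp [h0, h1])
    (fun s hs => hk s (Ioo_subset_Icc_self hs))
  have hsub : Icc (0 : ℝ) a ⊆ Icc 0 1 := Icc_subset_Icc_right ha.2.le
  obtain ⟨b, hb, hb'⟩ := exists_hasDerivAt_eq_zero (a := (0 : ℝ)) (b := a) ha.1
    (fun s hs => (hk' s (hsub hs)).continuousAt.continuousWithinAt) (by rw [ha']; simp)
    (fun s hs => hk' s (hsub (Ioo_subset_Icc_self hs)))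
  exact ⟨b, hsub (Ioo_subset_Icc_self hb), by linarith⟩

theorem exists_deriv_eq_half_right {f f' f'' : ℝ → ℝ}
    (hf : ∀ s ∈ Icc (0 : ℝ) 1, HasDerivAt f (f' s) s)
    (hf' : ∀ s ∈ Icc (0 : ℝ) 1, HasDerivAt f' (f'' s) s) (h0 : f 0 = 0) (h1 : f 1 = 0) :
    ∃ ξ ∈ Icc (0 : ℝ) 1, f' 1 = f'' ξ / 2 := by
  have hI : ∀ s ∈ Icc (0 : ℝ) 1, 1 - s ∈ Icc (0 : ℝ) 1 := fun s hs =>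
    ⟨by linarith [hs.2], by linarith [hs.1]⟩
  have hr : ∀ s : ℝ, HasDerivAt (fun s : ℝ => 1 - s) (-1) s := fun s => by
    simpa using (hasDerivAt_id s).const_sub 1
  obtain ⟨ξ, hξ, h⟩ := exists_deriv_eq_neg_half_left (f := fun s => f (1 - s))
    (f' := fun s => -f' (1 - s)) (f'' := fun s => f'' (1 - s))
    (fun s hs => by
      convert! (hf _ (hI s hs)).comp s (hr s) using 1
      simp)
    (fun s hs => by
      convert! ((hf' _ (hI s hs)).comp s (hr s)).neg using 1
      simp) (by simp [h1]) (by simp [h0])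
  refine ⟨1 - ξ, hI ξ hξ, ?_⟩
  simp only [sub_zero] at h
  linarith

namespace IsConeFunction

variable {V : Type*} [NormedAddCommGroup V] [InnerProductSpace ℝ V]
  {m : ℕ∞ω} {G : V → ℝ} {ℓ : V →L[ℝ] ℝ} {e : V}

/-- The second derivative of `G - G² / 2`. -/
def hessForm (G : V → ℝ) (x : V) : V →L[ℝ] V →L[ℝ] ℝ :=
  (1 - G x) • fderiv ℝ (fderiv ℝ G) x - (fderiv ℝ G x).smulRight (fderiv ℝ G x)

theorem hessForm_apply (x u w : V) : hessForm G x u w =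
    (1 - G x) * fderiv ℝ (fderiv ℝ G) x u w - fderiv ℝ G x u * fderiv ℝ G x w := by
  simp [hessForm]

theorem contDiffAt_hessForm (hG : IsConeFunction m G ℓ e) {x : V} (hx : G x ≠ ℓ x) :
    ContDiffAt ℝ 1 (hessForm G) x := by
  have h1 : ContDiffAt ℝ 1 G x :=
    (hG.contDiffAt x hx).of_le (le_trans (by norm_num) hG.three_le)
  have h2 : ContDiffAt ℝ 1 (fderiv ℝ G) x := (hG.contDiffAt_fderiv hx).of_le (by norm_num)
  have h3 : ContDiffAt ℝ 1 (fderiv ℝ (fderiv ℝ G)) x :=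
    (hG.contDiffAt_fderiv hx).fderiv_right (by norm_num)
  have h4 : ContDiffAt ℝ 1 (fun y => 1 - G y) x := contDiffAt_const.sub h1
  have h5 : ContDiffAt ℝ 1 (fun y => (1 - G y) • fderiv ℝ (fderiv ℝ G) y) x := h4.smul h3
  exact h5.sub (h2.smulRight h2)

/-- Subtracting `G² / 2` changes neither the value nor the first derivative on `{G = 0}`, but it
adds `-DG ⊗ DG` to the Hessian. The Hessian of `G` is definite only on the horizontal vectors in
`ker DG`; the corrected form is definite on all horizontal vectors, including chords of the section.
-/
theorem hessForm_neg (hG : IsConeFunction m G ℓ e) {p : V} (hp : p ≠ 0) (hp0 : G p = 0) {u : V}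
    (hu : ℓ u = 0) (hu0 : u ≠ 0) : hessForm G p u u < 0 := by
  have h1 := hG.hess_nonpos (hG.ne_height hp hp0) u
  rw [hessForm_apply, hp0, sub_zero, one_mul]
  by_contra! h2
  have h3 : fderiv ℝ G p u = 0 := by nlinarith [mul_self_nonneg (fderiv ℝ G p u)]
  rw [h3] at h2
  exact hu0 (hG.hess p hp hp0 u hu h3 (by linarith))

/-- Taylor's formula for `G - G² / 2` on the segment from `p` to `q`, where it vanishes at both
ends. The pairings in the two orders become values of the same quadratic form at two intermediate
points, so their difference is controlled by the modulus of continuity of the form. -/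
theorem exists_deriv_eq_hessForm (hG : IsConeFunction m G ℓ e) {p q : V}
    (hp : G p = 0) (hq : G q = 0)
    (hs : ∀ s ∈ Icc (0 : ℝ) 1, G (p + s • (q - p)) ≠ ℓ (p + s • (q - p))) :
    ∃ ξ ∈ Icc (0 : ℝ) 1, ∃ η ∈ Icc (0 : ℝ) 1,
      fderiv ℝ G p q = -hessForm G (p + ξ • (q - p)) (q - p) (q - p) / 2 ∧
      fderiv ℝ G q p = -hessForm G (p + η • (q - p)) (q - p) (q - p) / 2 := by
  set w := q - p with hw
  have hf : ∀ s ∈ Icc (0 : ℝ) 1, HasDerivAt (fun s : ℝ => G (p + s • w) - G (p + s • w) ^ 2 / 2)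
      ((1 - G (p + s • w)) * fderiv ℝ G (p + s • w) w) s := by
    intro s hs'
    have h1 := hG.hasDerivAt_line (hs s hs')
    convert! h1.sub ((h1.pow 2).div_const 2) using 1
    simp; ring
  have hf' : ∀ s ∈ Icc (0 : ℝ) 1,
      HasDerivAt (fun s : ℝ => (1 - G (p + s • w)) * fderiv ℝ G (p + s • w) w)
        (hessForm G (p + s • w) w w) s := by
    intro s hs'
    have h1 := hG.hasDerivAt_line (hs s hs')
    convert! (h1.const_sub 1).mul (hG.hasDerivAt_fderiv_line (hs s hs') w) using 1
    rw [hessForm_apply]; ring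
  have h0 := hs 0 (by simp)
  have h1 := hs 1 (by simp)
  have e1 : p + (1 : ℝ) • w = q := by simp [hw]
  rw [e1] at h1
  rw [zero_smul, add_zero] at h0
  obtain ⟨ξ, hξ, h2⟩ := exists_deriv_eq_neg_half_left hf hf' (by simp [hp]) (by rw [e1]; simp [hq])
  obtain ⟨η, hη, h3⟩ := exists_deriv_eq_half_right hf hf' (by simp [hp]) (by rw [e1]; simp [hq])
  refine ⟨ξ, hξ, η, hη, ?_, ?_⟩
  · rw [← h2, zero_smul, add_zero, hp, hw, map_sub, hG.fderiv_self h0, hp]; ring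
  · rw [e1, hq] at h3
    rw [neg_div, ← h3, hw, map_sub, hG.fderiv_self h1, hq]; ring

section FiniteDim

variable [FiniteDimensional ℝ V]

theorem exists_hessForm_le (hG : IsConeFunction m G ℓ e) {p : V} (hp : p ≠ 0) (hp0 : G p = 0) :
    ∃ c : ℝ, 0 < c ∧ ∀ u, ℓ u = 0 → hessForm G p u u ≤ -c * ‖u‖ ^ 2 := by
  have hK : IsCompact {u : V | u ∈ Metric.sphere (0 : V) 1 ∧ ℓ u = 0} :=
    (isCompact_sphere (0 : V) 1).inter_right (isClosed_eq ℓ.continuous continuous_const)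
  obtain ⟨c, hc, hc2⟩ : ∃ c : ℝ, 0 < c ∧ ∀ u ∈ {u : V | u ∈ Metric.sphere (0 : V) 1 ∧ ℓ u = 0},
      c ≤ -hessForm G p u u := by
    refine hK.exists_forall_le' (a := 0) ?_ ?_
    · fun_prop
    rintro u ⟨hu1, hu2⟩
    have hu0 : u ≠ 0 := by
      rintro rfl
      simp at hu1
    linarith [hG.hessForm_neg hp hp0 hu2 hu0]
  refine ⟨c, hc, fun u hu => ?_⟩
  rcases eq_or_ne u 0 with rfl | hu0
  · simp
  have hn : 0 < ‖u‖ := norm_pos_iff.2 hu0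
  have := hc2 (‖u‖⁻¹ • u) ⟨by simp [norm_smul, hn.ne'], by simp [hu]⟩
  simp only [_root_.map_smul, smul_apply, smul_eq_mul] at this
  have h3 : hessForm G p u u = ‖u‖ ^ 2 * (‖u‖⁻¹ * (‖u‖⁻¹ * hessForm G p u u)) := by field_simp
  rw [h3]
  nlinarith [sq_nonneg ‖u‖]

/-- The form `DG(p) q` on the section `{G = 0, ℓ = 1}` is at most quadratic in `p - q`, and it is
symmetric up to a relative error of first order: local version at the diagonal. -/
theorem eventually_pairing_le_diag (hG : IsConeFunction m G ℓ e) {p₀ : V} (hp₀ : p₀ ≠ 0)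
    (h0 : G p₀ = 0) : ∃ C : ℝ, 0 ≤ C ∧ ∀ᶠ z in 𝓝 (p₀, p₀), G z.1 = 0 → G z.2 = 0 →
      ℓ z.1 = ℓ z.2 → fderiv ℝ G z.1 z.2 ≤ C * ‖z.1 - z.2‖ ^ 2 ∧
      fderiv ℝ G z.1 z.2 ≤ (1 + C * ‖z.1 - z.2‖) * fderiv ℝ G z.2 z.1 := by
  have hx := hG.ne_height hp₀ h0
  obtain ⟨c, hc, hc2⟩ := hG.exists_hessForm_le hp₀ h0
  have hA := hG.contDiffAt_hessForm hx
  obtain ⟨L, t, ht, hL⟩ := hA.exists_lipschitzOnWith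
  have hA' : ∀ᶠ x in 𝓝 p₀, ‖hessForm G x - hessForm G p₀‖ < c / 2 := by
    filter_upwards [hA.continuousAt (Metric.ball_mem_nhds _ (half_pos hc))] with x hx
    rwa [← dist_eq_norm]
  obtain ⟨r, hr, hball⟩ := Metric.eventually_nhds_iff_ball.1
    ((hG.eventually_ne_height hx).and (hA'.and ht))
  set M := ‖hessForm G p₀‖ + c with hM
  have hM0 : 0 ≤ M := by positivity
  -- `M` bounds the norm of the form near `p₀` and serves the quadratic estimate. The two values of
  -- the form differ by at most `L ‖w‖³`, and each is at least `(c / 2) ‖w‖²` in absolute value,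
  -- which gives the relative error `(2 L / c) ‖w‖`.
  refine ⟨M + 2 * L / c, by positivity, ?_⟩
  filter_upwards [prod_mem_nhds (Metric.ball_mem_nhds p₀ hr) (Metric.ball_mem_nhds p₀ hr)]
  rintro ⟨p, q⟩ ⟨hp, hq⟩ hp0 hq0 hℓ
  simp only at hp hq hp0 hq0 hℓ ⊢
  have hseg : ∀ s ∈ Icc (0 : ℝ) 1, p + s • (q - p) ∈ Metric.ball p₀ r := fun s hs =>
    (convex_ball p₀ r).add_smul_sub_mem hp hq hs
  obtain ⟨ξ, hξ, η, hη, e1, e2⟩ := hG.exists_deriv_eq_hessForm hp0 hq0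
    (fun s hs => (hball _ (hseg s hs)).1)
  have hw : ℓ (q - p) = 0 := by rw [map_sub, hℓ, sub_self]
  rw [norm_sub_rev p q]
  set w := q - p
  have hlow : c / 2 * ‖w‖ ^ 2 ≤ -hessForm G (p + η • w) w w := by
    have h1 := hc2 w hw
    have h2 := (hball _ (hseg η hη)).2.1
    have h3 := (hessForm G (p + η • w) - hessForm G p₀).le_opNorm₂ w w
    rw [Real.norm_eq_abs, sub_apply, sub_apply] at h3
    have h4 := (abs_le.1 h3).2
    have h5 : ‖hessForm G (p + η • w) - hessForm G p₀‖ * ‖w‖ * ‖w‖ ≤ c / 2 * ‖w‖ ^ 2 := by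
      rw [mul_assoc, ← pow_two]; gcongr
    linarith
  have hup : -hessForm G (p + ξ • w) w w ≤ M * ‖w‖ ^ 2 := by
    have h2 := (hball _ (hseg ξ hξ)).2.1
    have h3 := (hessForm G (p + ξ • w)).le_opNorm₂ w w
    rw [Real.norm_eq_abs] at h3
    have h4 := (abs_le.1 h3).1
    have h5 : ‖hessForm G (p + ξ • w)‖ ≤ M := by
      have := norm_le_norm_add_norm_sub' (hessForm G (p + ξ • w)) (hessForm G p₀)
      linarith
    have h6 : ‖hessForm G (p + ξ • w)‖ * ‖w‖ * ‖w‖ ≤ M * ‖w‖ ^ 2 := by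
      rw [mul_assoc, ← pow_two]; gcongr
    linarith
  have hdiff : hessForm G (p + η • w) w w - hessForm G (p + ξ • w) w w ≤ L * ‖w‖ * ‖w‖ ^ 2 := by
    have h1 := hL.dist_le_mul _ (hball _ (hseg η hη)).2.2 _ (hball _ (hseg ξ hξ)).2.2
    rw [dist_eq_norm, dist_eq_norm, add_sub_add_left_eq_sub, ← sub_smul, norm_smul] at h1
    have h2 : ‖η - ξ‖ ≤ 1 := by
      rw [Real.norm_eq_abs, abs_le]
      constructor <;> linarith [hξ.1, hξ.2, hη.1, hη.2]
    have h3 := (hessForm G (p + η • w) - hessForm G (p + ξ • w)).le_opNorm₂ w w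
    rw [Real.norm_eq_abs, sub_apply, sub_apply] at h3
    have h4 := (abs_le.1 h3).2
    have h5 : (L : ℝ) * (‖η - ξ‖ * ‖w‖) ≤ L * ‖w‖ := by
      gcongr
      nlinarith [norm_nonneg w]
    calc _ ≤ ‖hessForm G (p + η • w) - hessForm G (p + ξ • w)‖ * ‖w‖ * ‖w‖ := h4
      _ ≤ (L * ‖w‖) * ‖w‖ * ‖w‖ := by gcongr; exact h1.trans h5
      _ = _ := by ring
  have hN : 0 ≤ ‖w‖ := norm_nonneg w
  have hLc : 0 ≤ 2 * (L : ℝ) / c := by positivity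
  rw [e1, e2]
  set a := -hessForm G (p + ξ • w) w w
  set b := -hessForm G (p + η • w) w w
  constructor
  · nlinarith [mul_nonneg hLc (sq_nonneg ‖w‖), mul_nonneg hM0 (sq_nonneg ‖w‖)]
  · have h1 : a ≤ b + L * ‖w‖ * ‖w‖ ^ 2 := by simp only [a, b]; linarith
    have h2 : L * ‖w‖ * ‖w‖ ^ 2 ≤ 2 * L / c * ‖w‖ * b := by
      calc L * ‖w‖ * ‖w‖ ^ 2 = 2 * L / c * ‖w‖ * (c / 2 * ‖w‖ ^ 2) := by field_simp
        _ ≤ _ := by gcongr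
    have h3 : 0 ≤ b := le_trans (by positivity) hlow
    have h4 : 0 ≤ M * ‖w‖ * b := by positivity
    nlinarith

/-- The form `DG(p) q` on the section `{G = 0, ℓ = 1}` is at most quadratic in `p - q`, and it is
symmetric up to a relative error of first order. -/
theorem exists_pairing_le (hG : IsConeFunction m G ℓ e) : ∃ C : ℝ, 0 ≤ C ∧ ∀ p q,
    G p = 0 → ℓ p = 1 → G q = 0 → ℓ q = 1 → fderiv ℝ G p q ≤ C * ‖p - q‖ ^ 2 ∧
      fderiv ℝ G p q ≤ (1 + C * ‖p - q‖) * fderiv ℝ G q p := by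
  set S := {x : V | G x = 0 ∧ ℓ x = 1} with hS
  have hne : ∀ x ∈ S, x ≠ 0 := by
    rintro x ⟨-, hx⟩ rfl
    simp at hx
  have hK : IsCompact (S ×ˢ S) := hG.isCompact_section.prod hG.isCompact_section
  let P : Set (V × V) → Prop := fun s => ∃ C : ℝ, 0 ≤ C ∧ ∀ z ∈ s, z ∈ S ×ˢ S →
    fderiv ℝ G z.1 z.2 ≤ C * ‖z.1 - z.2‖ ^ 2 ∧
      fderiv ℝ G z.1 z.2 ≤ (1 + C * ‖z.1 - z.2‖) * fderiv ℝ G z.2 z.1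
  have hpos : ∀ z ∈ S ×ˢ S, 0 ≤ fderiv ℝ G z.2 z.1 := by
    rintro z ⟨⟨h1, h2⟩, ⟨h3, h4⟩⟩
    rw [← h1]
    exact hG.le_fderiv (hG.ne_height (hne _ ⟨h3, h4⟩) h3) _
  have key : P (S ×ˢ S) := by
    -- The property passes to finite unions by taking the larger constant, because the pairings are
    -- nonnegative. It remains to find a neighbourhood of each pair: on the diagonal this is the
    -- local estimate, off the diagonal both pairings and the distance are bounded away from zero.
    refine hK.induction_on (p := P) ⟨0, le_rfl, by simp⟩ ?_ ?_ ?_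
    · rintro s t hst ⟨C, hC, h⟩
      exact ⟨C, hC, fun z hz => h z (hst hz)⟩
    · rintro s t ⟨C, hC, h⟩ ⟨D, hD, h'⟩
      refine ⟨max C D, le_max_of_le_left hC, ?_⟩
      have mono : ∀ (A : ℝ) (z : V × V), A ≤ max C D → z ∈ S ×ˢ S →
          fderiv ℝ G z.1 z.2 ≤ A * ‖z.1 - z.2‖ ^ 2 ∧
          fderiv ℝ G z.1 z.2 ≤ (1 + A * ‖z.1 - z.2‖) * fderiv ℝ G z.2 z.1 →
          fderiv ℝ G z.1 z.2 ≤ max C D * ‖z.1 - z.2‖ ^ 2 ∧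
          fderiv ℝ G z.1 z.2 ≤ (1 + max C D * ‖z.1 - z.2‖) * fderiv ℝ G z.2 z.1 := by
        intro A z hA hz h
        have := hpos z hz
        exact ⟨h.1.trans (by gcongr), h.2.trans (by gcongr)⟩
      rintro z (hz | hz) hzS
      · exact mono C z (le_max_left _ _) hzS (h z hz hzS)
      · exact mono D z (le_max_right _ _) hzS (h' z hz hzS)
    · rintro ⟨p, q⟩ ⟨hp, hq⟩
      by_cases hpq : p = q
      · subst hpq
        obtain ⟨C, hC, h⟩ := hG.eventually_pairing_le_diag (hne p hp) hp.1
        refine ⟨_, mem_nhdsWithin_of_mem_nhds h, C, hC, ?_⟩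
        rintro z hz ⟨h1, h2⟩
        exact hz h1.1 h2.1 (h1.2.trans h2.2.symm)
      · have hcp := (hG.contDiffAt_fderiv (hG.ne_height (hne p hp) hp.1)).continuousAt
        have hcq := (hG.contDiffAt_fderiv (hG.ne_height (hne q hq) hq.1)).continuousAt
        have c1 : ContinuousAt (fun z : V × V => fderiv ℝ G z.1 z.2) (p, q) :=
          (ContinuousAt.comp (f := Prod.fst) hcp continuousAt_fst).clm_apply continuousAt_snd
        have c2 : ContinuousAt (fun z : V × V => fderiv ℝ G z.2 z.1) (p, q) :=
          (ContinuousAt.comp (f := Prod.snd) hcq continuousAt_snd).clm_apply continuousAt_fst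
        have c3 : ContinuousAt (fun z : V × V => ‖z.1 - z.2‖) (p, q) := by fun_prop
        set β := fderiv ℝ G q p
        set A := fderiv ℝ G p q
        set δ := ‖p - q‖
        have hβ : 0 < β := hG.fderiv_pos_of_pos (hne q hq) hq.1 hp.1 (hq.2.trans hp.2.symm)
          (Ne.symm hpq)
        have hA : 0 < A := hG.fderiv_pos_of_pos (hne p hp) hp.1 hq.1 (hp.2.trans hq.2.symm) hpq
        have hδ : 0 < δ := norm_pos_iff.2 (sub_ne_zero.2 hpq)
        have n1 := c1.eventually_lt_const (u := 2 * A) (by simp only [A] at hA ⊢; linarith)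
        have n2 := c2.eventually_const_lt (u := β / 2) (by simp only [β] at hβ ⊢; linarith)
        have n3 := c3.eventually_const_lt (u := δ / 2) (by simp only [δ] at hδ ⊢; linarith)
        -- On the neighbourhood the pairing is below `2A`, the reversed one above `β / 2` and the
        -- distance above `δ / 2`. The two summands of `C` are the constants that the two
        -- inequalities need for these bounds.
        set C := 8 * A / δ ^ 2 + 8 * A / (β * δ) with hC
        refine ⟨_, mem_nhdsWithin_of_mem_nhds (n1.and (n2.and n3)), C, by positivity, ?_⟩
        rintro z ⟨h1, h2, h3⟩ -
        have hCa : 8 * A / δ ^ 2 ≤ C := by rw [hC]; linarith [show 0 ≤ 8 * A / (β * δ) by positivity]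
        have hCb : 8 * A / (β * δ) ≤ C := by
          rw [hC]; linarith [show 0 ≤ 8 * A / δ ^ 2 by positivity]
        constructor
        · calc fderiv ℝ G z.1 z.2 ≤ 2 * A := h1.le
            _ = 8 * A / δ ^ 2 * (δ / 2) ^ 2 := by field_simp; norm_num
            _ ≤ C * ‖z.1 - z.2‖ ^ 2 := by gcongr
        · calc fderiv ℝ G z.1 z.2 ≤ 2 * A := h1.le
            _ = (8 * A / (β * δ) * (δ / 2)) * (β / 2) := by field_simp; norm_num
            _ ≤ (1 + C * ‖z.1 - z.2‖) * fderiv ℝ G z.2 z.1 := by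
              gcongr
              have : 8 * A / (β * δ) * (δ / 2) ≤ C * ‖z.1 - z.2‖ := by gcongr
              linarith
  obtain ⟨C, hC, h⟩ := key
  exact ⟨C, hC, fun p q hp hp1 hq hq1 => h (p, q) ⟨⟨hp, hp1⟩, ⟨hq, hq1⟩⟩
    ⟨⟨hp, hp1⟩, ⟨hq, hq1⟩⟩⟩

end FiniteDim

end IsConeFunction

end ConeBilliard

/-! ### Reflections, exit points and the reflected line -/

namespace ConeBilliard

open Filter Topology Set
open scoped ContDiff Gradient

section Reflection

variable {V : Type*} [NormedAddCommGroup V] [InnerProductSpace ℝ V]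

/-- The orthogonal reflection in the hyperplane with (not necessarily unit) normal vector `ν`. -/
def reflectAlong (ν w : V) : V :=
  w - (2 * inner ℝ w ν / ‖ν‖ ^ 2) • ν

theorem reflectAlong_smul (ν : V) (t : ℝ) (w : V) :
    reflectAlong ν (t • w) = t • reflectAlong ν w := by
  simp only [reflectAlong, inner_smul_left, smul_sub, smul_smul]
  congr 2
  simp; ring

theorem reflectAlong_neg (ν w : V) : reflectAlong ν (-w) = -reflectAlong ν w := by
  simpa using reflectAlong_smul ν (-1) w

theorem reflectAlong_add (ν w z : V) :
    reflectAlong ν (w + z) = reflectAlong ν w + reflectAlong ν z := by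
  simp only [reflectAlong, inner_add_left, mul_add, add_div, add_smul]
  abel

theorem reflectAlong_of_inner_eq_zero {ν w : V} (h : inner ℝ w ν = 0) :
    reflectAlong ν w = w := by
  simp [reflectAlong, h]

theorem inner_reflectAlong_normal {ν : V} (hν : ν ≠ 0) (w : V) :
    inner ℝ (reflectAlong ν w) ν = -inner ℝ w ν := by
  have : ‖ν‖ ≠ 0 := norm_ne_zero_iff.2 hν
  rw [reflectAlong, inner_sub_left, inner_smul_left, real_inner_self_eq_norm_sq]
  simp only [conj_trivial]
  field_simp
  ring

theorem reflectAlong_reflectAlong {ν : V} (hν : ν ≠ 0) (w : V) :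
    reflectAlong ν (reflectAlong ν w) = w := by
  conv_lhs => rw [reflectAlong]
  rw [inner_reflectAlong_normal hν, reflectAlong, sub_sub, ← add_smul]
  have : 2 * inner ℝ w ν / ‖ν‖ ^ 2 + 2 * -inner ℝ w ν / ‖ν‖ ^ 2 = 0 := by ring
  rw [this, zero_smul, sub_zero]

theorem inner_reflectAlong_reflectAlong (ν w z : V) :
    inner ℝ (reflectAlong ν w) (reflectAlong ν z) = inner ℝ w z := by
  rcases eq_or_ne ν 0 with rfl | hν
  · simp [reflectAlong]
  have h0 : ‖ν‖ ≠ 0 := norm_ne_zero_iff.2 hν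
  simp only [reflectAlong, inner_sub_left, inner_sub_right, inner_smul_left, inner_smul_right,
    real_inner_self_eq_norm_sq, conj_trivial, real_inner_comm z ν]
  field_simp
  ring

theorem norm_reflectAlong (ν w : V) : ‖reflectAlong ν w‖ = ‖w‖ := by
  rw [← sq_eq_sq₀ (norm_nonneg _) (norm_nonneg _), ← real_inner_self_eq_norm_sq,
    ← real_inner_self_eq_norm_sq, inner_reflectAlong_reflectAlong]

theorem continuousAt_reflectAlong {ν w : V} (hν : ν ≠ 0) :
    ContinuousAt (fun z : V × V => reflectAlong z.1 z.2) (ν, w) := by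
  have h0 : ‖ν‖ ^ 2 ≠ 0 := by simpa using hν
  unfold reflectAlong
  refine continuousAt_snd.sub (ContinuousAt.smul (ContinuousAt.div ?_ ?_ h0) continuousAt_fst)
  all_goals fun_prop

theorem contDiffAt_reflectAlong {X : Type*} [NormedAddCommGroup X] [NormedSpace ℝ X] {n : ℕ∞ω}
    {f g : X → V} {x : X} (hf : ContDiffAt ℝ n f x) (hg : ContDiffAt ℝ n g x) (h0 : f x ≠ 0) :
    ContDiffAt ℝ n (fun y => reflectAlong (f y) (g y)) x := by
  have h1 : ‖f x‖ ^ 2 ≠ 0 := by simpa using h0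
  unfold reflectAlong
  exact hg.sub (((contDiffAt_const.mul (hg.inner ℝ hf)).div (hf.norm_sq ℝ) h1).smul hf)

/-- The line with the opposite orientation. -/
def reverseLine {V : Type*} [NormedAddCommGroup V] (x : V × V) : V × V := (-x.1, x.2)

@[simp] theorem reverseLine_reverseLine {V : Type*} [NormedAddCommGroup V] (x : V × V) :
    reverseLine (reverseLine x) = x := by
  simp [reverseLine]

theorem contDiff_reverseLine {n : ℕ∞ω} : ContDiff ℝ n (reverseLine : V × V → V × V) :=
  contDiff_fst.neg.prodMk contDiff_snd

end Reflection

section Gradient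

variable {V : Type*} [NormedAddCommGroup V] [InnerProductSpace ℝ V] [FiniteDimensional ℝ V]

theorem contDiffAt_gradient {G : V → ℝ} {n : ℕ∞ω} {x : V} (h : ContDiffAt ℝ n (fderiv ℝ G) x) :
    ContDiffAt ℝ n (∇ G) x := by
  let b := stdOrthonormalBasis ℝ V
  have : ∇ G = fun y => ∑ i, fderiv ℝ G y (b i) • b i := by
    ext1 y
    rw [← b.sum_repr' (∇ G y)]
    refine Finset.sum_congr rfl fun i _ => ?_
    rw [real_inner_comm, inner_gradient_left]
  rw [this]
  exact ContDiffAt.sum fun i _ => (h.clm_apply contDiffAt_const).smul contDiffAt_const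

end Gradient

section Exit

variable {V : Type*} [NormedAddCommGroup V] [InnerProductSpace ℝ V]
  {m : ℕ∞ω} {G : V → ℝ} {ℓ : V →L[ℝ] ℝ} {e : V}

/-- The last time at which the line `x.2 + t x.1` is in the cone `{G ≥ 0}`. -/
def exitTime (G : V → ℝ) (x : V × V) : ℝ :=
  sSup {t : ℝ | 0 ≤ G (x.2 + t • x.1)}

/-- The last point of the line `x.2 + t x.1` in the cone `{G ≥ 0}`. -/
def exitPoint (G : V → ℝ) (x : V × V) : V :=
  x.2 + exitTime G x • x.1

/-- The lines that meet the open cone `{G > 0}` and leave the cone at a point that is not the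
vertex. -/
def exitDomain (G : V → ℝ) : Set (V × V) :=
  {x | G x.1 < 0 ∧ (∃ t : ℝ, 0 < G (x.2 + t • x.1)) ∧ exitPoint G x ≠ 0}

namespace IsConeFunction

theorem concave (hG : IsConeFunction m G ℓ e) {a b : ℝ} (ha : 0 ≤ a) (hb : 0 ≤ b) (x y : V) :
    a * G x + b * G y ≤ G (a • x + b • y) := by
  rw [← hG.map_smul a ha, ← hG.map_smul b hb]
  exact hG.superadd _ _

theorem line_pos_of_lt (hG : IsConeFunction m G ℓ e) {x : V × V} {t₀ s t : ℝ}
    (h0 : 0 < G (x.2 + t₀ • x.1)) (ht : 0 ≤ G (x.2 + t • x.1)) (hs : t₀ ≤ s) (hst : s < t) :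
    0 < G (x.2 + s • x.1) := by
  have hd : 0 < t - t₀ := by linarith
  have h1 := hG.concave (a := (t - s) / (t - t₀)) (b := (s - t₀) / (t - t₀))
    (div_nonneg (by linarith) hd.le) (div_nonneg (by linarith) hd.le)
    (x.2 + t₀ • x.1) (x.2 + t • x.1)
  have h2 : ((t - s) / (t - t₀)) • (x.2 + t₀ • x.1) + ((s - t₀) / (t - t₀)) • (x.2 + t • x.1)
      = x.2 + s • x.1 := by
    have e1 : (t - s) / (t - t₀) + (s - t₀) / (t - t₀) = 1 := by field_simp; ring
    have e2 : (t - s) / (t - t₀) * t₀ + (s - t₀) / (t - t₀) * t = s := by field_simp; ring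
    calc _ = ((t - s) / (t - t₀) + (s - t₀) / (t - t₀)) • x.2
        + ((t - s) / (t - t₀) * t₀ + (s - t₀) / (t - t₀) * t) • x.1 := by module
      _ = _ := by rw [e1, e2, one_smul]
  rw [h2] at h1
  have h3 : 0 < (t - s) / (t - t₀) := div_pos (by linarith) hd
  have h4 : 0 ≤ (s - t₀) / (t - t₀) := div_nonneg (by linarith) hd.le
  have h5 := mul_pos h3 h0
  have h6 := mul_nonneg h4 ht
  linarith

/-- Concavity forbids a return to the cone: a later point with `G ≥ 0` would make `G` positive at
the intermediate time `T`. -/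
theorem exitTime_eq (hG : IsConeFunction m G ℓ e) {x : V × V} {t₀ T : ℝ}
    (h0 : 0 < G (x.2 + t₀ • x.1)) (hT : G (x.2 + T • x.1) = 0) (hlt : t₀ < T) :
    exitTime G x = T := by
  refine IsGreatest.csSup_eq ⟨hT.ge, fun t ht => ?_⟩
  by_contra! h
  exact (hG.line_pos_of_lt h0 ht hlt.le h).ne' hT

theorem exists_zero_of_pos_of_neg (hG : IsConeFunction m G ℓ e) {x : V × V} {t₀ t₁ : ℝ}
    (h0 : 0 < G (x.2 + t₀ • x.1)) (h1 : G (x.2 + t₁ • x.1) < 0) (hlt : t₀ < t₁) :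
    t₀ < exitTime G x ∧ exitTime G x < t₁ ∧ G (exitPoint G x) = 0 := by
  have hc : Continuous fun t : ℝ => G (x.2 + t • x.1) := hG.continuous.comp (by fun_prop)
  obtain ⟨T, hT, hT0⟩ := intermediate_value_Icc' hlt.le hc.continuousOn ⟨h1.le, h0.le⟩
  have hT1 : t₀ < T := by
    refine lt_of_le_of_ne hT.1 ?_
    rintro rfl
    exact h0.ne' hT0
  have hT2 : T < t₁ := by
    refine lt_of_le_of_ne hT.2 ?_
    rintro rfl
    exact h1.ne hT0
  have := hG.exitTime_eq h0 hT0 hT1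
  rw [exitPoint, this]
  exact ⟨hT1, hT2, hT0⟩

theorem exit_spec (hG : IsConeFunction m G ℓ e) {x : V × V} (hx : G x.1 < 0) {t₀ : ℝ}
    (h0 : 0 < G (x.2 + t₀ • x.1)) : t₀ < exitTime G x ∧ G (exitPoint G x) = 0 := by
  set A := G (-(x.2 + t₀ • x.1))
  -- With this `s` one has `s * G x.1 = -(|A| + 1)`, and superadditivity then forces `G` to be
  -- negative at time `t₀ + s`.
  set s := (|A| + 1) / -G x.1 with hs
  have hs0 : 0 < s := by
    have := abs_nonneg A
    exact div_pos (by linarith) (by linarith)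
  have h1 : G (x.2 + (t₀ + s) • x.1) < 0 := by
    have h2 := hG.superadd (x.2 + (t₀ + s) • x.1) (-(x.2 + t₀ • x.1))
    have h3 : x.2 + (t₀ + s) • x.1 + -(x.2 + t₀ • x.1) = s • x.1 := by module
    rw [h3, hG.map_smul s hs0.le] at h2
    have h4 : s * G x.1 = -(|A| + 1) := by
      have := hx.ne
      rw [hs]; field_simp
    have h5 := neg_abs_le A
    linarith
  have := hG.exists_zero_of_pos_of_neg h0 h1 (by linarith)
  exact ⟨this.1, this.2.2⟩

theorem exitPoint_zero (hG : IsConeFunction m G ℓ e) {x : V × V} (hx : x ∈ exitDomain G) :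
    G (exitPoint G x) = 0 := by
  obtain ⟨h1, ⟨t, h2⟩, -⟩ := hx
  exact (hG.exit_spec h1 h2).2

theorem exitPoint_ne_height (hG : IsConeFunction m G ℓ e) {x : V × V} (hx : x ∈ exitDomain G) :
    G (exitPoint G x) ≠ ℓ (exitPoint G x) :=
  hG.ne_height hx.2.2 (hG.exitPoint_zero hx)

/-- The tangent functional at the exit point dominates `G`, and `G` is positive at an earlier point
of the line; so the line crosses the boundary transversally. -/
theorem fderiv_exitPoint_neg (hG : IsConeFunction m G ℓ e) {x : V × V} (hx : x ∈ exitDomain G) :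
    fderiv ℝ G (exitPoint G x) x.1 < 0 := by
  obtain ⟨h1, ⟨t, h2⟩, -⟩ := id hx
  obtain ⟨h3, h4⟩ := hG.exit_spec h1 h2
  have hne := hG.exitPoint_ne_height hx
  have h5 : x.2 + t • x.1 = exitPoint G x - (exitTime G x - t) • x.1 := by
    rw [exitPoint]; module
  have h6 := hG.le_fderiv hne (x.2 + t • x.1)
  nth_rw 2 [h5] at h6
  rw [map_sub, hG.fderiv_self hne, h4, _root_.map_smul, smul_eq_mul] at h6
  nlinarith

theorem pos_of_fderiv_neg (hG : IsConeFunction m G ℓ e) {p v : V} (hp : p ≠ 0) (h0 : G p = 0)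
    (hv : fderiv ℝ G p v < 0) : ∃ s : ℝ, 0 < s ∧ 0 < G (p - s • v) := by
  have hd := hG.hasDerivAt_line (p := p) (v := v) (t := 0)
    (by rw [zero_smul, add_zero]; exact hG.ne_height hp h0)
  rw [zero_smul, add_zero] at hd
  have h1 := hd.hasDerivWithinAt (s := Iio 0)
  rw [hasDerivWithinAt_iff_tendsto_slope' (by simp)] at h1
  obtain ⟨t, ht, ht'⟩ := ((h1.eventually_lt_const hv).and self_mem_nhdsWithin).exists
  have ht0 : t < 0 := ht'
  refine ⟨-t, by linarith, ?_⟩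
  rw [slope_def_field, zero_smul, add_zero, h0, sub_zero, sub_zero, div_lt_iff_of_neg ht0,
    zero_mul] at ht
  rwa [neg_smul, sub_neg_eq_add]

theorem mem_exitDomain_of_fderiv_neg (hG : IsConeFunction m G ℓ e) {x : V × V} {t : ℝ}
    (hp : x.2 + t • x.1 ≠ 0) (h0 : G (x.2 + t • x.1) = 0)
    (hv : fderiv ℝ G (x.2 + t • x.1) x.1 < 0) :
    x ∈ exitDomain G ∧ exitTime G x = t ∧ exitPoint G x = x.2 + t • x.1 := by
  obtain ⟨s, hs, hs'⟩ := hG.pos_of_fderiv_neg hp h0 hv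
  have e1 : x.2 + t • x.1 - s • x.1 = x.2 + (t - s) • x.1 := by module
  rw [e1] at hs'
  have hT := hG.exitTime_eq hs' h0 (by linarith)
  have hP : exitPoint G x = x.2 + t • x.1 := by rw [exitPoint, hT]
  refine ⟨⟨(hG.le_fderiv (hG.ne_height hp h0) _).trans_lt hv, ⟨_, hs'⟩, by rwa [hP]⟩, hT, hP⟩

theorem continuousAt_exitTime (hG : IsConeFunction m G ℓ e) {x : V × V} (hx : G x.1 < 0)
    (h0 : ∃ t : ℝ, 0 < G (x.2 + t • x.1)) : ContinuousAt (exitTime G) x := by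
  obtain ⟨t₀, ht₀⟩ := h0
  obtain ⟨h1, h2⟩ := hG.exit_spec hx ht₀
  set T := exitTime G x with hT
  have hc : ∀ t : ℝ, Continuous fun y : V × V => G (y.2 + t • y.1) := fun t =>
    hG.continuous.comp (by fun_prop)
  rw [Metric.continuousAt_iff']
  intro ε hε
  -- `G` is positive at `a` and negative at `T + ε`. Both signs survive a small perturbation of the
  -- line and trap its exit time between these two values.
  set a := max t₀ (T - ε) with ha
  have haT : a < T := max_lt h1 (by linarith)
  have hpos : 0 < G (x.2 + a • x.1) :=
    hG.line_pos_of_lt ht₀ h2.ge (le_max_left _ _) haT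
  have hneg : G (x.2 + (T + ε) • x.1) < 0 := by
    by_contra! h
    exact (hG.line_pos_of_lt ht₀ h h1.le (by linarith)).ne' h2
  filter_upwards [(hc a).continuousAt.eventually_const_lt hpos,
    (hc (T + ε)).continuousAt.eventually_lt_const hneg] with y hy1 hy2
  obtain ⟨h3, h4, -⟩ := hG.exists_zero_of_pos_of_neg hy1 hy2 (by linarith)
  have h5 : T - ε ≤ a := le_max_right _ _
  rw [Real.dist_eq, abs_lt]
  constructor <;> linarith

theorem eventually_mem_exitDomain (hG : IsConeFunction m G ℓ e) {x : V × V}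
    (hx : x ∈ exitDomain G) : ∀ᶠ y in 𝓝 x, y ∈ exitDomain G := by
  obtain ⟨h1, ⟨t, h2⟩, h3⟩ := hx
  have c1 : ContinuousAt (fun y : V × V => G y.1) x :=
    (hG.continuous.comp continuous_fst).continuousAt
  have c2 : ContinuousAt (fun y : V × V => G (y.2 + t • y.1)) x :=
    (hG.continuous.comp (by fun_prop)).continuousAt
  have c3 : ContinuousAt (exitPoint G) x :=
    continuousAt_snd.add ((hG.continuousAt_exitTime h1 ⟨t, h2⟩).smul continuousAt_fst)
  filter_upwards [c1.eventually_lt_const h1, c2.eventually_const_lt h2, c3.eventually_ne h3]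
    with y hy1 hy2 hy3
  exact ⟨hy1, ⟨t, hy2⟩, hy3⟩

theorem gradient_ne_zero (hG : IsConeFunction m G ℓ e) [CompleteSpace V] {x : V}
    (hx : G x ≠ ℓ x) : ∇ G x ≠ 0 := by
  intro h
  have h1 := hG.fderiv_axis hx
  rw [← inner_gradient_left, h, inner_zero_left] at h1
  exact zero_ne_one h1

theorem inner_gradient_self (hG : IsConeFunction m G ℓ e) [CompleteSpace V] {x : V}
    (hx : G x ≠ ℓ x) : inner ℝ x (∇ G x) = G x := by
  rw [real_inner_comm, inner_gradient_left, hG.fderiv_self hx]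

theorem gradient_smul (hG : IsConeFunction m G ℓ e) [CompleteSpace V] {t : ℝ} (ht : 0 < t)
    (x : V) : ∇ G (t • x) = ∇ G x := by
  rw [gradient, gradient, hG.fderiv_smul ht]

end IsConeFunction

theorem isInvertible_of_apply_one_ne_zero {L : ℝ →L[ℝ] ℝ} (h : L 1 ≠ 0) : L.IsInvertible :=
  ⟨ContinuousLinearEquiv.unitsEquivAut ℝ (Units.mk0 (L 1) h), by ext; simp⟩

namespace IsConeFunction

variable [FiniteDimensional ℝ V]

/-- The implicit function theorem, applicable by transversality at the exit point. The exit time is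
known to be continuous, so it must be the local branch that the theorem supplies. -/
theorem contDiffAt_exitTime (hG : IsConeFunction m G ℓ e) {x : V × V} (hx : x ∈ exitDomain G) :
    ContDiffAt ℝ m (exitTime G) x := by
  set T := exitTime G x with hT
  let f : (V × V) × ℝ → ℝ := fun z => G (z.1.2 + z.2 • z.1.1)
  have hne : G (x.2 + T • x.1) ≠ ℓ (x.2 + T • x.1) := hG.exitPoint_ne_height hx
  have hf : ContDiffAt ℝ m f (x, T) := by
    refine ContDiffAt.comp (g := G) (f := fun z : (V × V) × ℝ => z.1.2 + z.2 • z.1.1) (x, T)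
      (hG.contDiffAt _ hne) ?_
    fun_prop
  have hinr : (fderiv ℝ f (x, T) ∘L .inr ℝ (V × V) ℝ) 1 = fderiv ℝ G (x.2 + T • x.1) x.1 := by
    have h1 : HasFDerivAt (fun s : ℝ => f (x, s)) (fderiv ℝ f (x, T) ∘L .inr ℝ (V × V) ℝ) T :=
      (hf.differentiableAt hG.m_ne_zero).hasFDerivAt.comp T (hasFDerivAt_prodMk_right x T)
    exact h1.hasDerivAt.unique (hG.hasDerivAt_line hne)
  have hinv : (fderiv ℝ f (x, T) ∘L .inr ℝ (V × V) ℝ).IsInvertible :=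
    isInvertible_of_apply_one_ne_zero (by rw [hinr]; exact (hG.fderiv_exitPoint_neg hx).ne)
  refine (hf.contDiffAt_implicitFunction hG.m_ne_zero hinv).congr_of_eventuallyEq ?_
  have h2 := hf.eventually_apply_eq_iff_implicitFunction hG.m_ne_zero hinv
  have hcont : ContinuousAt (fun y => (y, exitTime G y)) x :=
    continuousAt_id.prodMk (hG.continuousAt_exitTime hx.1 hx.2.1)
  filter_upwards [hcont.eventually h2, hG.eventually_mem_exitDomain hx] with y hy1 hy2
  refine (hy1.1 ?_).symm
  have e1 : f (y, exitTime G y) = 0 := hG.exitPoint_zero hy2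
  have e2 : f (x, T) = 0 := hG.exitPoint_zero hx
  rw [e1, e2]

end IsConeFunction

end Exit

section Bounce

variable {V : Type*} [NormedAddCommGroup V] [InnerProductSpace ℝ V] [FiniteDimensional ℝ V]
  {m : ℕ∞ω} {G : V → ℝ} {ℓ : V →L[ℝ] ℝ} {e : V}

/-- Reflection of a line at its exit point, as a map of the ambient space. -/
def bounce (G : V → ℝ) (x : V × V) : V × V :=
  (reflectAlong (∇ G (exitPoint G x)) x.1, reflectAlong (∇ G (exitPoint G x)) x.2)

theorem inner_bounce (x : V × V) : inner ℝ (bounce G x).1 (bounce G x).2 = inner ℝ x.1 x.2 :=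
  inner_reflectAlong_reflectAlong _ _ _

theorem norm_bounce_fst (x : V × V) : ‖(bounce G x).1‖ = ‖x.1‖ := norm_reflectAlong _ _

theorem norm_bounce_snd (x : V × V) : ‖(bounce G x).2‖ = ‖x.2‖ := norm_reflectAlong _ _

namespace IsConeFunction

/-- By Euler's identity the exit point is orthogonal to the normal, hence fixed by the reflection.
This is why reflecting `Q` together with `v` gives the correct line, with an unchanged time
parameter. -/
theorem bounce_line_exitTime (hG : IsConeFunction m G ℓ e) {x : V × V} (hx : x ∈ exitDomain G) :
    (bounce G x).2 + exitTime G x • (bounce G x).1 = exitPoint G x := by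
  rw [bounce, ← reflectAlong_smul, ← reflectAlong_add]
  refine reflectAlong_of_inner_eq_zero ?_
  exact (hG.inner_gradient_self (hG.exitPoint_ne_height hx)).trans (hG.exitPoint_zero hx)

theorem fderiv_bounce_fst (hG : IsConeFunction m G ℓ e) {x : V × V} (hx : x ∈ exitDomain G) :
    fderiv ℝ G (exitPoint G x) (bounce G x).1 = -fderiv ℝ G (exitPoint G x) x.1 := by
  rw [← inner_gradient_left, ← inner_gradient_left, real_inner_comm, real_inner_comm x.1, bounce,
    inner_reflectAlong_normal (hG.gradient_ne_zero (hG.exitPoint_ne_height hx))]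

/-- Time reversal. It supplies an explicit local inverse of `bounce`, from which injectivity,
injectivity of the differential and openness on the space of lines are deduced. -/
theorem reverse_bounce (hG : IsConeFunction m G ℓ e) {x : V × V} (hx : x ∈ exitDomain G) :
    reverseLine (bounce G x) ∈ exitDomain G ∧
      bounce G (reverseLine (bounce G x)) = reverseLine x := by
  have e1 : (reverseLine (bounce G x)).2 + (-exitTime G x) • (reverseLine (bounce G x)).1
      = exitPoint G x := by
    rw [← hG.bounce_line_exitTime hx, reverseLine]; module
  have h1 := hG.mem_exitDomain_of_fderiv_neg (x := reverseLine (bounce G x)) (t := -exitTime G x)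
    (by rw [e1]; exact hx.2.2) (by rw [e1]; exact hG.exitPoint_zero hx)
    (by
      rw [e1, reverseLine, map_neg, hG.fderiv_bounce_fst hx, neg_neg]
      exact hG.fderiv_exitPoint_neg hx)
  refine ⟨h1.1, ?_⟩
  have hν := hG.gradient_ne_zero (hG.exitPoint_ne_height hx)
  rw [bounce, h1.2.2, e1]
  simp only [reverseLine, bounce, reflectAlong_neg, reflectAlong_reflectAlong hν]

theorem exists_bounce_pos (hG : IsConeFunction m G ℓ e) {x : V × V} (hx : x ∈ exitDomain G) :
    ∃ t : ℝ, exitTime G x < t ∧ 0 < G ((bounce G x).2 + t • (bounce G x).1) := by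
  obtain ⟨s, hs, hs'⟩ := hG.pos_of_fderiv_neg (v := -(bounce G x).1) hx.2.2
    (hG.exitPoint_zero hx) (by
      rw [map_neg, hG.fderiv_bounce_fst hx, neg_neg]; exact hG.fderiv_exitPoint_neg hx)
  refine ⟨exitTime G x + s, by linarith, ?_⟩
  rw [← hG.bounce_line_exitTime hx] at hs'
  convert hs' using 2
  module

theorem bounce_injOn (hG : IsConeFunction m G ℓ e) : InjOn (bounce G) (exitDomain G) := by
  intro x hx y hy h
  have h1 := (hG.reverse_bounce hx).2
  rw [h, (hG.reverse_bounce hy).2] at h1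
  rw [← reverseLine_reverseLine x, ← h1, reverseLine_reverseLine]

theorem contDiffAt_bounce (hG : IsConeFunction m G ℓ e) {k : ℕ∞ω} (hk : k + 1 ≤ m) {x : V × V}
    (hx : x ∈ exitDomain G) : ContDiffAt ℝ k (bounce G) x := by
  have hkm : k ≤ m := le_trans le_self_add hk
  have h1 : ContDiffAt ℝ k (exitPoint G) x :=
    contDiffAt_snd.add (((hG.contDiffAt_exitTime hx).of_le hkm).smul contDiffAt_fst)
  have hne := hG.exitPoint_ne_height hx
  have h2 : ContDiffAt ℝ k (∇ G) (exitPoint G x) :=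
    contDiffAt_gradient ((hG.contDiffAt _ hne).fderiv_right hk)
  have h3 : ContDiffAt ℝ k (fun y => ∇ G (exitPoint G y)) x := h2.comp x h1
  exact (contDiffAt_reflectAlong h3 contDiffAt_fst (hG.gradient_ne_zero hne)).prodMk
    (contDiffAt_reflectAlong h3 contDiffAt_snd (hG.gradient_ne_zero hne))

theorem fderiv_bounce_injective (hG : IsConeFunction m G ℓ e) {x : V × V}
    (hx : x ∈ exitDomain G) {w : V × V} (hw : fderiv ℝ (bounce G) x w = 0) : w = 0 := by
  have h1m : (1 : ℕ∞ω) + 1 ≤ m := le_trans (by norm_num) hG.three_le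
  have hrev : ∀ y : V × V, DifferentiableAt ℝ (reverseLine : V × V → V × V) y := fun y =>
    (contDiff_reverseLine (n := 1)).contDiffAt.differentiableAt one_ne_zero
  have hB := ((hG.contDiffAt_bounce h1m hx).differentiableAt one_ne_zero).hasFDerivAt
  have hB' := (hG.contDiffAt_bounce h1m (hG.reverse_bounce hx).1).differentiableAt one_ne_zero
  have hR : DifferentiableAt ℝ (fun y => reverseLine (bounce G (reverseLine y))) (bounce G x) :=
    (hrev _).comp _ (hB'.comp (bounce G x) (hrev _))
  have h2 := hR.hasFDerivAt.comp x hB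
  have h3 := h2.unique ((hasFDerivAt_id x).congr_of_eventuallyEq (by
    filter_upwards [hG.eventually_mem_exitDomain hx] with y hy
    simp [(hG.reverse_bounce hy).2]))
  have h4 := congrArg (fun L => L w) h3
  simp only [ContinuousLinearMap.comp_apply, hw, _root_.map_zero,
    ContinuousLinearMap.id_apply] at h4
  exact h4.symm

/-- Differentiation of the identities saying that `bounce` preserves `‖v‖²` and `⟪v, Q⟫` on the
whole ambient space; tangent vectors of the space of lines therefore go to tangent vectors. -/
theorem fderiv_bounce_tangent (hG : IsConeFunction m G ℓ e) {x : V × V}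
    (hx : x ∈ exitDomain G) (w : V × V) :
    inner ℝ (bounce G x).1 (fderiv ℝ (bounce G) x w).1 = inner ℝ x.1 w.1 ∧
      inner ℝ (fderiv ℝ (bounce G) x w).1 (bounce G x).2 +
        inner ℝ (bounce G x).1 (fderiv ℝ (bounce G) x w).2 =
          inner ℝ w.1 x.2 + inner ℝ x.1 w.2 := by
  have h1m : (1 : ℕ∞ω) + 1 ≤ m := le_trans (by norm_num) hG.three_le
  have hB := ((hG.contDiffAt_bounce h1m hx).differentiableAt one_ne_zero).hasFDerivAt
  have hB1 := hB.fst
  have hB2 := hB.snd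
  have hi1 : HasFDerivAt (fun y : V × V => y.1) (ContinuousLinearMap.fst ℝ V V) x :=
    hasFDerivAt_fst
  have hi2 : HasFDerivAt (fun y : V × V => y.2) (ContinuousLinearMap.snd ℝ V V) x :=
    hasFDerivAt_snd
  have e1 : (fun y => inner ℝ (bounce G y).1 (bounce G y).1)
      = fun y : V × V => (inner ℝ y.1 y.1 : ℝ) := by
    ext y; exact inner_reflectAlong_reflectAlong _ _ _
  have e2 : (fun y => inner ℝ (bounce G y).1 (bounce G y).2)
      = fun y : V × V => (inner ℝ y.1 y.2 : ℝ) := by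
    ext y; exact inner_bounce y
  have h1 := (hB1.inner ℝ hB1)
  have h2 := (hB1.inner ℝ hB2)
  rw [e1] at h1
  rw [e2] at h2
  have h3 := congrArg (fun L => L w) (h1.unique (hi1.inner ℝ hi1))
  have h4 := congrArg (fun L => L w) (h2.unique (hi1.inner ℝ hi2))
  simp [fderivInnerCLM_apply] at h3 h4
  rw [real_inner_comm (bounce G x).1, real_inner_comm x.1] at h3
  constructor
  · linarith
  · linarith

/-- Lines close to a line that is asymptotic to the boundary of the cone are reflected at most
once. -/
theorem bounce_near_asymptotic (hG : IsConeFunction m G ℓ e) {z : V × V} (hz : z.1 ≠ 0)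
    (hz0 : G z.1 = 0) (hpos : 0 < fderiv ℝ G z.1 z.2) :
    Tendsto (bounce G) (𝓝[{y | G y.1 < 0}] z) (𝓝 (z.1, reflectAlong (∇ G z.1) z.2)) ∧
    ∀ᶠ y in 𝓝[{y | G y.1 < 0}] z, y ∈ exitDomain G ∧ 0 < G (bounce G y).1 := by
  have hne := hG.ne_height hz hz0
  have hν := hG.gradient_ne_zero hne
  set F := 𝓝[{y : V × V | G y.1 < 0}] z with hF
  have hfst : Tendsto (fun y : V × V => y.1) F (𝓝 z.1) :=
    continuousAt_fst.tendsto.mono_left nhdsWithin_le_nhds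
  have hsnd : Tendsto (fun y : V × V => y.2) F (𝓝 z.2) :=
    continuousAt_snd.tendsto.mono_left nhdsWithin_le_nhds
  have hneg : ∀ᶠ y in F, G y.1 < 0 := self_mem_nhdsWithin
  obtain ⟨s, hs, hs'⟩ := hG.pos_of_fderiv_neg (v := -z.2) hz hz0 (by rw [map_neg]; linarith)
  -- The asymptotic line itself stays in the open cone from time `s⁻¹` on. Nearby lines thus stay
  -- inside for arbitrarily long, and their exit times tend to infinity.
  have hray : ∀ t, s⁻¹ ≤ t → 0 < G (z.2 + t • z.1) := by
    intro t ht
    have e1 : z.2 + t • z.1 = s⁻¹ • (z.1 - s • -z.2) + (t - s⁻¹) • z.1 := by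
      have : s⁻¹ * s = 1 := inv_mul_cancel₀ hs.ne'
      rw [smul_neg, sub_neg_eq_add, smul_add, smul_smul, this, one_smul]
      module
    have h2 := hG.concave (a := s⁻¹) (b := t - s⁻¹) (by positivity) (by linarith)
      (z.1 - s • -z.2) z.1
    rw [← e1, hz0, mul_zero, add_zero] at h2
    exact lt_of_lt_of_le (mul_pos (inv_pos.2 hs) hs') h2
  have hevpos : ∀ t, s⁻¹ ≤ t → ∀ᶠ y : V × V in F, 0 < G (y.2 + t • y.1) := by
    intro t ht
    have c : ContinuousAt (fun y : V × V => G (y.2 + t • y.1)) z :=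
      (hG.continuous.comp (by fun_prop)).continuousAt
    exact nhdsWithin_le_nhds (c.eventually_const_lt (hray t ht))
  have hT : Tendsto (exitTime G) F atTop := by
    refine tendsto_atTop.2 fun t => ?_
    filter_upwards [hneg, hevpos (max t s⁻¹) (le_max_right _ _)] with y h1 h2
    exact (le_max_left _ _).trans (hG.exit_spec h1 h2).1.le
  have hTinv : Tendsto (fun y => (exitTime G y)⁻¹) F (𝓝 0) := tendsto_inv_atTop_zero.comp hT
  have hTpos : ∀ᶠ y in F, 0 < exitTime G y := hT.eventually_gt_atTop 0
  -- The exit point runs off to infinity, but its rescaling `P` converges to `z.1`. As `∇G` is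
  -- homogeneous of degree zero, the normals at the exit points converge to `∇G z.1`.
  set P : V × V → V := fun y => y.1 + (exitTime G y)⁻¹ • y.2 with hP
  have hPlim : Tendsto P F (𝓝 z.1) := by
    have := hfst.add (hTinv.smul hsnd)
    rwa [zero_smul, add_zero] at this
  have hPe : ∀ᶠ y in F, exitPoint G y = exitTime G y • P y := by
    filter_upwards [hTpos] with y hy
    rw [hP, exitPoint, smul_add, smul_smul, mul_inv_cancel₀ hy.ne', one_smul, add_comm]
  have hD : ∀ᶠ y in F, y ∈ exitDomain G := by
    filter_upwards [hneg, hevpos s⁻¹ le_rfl, hPe, hTpos, hPlim.eventually_ne hz]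
      with y h1 h2 h3 h4 h5
    exact ⟨h1, ⟨_, h2⟩, by rw [h3]; exact smul_ne_zero h4.ne' h5⟩
  have hgrad : ContinuousAt (∇ G) z.1 :=
    (contDiffAt_gradient (hG.contDiffAt_fderiv hne)).continuousAt
  have hνlim : Tendsto (fun y => ∇ G (exitPoint G y)) F (𝓝 (∇ G z.1)) := by
    refine (hgrad.tendsto.comp hPlim).congr' ?_
    filter_upwards [hPe, hTpos] with y h1 h2
    rw [h1, hG.gradient_smul h2, Function.comp]
  have hlim1 : Tendsto (fun y => (bounce G y).1) F (𝓝 z.1) := by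
    have := (continuousAt_reflectAlong (w := z.1) hν).tendsto.comp (hνlim.prodMk_nhds hfst)
    have e1 : reflectAlong (∇ G z.1) z.1 = z.1 :=
      reflectAlong_of_inner_eq_zero ((hG.inner_gradient_self hne).trans hz0)
    simp only [e1] at this
    exact this
  have hlim2 : Tendsto (fun y => (bounce G y).2) F (𝓝 (reflectAlong (∇ G z.1) z.2)) :=
    (continuousAt_reflectAlong (w := z.2) hν).tendsto.comp (hνlim.prodMk_nhds hsnd)
  refine ⟨hlim1.prodMk_nhds hlim2, ?_⟩
  -- The reflection reverses the normal component of `Q`, so the limit is `DG(v) Q`, which is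
  -- positive by assumption.
  have hD' : Tendsto (fun y => fderiv ℝ G (bounce G y).1 (-(bounce G y).2)) F
      (𝓝 (fderiv ℝ G z.1 (-reflectAlong (∇ G z.1) z.2))) := by
    have c1 : Tendsto (fun y => fderiv ℝ G (bounce G y).1) F (𝓝 (fderiv ℝ G z.1)) :=
      (hG.contDiffAt_fderiv hne).continuousAt.tendsto.comp hlim1
    exact ((isBoundedBilinearMap_apply (𝕜 := ℝ) (E := V) (F := ℝ)).continuous.tendsto
      (fderiv ℝ G z.1, -reflectAlong (∇ G z.1) z.2)).comp (c1.prodMk_nhds hlim2.neg)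
  have hval : fderiv ℝ G z.1 (-reflectAlong (∇ G z.1) z.2) = fderiv ℝ G z.1 z.2 := by
    rw [← inner_gradient_left, ← inner_gradient_left, inner_neg_right, real_inner_comm,
      inner_reflectAlong_normal hν, neg_neg, real_inner_comm]
  rw [hval] at hD'
  filter_upwards [hD, hTpos, hPe, hD'.eventually_const_lt hpos,
    hlim1.eventually (hG.eventually_ne_height hne)] with y h1 h2 h3 h4 h5
  refine ⟨h1, ?_⟩
  have hGP : G (P y) = 0 := by
    have := hG.exitPoint_zero h1
    rw [h3, hG.map_smul _ h2.le] at this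
    exact (mul_eq_zero.1 this).resolve_left h2.ne'
  -- Apply `DG` at the reflected direction `v'` to this decomposition. The left side becomes `G v'`
  -- by Euler, the `P` term is at least `G (P y) = 0`, and the last term is positive: the reflected
  -- line escapes.
  have e1 : (bounce G y).1 = P y + (exitTime G y)⁻¹ • -(bounce G y).2 := by
    have h6 := hG.bounce_line_exitTime h1
    rw [h3] at h6
    have h7 : exitTime G y • (bounce G y).1 = exitTime G y • P y - (bounce G y).2 := by
      rw [← h6]; abel
    have h8 := congrArg (fun u => (exitTime G y)⁻¹ • u) h7
    simp only [smul_sub, smul_smul, inv_mul_cancel₀ h2.ne', one_smul] at h8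
    rw [h8, smul_neg, sub_eq_add_neg]
  have h6 := hG.fderiv_self h5
  nth_rw 2 [e1] at h6
  rw [map_add, _root_.map_smul, smul_eq_mul] at h6
  have h7 := hG.le_fderiv h5 (P y)
  rw [hGP] at h7
  have h8 := mul_pos (inv_pos.2 h2) h4
  linarith

end IsConeFunction

end Bounce

end ConeBilliard

/-! ### Finiteness of the number of reflections -/

namespace ConeBilliard

open Filter Topology Set
open scoped ContDiff Gradient

/-- The left side is the sine of the right side. -/
theorem div_sqrt_mul_sqrt_le_arctan_sub {a b : ℝ} (hab : a ≤ b) :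
    (b - a) / (√(1 + a ^ 2) * √(1 + b ^ 2)) ≤ Real.arctan b - Real.arctan a := by
  have h1 : Real.sin (Real.arctan b - Real.arctan a)
      = (b - a) / (√(1 + a ^ 2) * √(1 + b ^ 2)) := by
    rw [Real.sin_sub, Real.sin_arctan, Real.sin_arctan, Real.cos_arctan, Real.cos_arctan]
    have ha : 0 < √(1 + a ^ 2) := Real.sqrt_pos.2 (by positivity)
    have hb : 0 < √(1 + b ^ 2) := Real.sqrt_pos.2 (by positivity)
    field_simp
  rw [← h1]
  exact Real.sin_le (sub_nonneg.2 (Real.arctan_mono hab))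

/-- There is no infinite sequence of positive `b i` that decreases by factors at most `1 + C δ i`
and is dominated by a summable multiple of `δ i`. -/
theorem not_forall_decay {δ b : ℕ → ℝ} {C M A : ℝ} (hC : 0 ≤ C) (hb : ∀ i, 0 < b i)
    (hδ : ∀ i, 0 ≤ δ i) (h1 : ∀ i, b i ≤ (1 + C * δ i) * b (i + 1)) (h2 : ∀ i, b i ≤ M * δ i)
    (h3 : ∀ N, ∑ i ∈ Finset.range N, δ i ≤ A) : False := by
  have h4 : ∀ N, b 0 ≤ Real.exp (C * ∑ i ∈ Finset.range N, δ i) * b N := by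
    intro N
    induction N with
    | zero => simp
    | succ N ih =>
      rw [Finset.sum_range_succ, mul_add, Real.exp_add]
      calc b 0 ≤ Real.exp (C * ∑ i ∈ Finset.range N, δ i) * b N := ih
        _ ≤ Real.exp (C * ∑ i ∈ Finset.range N, δ i) * ((1 + C * δ N) * b (N + 1)) := by
          gcongr; exact h1 N
        _ ≤ Real.exp (C * ∑ i ∈ Finset.range N, δ i) * (Real.exp (C * δ N) * b (N + 1)) := by
          have := (hb (N + 1)).le
          gcongr
          linarith [Real.add_one_le_exp (C * δ N)]
        _ = _ := by ring
  have h5 : ∀ N, b 0 ≤ Real.exp (C * A) * b N := by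
    intro N
    have := (hb N).le
    refine (h4 N).trans ?_
    gcongr
    exact h3 N
  have hM : 0 < M := by
    by_contra! h
    nlinarith [h2 0, hb 0, hδ 0]
  -- The product of the factors `1 + C δ i` is at most `exp (C A)`, so `b` is bounded below. Since
  -- `b i ≤ M δ i`, every `δ i` is at least `η`, and the partial sums cannot stay below `A`.
  set η := b 0 / (Real.exp (C * A) * M) with hη
  have hη0 : 0 < η := div_pos (hb 0) (by positivity)
  have h6 : ∀ N, η ≤ δ N := by
    intro N
    rw [hη, div_le_iff₀ (by positivity)]
    calc b 0 ≤ Real.exp (C * A) * b N := h5 N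
      _ ≤ Real.exp (C * A) * (M * δ N) := by gcongr; exact h2 N
      _ = _ := by ring
  obtain ⟨N, hN⟩ := exists_nat_gt (A / η)
  have h7 : N * η ≤ A := by
    refine le_trans ?_ (h3 N)
    simpa using Finset.sum_le_sum (s := Finset.range N) fun i _ => h6 i
  rw [div_lt_iff₀ hη0] at hN
  linarith

section Finiteness

variable {V : Type*} [NormedAddCommGroup V] [InnerProductSpace ℝ V]
  {m : ℕ∞ω} {G : V → ℝ} {ℓ : V →L[ℝ] ℝ} {e : V}

namespace IsConeFunction

/-- The combination `ℓ q • p - ℓ p • q` equals `τ • (ℓ v • Q - ℓ Q • v)`, in which the position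
along the line has cancelled. -/
theorem norm_section_sub_le {p q v Q : V} {T τ : ℝ} (hp : p = Q + T • v) (hq : q = p + τ • v)
    (hτ : 0 < τ) (hℓp : 0 < ℓ p) (hℓq : 0 < ℓ q) (hv : ‖v‖ = 1) :
    ‖(ℓ p)⁻¹ • p - (ℓ q)⁻¹ • q‖ ≤ 2 * ‖ℓ‖ * τ * ‖Q‖ / (ℓ p * ℓ q) := by
  have h1 : (ℓ p)⁻¹ • p - (ℓ q)⁻¹ • q = (τ / (ℓ p * ℓ q)) • (ℓ v • Q - ℓ Q • v) := by
    have e1 : (ℓ p)⁻¹ • p - (ℓ q)⁻¹ • q = (ℓ p * ℓ q)⁻¹ • (ℓ q • p - ℓ p • q) := by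
      rw [smul_sub, smul_smul, smul_smul]
      congr 2 <;> field_simp
    have e2 : ℓ q • p - ℓ p • q = τ • (ℓ v • Q - ℓ Q • v) := by
      rw [hq, hp]
      simp only [map_add, _root_.map_smul, smul_eq_mul]
      module
    rw [e1, e2, smul_smul]
    congr 1
    field_simp
  have h2 : ‖ℓ v • Q - ℓ Q • v‖ ≤ 2 * ‖ℓ‖ * ‖Q‖ := by
    refine (norm_sub_le _ _).trans ?_
    rw [norm_smul, norm_smul, hv]
    have a1 := ℓ.le_opNorm v
    have a2 := ℓ.le_opNorm Q
    rw [hv, mul_one] at a1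
    have := mul_le_mul_of_nonneg_right a1 (norm_nonneg Q)
    linarith
  rw [h1, norm_smul, Real.norm_of_nonneg (by positivity)]
  calc τ / (ℓ p * ℓ q) * ‖ℓ v • Q - ℓ Q • v‖ ≤ τ / (ℓ p * ℓ q) * (2 * ‖ℓ‖ * ‖Q‖) := by gcongr
    _ = _ := by ring

theorem norm_eq_mul_sqrt {v Q : V} (hv : ‖v‖ = 1) (hvQ : inner ℝ v Q = 0) (hQ : Q ≠ 0) (T : ℝ) :
    ‖Q + T • v‖ = ‖Q‖ * √(1 + (T / ‖Q‖) ^ 2) := by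
  have hQ' : 0 < ‖Q‖ := norm_pos_iff.2 hQ
  rw [← sq_eq_sq₀ (norm_nonneg _) (by positivity), mul_pow, Real.sq_sqrt (by positivity),
    norm_add_sq_real, inner_smul_right, real_inner_comm, hvQ, norm_smul, hv]
  field_simp
  simp

/-- A billiard trajectory has only finitely many reflections. -/
theorem exists_iterate_nonneg [FiniteDimensional ℝ V] (hG : IsConeFunction m G ℓ e) {x : V × V} (hv : ‖x.1‖ = 1)
    (hvQ : inner ℝ x.1 x.2 = 0) (hQ : x.2 ≠ 0) (h0 : ∃ t : ℝ, 0 < G (x.2 + t • x.1)) :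
    ∃ N, 0 ≤ G ((bounce G)^[N] x).1 := by
  by_contra! hneg
  set X : ℕ → V × V := fun i => (bounce G)^[i] x with hX
  have hsucc : ∀ i, X (i + 1) = bounce G (X i) := fun i => Function.iterate_succ_apply' _ _ _
  have hX1 : ∀ i, ‖(X i).1‖ = 1 := by
    intro i
    induction i with
    | zero => exact hv
    | succ i ih => rw [hsucc, norm_bounce_fst, ih]
  have hX2 : ∀ i, ‖(X i).2‖ = ‖x.2‖ := by
    intro i
    induction i with
    | zero => rfl
    | succ i ih => rw [hsucc, norm_bounce_snd, ih]
  have hX3 : ∀ i, inner ℝ (X i).1 (X i).2 = 0 := by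
    intro i
    induction i with
    | zero => exact hvQ
    | succ i ih => rw [hsucc, inner_bounce, ih]
  have hρ : 0 < ‖x.2‖ := norm_pos_iff.2 hQ
  have hX2' : ∀ i, (X i).2 ≠ 0 := fun i => norm_pos_iff.1 (by rw [hX2]; exact hρ)
  have hmem : ∀ i, (∃ t : ℝ, 0 < G ((X i).2 + t • (X i).1)) → X i ∈ exitDomain G := by
    intro i h
    refine ⟨hneg i, h, norm_pos_iff.1 ?_⟩
    rw [exitPoint, norm_eq_mul_sqrt (hX1 i) (hX3 i) (hX2' i), hX2]
    positivity
  have hD : ∀ i, X i ∈ exitDomain G := by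
    intro i
    induction i with
    | zero => exact hmem 0 h0
    | succ i ih =>
      obtain ⟨t, -, ht⟩ := hG.exists_bounce_pos ih
      exact hmem _ ⟨t, by rw [hsucc]; exact ht⟩
  set T : ℕ → ℝ := fun i => exitTime G (X i) with hT
  set p : ℕ → V := fun i => exitPoint G (X i) with hp
  have hTlt : ∀ i, T i < T (i + 1) := by
    intro i
    obtain ⟨t, ht1, ht2⟩ := hG.exists_bounce_pos (hD i)
    rw [← hsucc] at ht2
    exact ht1.trans (hG.exit_spec (hD (i + 1)).1 ht2).1
  have hline : ∀ i, p i = (X (i + 1)).2 + T i • (X (i + 1)).1 := by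
    intro i
    rw [hsucc]; exact (hG.bounce_line_exitTime (hD i)).symm
  have hstep : ∀ i, p (i + 1) = p i + (T (i + 1) - T i) • (X (i + 1)).1 := by
    intro i
    rw [hline i]
    simp only [hp, exitPoint, hT]
    module
  have hp0 : ∀ i, G (p i) = 0 := fun i => hG.exitPoint_zero (hD i)
  have hpne : ∀ i, G (p i) ≠ ℓ (p i) := fun i => hG.exitPoint_ne_height (hD i)
  have hh : ∀ i, 0 < ℓ (p i) := fun i => hG.height_pos _ (hD i).2.2 (hp0 i).ge
  have hnorm : ∀ i, ‖p i‖ = ‖x.2‖ * √(1 + (T i / ‖x.2‖) ^ 2) := by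
    intro i
    rw [← hX2 i]
    exact norm_eq_mul_sqrt (hX1 i) (hX3 i) (hX2' i) _
  -- Height times the normal component (measured by `DG`) of the outgoing velocity; the height
  -- factor makes the next two identities share the common factor `ℓ (p i) * ℓ (p (i + 1))`.
  set b : ℕ → ℝ := fun i => ℓ (p i) * fderiv ℝ G (p i) (X (i + 1)).1 with hb
  set s : ℕ → V := fun i => (ℓ (p i))⁻¹ • p i with hs
  have hs0 : ∀ i, G (s i) = 0 := fun i => by
    simp only [hs]
    rw [hG.map_smul _ (inv_nonneg.2 (hh i).le), hp0, mul_zero]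
  have hs1 : ∀ i, ℓ (s i) = 1 := fun i => by
    simp only [hs, _root_.map_smul, smul_eq_mul]
    exact inv_mul_cancel₀ (hh i).ne'
  have hfs : ∀ i, fderiv ℝ G (s i) = fderiv ℝ G (p i) := fun i =>
    hG.fderiv_smul (inv_pos.2 (hh i)) _
  have hbpos : ∀ i, 0 < b i := by
    intro i
    refine mul_pos (hh i) ?_
    rw [hsucc, hG.fderiv_bounce_fst (hD i)]
    linarith [hG.fderiv_exitPoint_neg (hD i)]
  have hb1 : ∀ i, (T (i + 1) - T i) * b i
      = ℓ (p i) * ℓ (p (i + 1)) * fderiv ℝ G (s i) (s (i + 1)) := by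
    intro i
    have e1 : fderiv ℝ G (p i) (p (i + 1))
        = (T (i + 1) - T i) * fderiv ℝ G (p i) (X (i + 1)).1 := by
      rw [hstep, map_add, hG.fderiv_self (hpne i), hp0, zero_add, _root_.map_smul, smul_eq_mul]
    have := (hh (i + 1)).ne'
    rw [hfs]
    simp only [hs, _root_.map_smul, smul_eq_mul, e1, hb]
    field_simp
  -- The reflection law at `p (i + 1)` equates the incoming normal velocity with the outgoing one up
  -- to sign. Compared with `hb1`, the quotient of `b i` and `b (i + 1)` is the quotient of the
  -- pairing and its transpose, which is close to one by `exists_pairing_le`.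
  have hb2 : ∀ i, (T (i + 1) - T i) * b (i + 1)
      = ℓ (p i) * ℓ (p (i + 1)) * fderiv ℝ G (s (i + 1)) (s i) := by
    intro i
    have e0 : p i = p (i + 1) - (T (i + 1) - T i) • (X (i + 1)).1 := by
      rw [hstep]; abel
    have e1 : fderiv ℝ G (p (i + 1)) (p i)
        = (T (i + 1) - T i) * fderiv ℝ G (p (i + 1)) (X (i + 1 + 1)).1 := by
      rw [e0, map_sub, hG.fderiv_self (hpne _), hp0, hsucc (i + 1),
        hG.fderiv_bounce_fst (hD (i + 1)), _root_.map_smul, smul_eq_mul]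
      ring
    have := (hh i).ne'
    rw [hfs]
    simp only [hs, _root_.map_smul, smul_eq_mul, e1, hb]
    field_simp
  obtain ⟨C, hC, hCest⟩ := hG.exists_pairing_le
  obtain ⟨c, hc, hcest⟩ := hG.exists_norm_le_height
  set δ : ℕ → ℝ := fun i => ‖s i - s (i + 1)‖ with hδ
  have hδle : ∀ i, δ i ≤ 2 * ‖ℓ‖ * (T (i + 1) - T i) * ‖x.2‖ / (ℓ (p i) * ℓ (p (i + 1))) := by
    intro i
    have := norm_section_sub_le (ℓ := ℓ) (hline i) (hstep i) (sub_pos.2 (hTlt i)) (hh i)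
      (hh (i + 1)) (hX1 (i + 1))
    rwa [hX2] at this
  refine not_forall_decay (δ := δ) (b := b) (C := C) (M := 2 * ‖ℓ‖ * ‖x.2‖ * C)
    (A := 2 * ‖ℓ‖ / c ^ 2 * Real.pi) hC hbpos (fun i => norm_nonneg _) ?_ ?_ ?_
  · intro i
    have h1 := (hCest _ _ (hs0 i) (hs1 i) (hs0 (i + 1)) (hs1 (i + 1))).2
    have hτ := sub_pos.2 (hTlt i)
    refine le_of_mul_le_mul_left ?_ hτ
    have e1 : (T (i + 1) - T i) * ((1 + C * δ i) * b (i + 1))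
        = (1 + C * δ i) * ((T (i + 1) - T i) * b (i + 1)) := by ring
    rw [e1, hb1, hb2]
    have := mul_le_mul_of_nonneg_left h1 (mul_pos (hh i) (hh (i + 1))).le
    linarith
  · intro i
    have h1 := (hCest _ _ (hs0 i) (hs1 i) (hs0 (i + 1)) (hs1 (i + 1))).1
    have hτ := sub_pos.2 (hTlt i)
    have hH := mul_pos (hh i) (hh (i + 1))
    have h2 := hδle i
    rw [le_div_iff₀ hH] at h2
    have hδ0 : 0 ≤ δ i := norm_nonneg _
    refine le_of_mul_le_mul_left ?_ hτ
    rw [hb1]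
    calc ℓ (p i) * ℓ (p (i + 1)) * fderiv ℝ G (s i) (s (i + 1))
        ≤ ℓ (p i) * ℓ (p (i + 1)) * (C * δ i ^ 2) := by gcongr
      _ = C * δ i * (δ i * (ℓ (p i) * ℓ (p (i + 1)))) := by ring
      _ ≤ C * δ i * (2 * ‖ℓ‖ * (T (i + 1) - T i) * ‖x.2‖) := by gcongr
      _ = _ := by ring
  · intro N
    -- With heights replaced by norms, the bound for `δ i` is a constant times the sine of the angle
    -- between successive points on the line as seen from the origin. The arctangents telescope
    -- because `‖Q‖` never changes and one time parameter runs along the whole trajectory.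
    have hterm : ∀ i, δ i ≤ 2 * ‖ℓ‖ / c ^ 2 *
        (Real.arctan (T (i + 1) / ‖x.2‖) - Real.arctan (T i / ‖x.2‖)) := by
      intro i
      have hτ := sub_pos.2 (hTlt i)
      have h1 : c * ‖p i‖ ≤ ℓ (p i) := hcest _ (hp0 i).ge
      have h2 : c * ‖p (i + 1)‖ ≤ ℓ (p (i + 1)) := hcest _ (hp0 (i + 1)).ge
      have hn1 : 0 < ‖p i‖ := norm_pos_iff.2 (hD i).2.2
      have hn2 : 0 < ‖p (i + 1)‖ := norm_pos_iff.2 (hD (i + 1)).2.2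
      have h3 := div_sqrt_mul_sqrt_le_arctan_sub
        (a := T i / ‖x.2‖) (b := T (i + 1) / ‖x.2‖) (by gcongr; exact (hTlt i).le)
      have hq1 : 0 < √(1 + (T i / ‖x.2‖) ^ 2) := Real.sqrt_pos.2 (by positivity)
      have hq2 : 0 < √(1 + (T (i + 1) / ‖x.2‖) ^ 2) := Real.sqrt_pos.2 (by positivity)
      have hh1 := (hh i).le
      calc δ i ≤ 2 * ‖ℓ‖ * (T (i + 1) - T i) * ‖x.2‖ / (ℓ (p i) * ℓ (p (i + 1))) := hδle i
        _ ≤ 2 * ‖ℓ‖ * (T (i + 1) - T i) * ‖x.2‖ / ((c * ‖p i‖) * (c * ‖p (i + 1)‖)) := by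
          gcongr
        _ = 2 * ‖ℓ‖ / c ^ 2 * ((T (i + 1) / ‖x.2‖ - T i / ‖x.2‖) /
            (√(1 + (T i / ‖x.2‖) ^ 2) * √(1 + (T (i + 1) / ‖x.2‖) ^ 2))) := by
          rw [hnorm i, hnorm (i + 1)]
          field_simp
        _ ≤ _ := by gcongr
    calc ∑ i ∈ Finset.range N, δ i ≤ ∑ i ∈ Finset.range N, 2 * ‖ℓ‖ / c ^ 2 *
          (Real.arctan (T (i + 1) / ‖x.2‖) - Real.arctan (T i / ‖x.2‖)) :=
          Finset.sum_le_sum fun i _ => hterm i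
      _ = 2 * ‖ℓ‖ / c ^ 2 * (Real.arctan (T N / ‖x.2‖) - Real.arctan (T 0 / ‖x.2‖)) := by
        rw [← Finset.mul_sum, Finset.sum_range_sub (fun i => Real.arctan (T i / ‖x.2‖))]
      _ ≤ 2 * ‖ℓ‖ / c ^ 2 * Real.pi := by
        gcongr
        linarith [Real.arctan_lt_pi_div_two (T N / ‖x.2‖),
          Real.neg_pi_div_two_lt_arctan (T 0 / ‖x.2‖)]

end IsConeFunction

end Finiteness

end ConeBilliard

/-! ### The final line of a trajectory and its dependence on the initial line -/

namespace ConeBilliard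

open Filter Topology Set
open scoped ContDiff Gradient

variable {V : Type*} [NormedAddCommGroup V] [InnerProductSpace ℝ V] [FiniteDimensional ℝ V]
  {m k : ℕ∞ω} {G : V → ℝ} {ℓ : V →L[ℝ] ℝ} {e : V}

/-- The pairs `(v, Q)` with `‖v‖ = 1` and `⟪v, Q⟫ = 0`. -/
def unitLines (V : Type*) [NormedAddCommGroup V] [InnerProductSpace ℝ V] : Set (V × V) :=
  {x | ‖x.1‖ = 1 ∧ inner ℝ x.1 x.2 = 0}

/-- The lines that miss the vertex and meet the open cone `{G > 0}`. -/
def crossingLines (G : V → ℝ) : Set (V × V) :=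
  {x ∈ unitLines V | x.2 ≠ 0 ∧ ∃ t : ℝ, 0 < G (x.2 + t • x.1)}

/-- The first `N` reflections of the line `x` are regular. -/
def Admissible (G : V → ℝ) (N : ℕ) (x : V × V) : Prop :=
  ∀ i < N, (bounce G)^[i] x ∈ exitDomain G

/-- The number of reflections of the line `x`. -/
def bounceCount (G : V → ℝ) (x : V × V) : ℕ :=
  sInf {N | 0 ≤ G ((bounce G)^[N] x).1}

/-- The line along which the trajectory of `x` escapes to infinity. -/
def finalLine (G : V → ℝ) (x : V × V) : V × V :=
  (bounce G)^[bounceCount G x] x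

theorem admissible_succ_iff {N : ℕ} {x : V × V} :
    Admissible G (N + 1) x ↔ x ∈ exitDomain G ∧ Admissible G N (bounce G x) := by
  constructor
  · exact fun h => ⟨h 0 (Nat.succ_pos N), fun i hi => h (i + 1) (Nat.succ_lt_succ hi)⟩
  · rintro ⟨h1, h2⟩ i hi
    cases i with
    | zero => exact h1
    | succ i => exact h2 i (Nat.lt_of_succ_lt_succ hi)

theorem bounce_mem_unitLines {x : V × V} (hx : x ∈ unitLines V) : bounce G x ∈ unitLines V :=
  ⟨(norm_bounce_fst x).trans hx.1, (inner_bounce x).trans hx.2⟩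

theorem iterate_bounce_mem_unitLines (N : ℕ) {x : V × V} (hx : x ∈ unitLines V) :
    (bounce G)^[N] x ∈ unitLines V := by
  induction N generalizing x with
  | zero => exact hx
  | succ N ih => exact ih (bounce_mem_unitLines hx)

theorem norm_iterate_bounce_snd (N : ℕ) (x : V × V) : ‖((bounce G)^[N] x).2‖ = ‖x.2‖ := by
  induction N generalizing x with
  | zero => rfl
  | succ N ih => rw [Function.iterate_succ_apply, ih, norm_bounce_snd]

theorem reverseLine_mem_unitLines {x : V × V} (hx : x ∈ unitLines V) :
    reverseLine x ∈ unitLines V := by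
  refine ⟨by simpa [reverseLine] using hx.1, ?_⟩
  have := hx.2
  simp [reverseLine, this]

theorem bounceCount_eq {N : ℕ} {x : V × V} (h : 0 ≤ G ((bounce G)^[N] x).1)
    (h' : ∀ i < N, G ((bounce G)^[i] x).1 < 0) : bounceCount G x = N := by
  refine le_antisymm (Nat.sInf_le h) ?_
  by_contra! hlt
  have h2 : 0 ≤ G ((bounce G)^[bounceCount G x] x).1 :=
    Nat.sInf_mem (s := {N | 0 ≤ G ((bounce G)^[N] x).1}) ⟨N, h⟩
  exact (h' _ hlt).not_ge h2

theorem neg_of_lt_bounceCount {i : ℕ} {x : V × V} (h : i < bounceCount G x) :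
    G ((bounce G)^[i] x).1 < 0 := by
  have := Nat.notMem_of_lt_sInf h
  simpa using this

theorem finalLine_of_nonneg {x : V × V} (h : 0 ≤ G x.1) : finalLine G x = x := by
  have : bounceCount G x = 0 := bounceCount_eq h (by simp)
  rw [finalLine, this]; rfl

namespace IsConeFunction

theorem mem_exitDomain_of_neg (_hG : IsConeFunction m G ℓ e) {x : V × V} (hx : x ∈ crossingLines G)
    (h : G x.1 < 0) : x ∈ exitDomain G := by
  refine ⟨h, hx.2.2, norm_pos_iff.1 ?_⟩
  have := norm_pos_iff.2 hx.2.1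
  rw [exitPoint, norm_eq_mul_sqrt hx.1.1 hx.1.2 hx.2.1]
  positivity

theorem bounce_mem_crossingLines (hG : IsConeFunction m G ℓ e) {x : V × V}
    (hx : x ∈ crossingLines G) (h : x ∈ exitDomain G) : bounce G x ∈ crossingLines G := by
  obtain ⟨t, -, ht⟩ := hG.exists_bounce_pos h
  refine ⟨bounce_mem_unitLines hx.1, ?_, t, ht⟩
  rw [← norm_pos_iff, norm_bounce_snd, norm_pos_iff]
  exact hx.2.1

theorem iterate_mem_crossingLines (hG : IsConeFunction m G ℓ e) {N : ℕ} {x : V × V}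
    (hx : x ∈ crossingLines G) (h : Admissible G N x) : (bounce G)^[N] x ∈ crossingLines G := by
  induction N generalizing x with
  | zero => exact hx
  | succ N ih =>
    rw [admissible_succ_iff] at h
    exact ih (hG.bounce_mem_crossingLines hx h.1) h.2

/-- Finiteness of reflections makes the infimum in `bounceCount` an attained minimum. Regularity of
the earlier reflections follows from `Q ≠ 0`: the lines never pass through the vertex. -/
theorem bounceCount_spec (hG : IsConeFunction m G ℓ e) {x : V × V} (hx : x ∈ crossingLines G) :
    Admissible G (bounceCount G x) x ∧ 0 ≤ G (finalLine G x).1 := by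
  refine ⟨fun i hi => ?_,
    Nat.sInf_mem (hG.exists_iterate_nonneg hx.1.1 hx.1.2 hx.2.1 hx.2.2)⟩
  induction i using Nat.strong_induction_on with
  | _ i ih =>
    exact hG.mem_exitDomain_of_neg (hG.iterate_mem_crossingLines hx
      (fun j hj => ih j hj (hj.trans hi))) (neg_of_lt_bounceCount hi)

theorem finalLine_mem (hG : IsConeFunction m G ℓ e) {x : V × V} (hx : x ∈ crossingLines G) :
    finalLine G x ∈ crossingLines G :=
  hG.iterate_mem_crossingLines hx (hG.bounceCount_spec hx).1

theorem finalLine_bounce (hG : IsConeFunction m G ℓ e) {x : V × V} (hx : x ∈ crossingLines G)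
    (h : x ∈ exitDomain G) : finalLine G (bounce G x) = finalLine G x := by
  have hb := hG.bounce_mem_crossingLines hx h
  have : bounceCount G x = bounceCount G (bounce G x) + 1 := by
    refine bounceCount_eq (hG.bounceCount_spec hb).2 fun i hi => ?_
    cases i with
    | zero => exact h.1
    | succ i => exact neg_of_lt_bounceCount (x := bounce G x) (Nat.lt_of_succ_lt_succ hi)
  rw [finalLine, finalLine, this, Function.iterate_succ_apply]

theorem finalLine_iterate (hG : IsConeFunction m G ℓ e) {N : ℕ} {x : V × V}
    (hx : x ∈ crossingLines G) (h : Admissible G N x) :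
    finalLine G ((bounce G)^[N] x) = finalLine G x := by
  induction N generalizing x with
  | zero => rfl
  | succ N ih =>
    rw [admissible_succ_iff] at h
    rw [Function.iterate_succ_apply, ih (hG.bounce_mem_crossingLines hx h.1) h.2,
      hG.finalLine_bounce hx h.1]

theorem iterate_bounce_injective (hG : IsConeFunction m G ℓ e) {N : ℕ} {x y : V × V}
    (hx : Admissible G N x) (hy : Admissible G N y)
    (h : (bounce G)^[N] x = (bounce G)^[N] y) : x = y := by
  induction N generalizing x y with
  | zero => exact h
  | succ N ih =>
    rw [admissible_succ_iff] at hx hy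
    exact hG.bounce_injOn hx.1 hy.1 (ih hx.2 hy.2 h)

/-- The two trajectories are aligned at their common end, and the last `bounceCount G y` reflections
are cancelled by injectivity. -/
theorem eq_iterate_of_finalLine_eq (hG : IsConeFunction m G ℓ e) {x y : V × V}
    (hx : x ∈ crossingLines G) (hy : y ∈ crossingLines G) (h : finalLine G x = finalLine G y)
    (hle : bounceCount G y ≤ bounceCount G x) :
    ∃ i, Admissible G i x ∧ (bounce G)^[i] x = y := by
  obtain ⟨i, hi⟩ := Nat.exists_eq_add_of_le' hle
  have hax := (hG.bounceCount_spec hx).1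
  have hay := (hG.bounceCount_spec hy).1
  refine ⟨i, fun j hj => hax j (by omega), hG.iterate_bounce_injective
    (N := bounceCount G y) (fun j hj => ?_) hay ?_⟩
  · rw [← Function.iterate_add_apply]
    exact hax _ (by omega)
  · rw [← Function.iterate_add_apply, add_comm, ← hi]
    exact h

/-- The number `N` is held fixed while the line varies. The iterate is then smooth, also at lines of
`Δ`, near which `bounceCount` may jump. -/
theorem admissible_local (hG : IsConeFunction m G ℓ e) (hk : k + 1 ≤ m) {N : ℕ} {x : V × V}
    (hx : Admissible G N x) :
    (∀ᶠ y in 𝓝 x, Admissible G N y) ∧ ContDiffAt ℝ k (bounce G)^[N] x := by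
  induction N generalizing x with
  | zero => exact ⟨Eventually.of_forall fun y i hi => absurd hi (Nat.not_lt_zero i), contDiffAt_id⟩
  | succ N ih =>
    rw [admissible_succ_iff] at hx
    obtain ⟨h1, h2⟩ := ih hx.2
    have hB := hG.contDiffAt_bounce hk hx.1
    refine ⟨?_, h2.comp x hB⟩
    filter_upwards [hB.continuousAt.eventually h1, hG.eventually_mem_exitDomain hx.1]
      with y hy1 hy2
    exact admissible_succ_iff.2 ⟨hy2, hy1⟩

theorem one_add_one_le (hG : IsConeFunction m G ℓ e) : (1 : ℕ∞ω) + 1 ≤ m :=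
  le_trans (by norm_num) hG.three_le

theorem fderiv_iterate_bounce (hG : IsConeFunction m G ℓ e) {N : ℕ} {x : V × V}
    (hx : Admissible G N x) (w : V × V) :
    (fderiv ℝ (bounce G)^[N] x w = 0 → w = 0) ∧
    inner ℝ ((bounce G)^[N] x).1 (fderiv ℝ (bounce G)^[N] x w).1 = inner ℝ x.1 w.1 ∧
      inner ℝ (fderiv ℝ (bounce G)^[N] x w).1 ((bounce G)^[N] x).2 +
        inner ℝ ((bounce G)^[N] x).1 (fderiv ℝ (bounce G)^[N] x w).2 =
          inner ℝ w.1 x.2 + inner ℝ x.1 w.2 := by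
  induction N generalizing x w with
  | zero => simp
  | succ N ih =>
    rw [admissible_succ_iff] at hx
    have h1 := (hG.admissible_local hG.one_add_one_le hx.2).2.differentiableAt one_ne_zero
    have h2 := (hG.contDiffAt_bounce hG.one_add_one_le hx.1).differentiableAt one_ne_zero
    have h3 : fderiv ℝ (bounce G)^[N + 1] x w
        = fderiv ℝ (bounce G)^[N] (bounce G x) (fderiv ℝ (bounce G) x w) := by
      rw [Function.iterate_succ, fderiv_comp x h1 h2]; rfl
    obtain ⟨i1, i2, i3⟩ := ih hx.2 (fderiv ℝ (bounce G) x w)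
    obtain ⟨j1, j2⟩ := hG.fderiv_bounce_tangent hx.1 w
    rw [h3, Function.iterate_succ_apply]
    exact ⟨fun h => hG.fderiv_bounce_injective hx.1 (i1 h), i2.trans j1, i3.trans j2⟩

/-- Openness of `bounce` on the space of lines, from the local inverse given by time reversal. It
serves to pull density back from final lines to initial lines. -/
theorem nhdsWithin_bounce_le (hG : IsConeFunction m G ℓ e) {x : V × V} (hx : x ∈ exitDomain G) :
    𝓝[unitLines V] (bounce G x) ≤ map (bounce G) (𝓝[unitLines V] x) := by
  obtain ⟨h1, h2⟩ := hG.reverse_bounce hx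
  set R : V × V → V × V := fun y => reverseLine (bounce G (reverseLine y)) with hR
  have hrev : Continuous (reverseLine : V × V → V × V) :=
    (contDiff_reverseLine (n := 0)).continuous
  have hRx : R (bounce G x) = x := by simp [hR, h2]
  have hRc : ContinuousAt R (bounce G x) := by
    have h3 : ContinuousAt (bounce G) (reverseLine (bounce G x)) :=
      (hG.contDiffAt_bounce hG.one_add_one_le h1).continuousAt
    have h4 : ContinuousAt (fun y => bounce G (reverseLine y)) (bounce G x) :=
      ContinuousAt.comp (f := reverseLine) h3 hrev.continuousAt
    exact hrev.continuousAt.comp h4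
  have hRt : Tendsto R (𝓝[unitLines V] (bounce G x)) (𝓝[unitLines V] x) := by
    refine tendsto_nhdsWithin_iff.2 ⟨?_, ?_⟩
    · have := hRc.tendsto
      rw [hRx] at this
      exact this.mono_left nhdsWithin_le_nhds
    · filter_upwards [self_mem_nhdsWithin] with y hy
      exact reverseLine_mem_unitLines (bounce_mem_unitLines (reverseLine_mem_unitLines hy))
  have hBR : ∀ᶠ y in 𝓝[unitLines V] (bounce G x), bounce G (R y) = y := by
    refine nhdsWithin_le_nhds ?_
    filter_upwards [hrev.continuousAt.eventually (hG.eventually_mem_exitDomain h1)] with y hy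
    simp [hR, (hG.reverse_bounce hy).2]
  intro S hS
  filter_upwards [hRt hS, hBR] with y hy1 hy2
  rw [← hy2]
  exact hy1

theorem nhdsWithin_iterate_bounce_le (hG : IsConeFunction m G ℓ e) {N : ℕ} {x : V × V}
    (hx : Admissible G N x) :
    𝓝[unitLines V] ((bounce G)^[N] x) ≤ map (bounce G)^[N] (𝓝[unitLines V] x) := by
  induction N generalizing x with
  | zero => simp
  | succ N ih =>
    rw [admissible_succ_iff] at hx
    rw [Function.iterate_succ_apply, Function.iterate_succ, ← map_map]
    exact (ih hx.2).trans (map_mono (hG.nhdsWithin_bounce_le hx.1))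

theorem tendsto_iterate_bounce (hG : IsConeFunction m G ℓ e) {N : ℕ} {x : V × V}
    (hx : Admissible G N x) :
    Tendsto (bounce G)^[N] (𝓝[crossingLines G] x) (𝓝[crossingLines G] ((bounce G)^[N] x)) := by
  obtain ⟨h1, h2⟩ := hG.admissible_local hG.one_add_one_le hx
  refine tendsto_nhdsWithin_iff.2 ⟨h2.continuousAt.tendsto.mono_left nhdsWithin_le_nhds, ?_⟩
  filter_upwards [self_mem_nhdsWithin, nhdsWithin_le_nhds h1] with y hy1 hy2
  exact hG.iterate_mem_crossingLines hy1 hy2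

theorem nhdsWithin_crossingLines (hG : IsConeFunction m G ℓ e) {x : V × V}
    (hx : x ∈ crossingLines G) : 𝓝[crossingLines G] x = 𝓝[unitLines V] x := by
  refine le_antisymm (nhdsWithin_mono _ fun y hy => hy.1) ?_
  obtain ⟨h1, h2, t, ht⟩ := hx
  have c1 : ContinuousAt (fun y : V × V => y.2) x := continuousAt_snd
  have c2 : ContinuousAt (fun y : V × V => G (y.2 + t • y.1)) x :=
    (hG.continuous.comp (by fun_prop)).continuousAt
  refine nhdsWithin_le_of_mem ?_
  filter_upwards [self_mem_nhdsWithin, nhdsWithin_le_nhds (c1.eventually_ne h2),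
    nhdsWithin_le_nhds (c2.eventually_const_lt ht)] with y hy1 hy2 hy3
  exact ⟨hy1, hy2, t, hy3⟩

theorem ne_zero_of_mem (_hG : IsConeFunction m G ℓ e) {x : V × V} (hx : x ∈ crossingLines G) :
    x.1 ≠ 0 := by
  intro h
  have := hx.1.1
  rw [h, norm_zero] at this
  exact zero_ne_one this

/-- For a direction on the boundary, `DG(v)` is constant along the line because `DG(v) v = 0`, and
it is at least `G` at an interior point. With the converse below, this identifies `Δ₀`. -/
theorem fderiv_pos_of_asymptotic (hG : IsConeFunction m G ℓ e) {x : V × V}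
    (hx : x ∈ crossingLines G) (h0 : G x.1 = 0) : 0 < fderiv ℝ G x.1 x.2 := by
  have hne := hG.ne_height (hG.ne_zero_of_mem hx) h0
  obtain ⟨-, -, t, ht⟩ := hx
  have := hG.le_fderiv hne (x.2 + t • x.1)
  rw [map_add, _root_.map_smul, hG.fderiv_self hne, h0, smul_zero, add_zero] at this
  linarith

theorem mem_crossingLines_of_fderiv_pos (hG : IsConeFunction m G ℓ e) {x : V × V}
    (hx : x ∈ unitLines V) (h0 : G x.1 = 0) (hpos : 0 < fderiv ℝ G x.1 x.2) :
    x ∈ crossingLines G := by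
  have hx1 : x.1 ≠ 0 := by
    intro h
    have := hx.1
    rw [h, norm_zero] at this
    exact zero_ne_one this
  refine ⟨hx, ?_, ?_⟩
  · intro h
    rw [h, _root_.map_zero] at hpos
    exact hpos.false
  · obtain ⟨s, hs, hs'⟩ := hG.pos_of_fderiv_neg (v := -x.2) hx1 h0 (by rw [map_neg]; linarith)
    refine ⟨s⁻¹, ?_⟩
    have h1 : x.2 + s⁻¹ • x.1 = s⁻¹ • (x.1 - s • -x.2) := by
      rw [smul_neg, sub_neg_eq_add, smul_add, smul_smul, inv_mul_cancel₀ hs.ne', one_smul,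
        add_comm]
    rw [h1, hG.map_smul _ (inv_nonneg.2 hs.le)]
    exact mul_pos (inv_pos.2 hs) hs'

/-- Near a line that is asymptotic to the boundary, only such lines have an asymptotic final
line. -/
theorem eventually_finalLine_asymptotic (hG : IsConeFunction m G ℓ e) {z : V × V}
    (hz : z ∈ crossingLines G) (h0 : G z.1 = 0) :
    ∀ᶠ y in 𝓝[crossingLines G] z, G y.1 < 0 → finalLine G y = bounce G y ∧
      0 < G (bounce G y).1 := by
  have h1 := (hG.bounce_near_asymptotic (hG.ne_zero_of_mem hz) h0
    (hG.fderiv_pos_of_asymptotic hz h0)).2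
  rw [eventually_nhdsWithin_iff] at h1
  filter_upwards [self_mem_nhdsWithin, nhdsWithin_le_nhds h1] with y hy1 hy2 hy3
  obtain ⟨h2, h3⟩ := hy2 hy3
  exact ⟨by rw [← hG.finalLine_bounce hy1 h2, finalLine_of_nonneg h3.le], h3⟩

/-- This gives a local equation for `Δ` with a fixed number of reflections. If the direction after
these reflections has `G < 0`, then one more reflection leads strictly inside the cone, so such a
line is not in `Δ`. -/
theorem eventually_zero_iff (hG : IsConeFunction m G ℓ e) {x : V × V}
    (hx : x ∈ crossingLines G) (h0 : G (finalLine G x).1 = 0) :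
    ∀ᶠ y in 𝓝[crossingLines G] x,
      (G (finalLine G y).1 = 0 ↔ G ((bounce G)^[bounceCount G x] y).1 = 0) := by
  have ha := (hG.bounceCount_spec hx).1
  have h1 := (hG.tendsto_iterate_bounce ha).eventually
    (hG.eventually_finalLine_asymptotic (hG.finalLine_mem hx) h0)
  have h2 := (hG.admissible_local hG.one_add_one_le ha).1
  filter_upwards [self_mem_nhdsWithin, nhdsWithin_le_nhds h2, h1] with y hy1 hy2 hy3
  rw [← hG.finalLine_iterate hy1 hy2]
  rcases lt_or_ge (G ((bounce G)^[bounceCount G x] y).1) 0 with h | h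
  · obtain ⟨h4, h5⟩ := hy3 h
    rw [h4]
    exact iff_of_false h5.ne' h.ne
  · rw [finalLine_of_nonneg h]

theorem eventually_finalLine_eq (hG : IsConeFunction m G ℓ e) {x : V × V}
    (hx : x ∈ crossingLines G) (h0 : 0 < G (finalLine G x).1) :
    ∀ᶠ y in 𝓝[crossingLines G] x,
      finalLine G y = (bounce G)^[bounceCount G x] y ∧ 0 < G (finalLine G y).1 := by
  have ha := (hG.bounceCount_spec hx).1
  obtain ⟨h2, h3⟩ := hG.admissible_local hG.one_add_one_le ha
  have h4 : ContinuousAt (fun y => G ((bounce G)^[bounceCount G x] y).1) x :=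
    (hG.continuous.comp continuous_fst).continuousAt.comp h3.continuousAt
  filter_upwards [self_mem_nhdsWithin, nhdsWithin_le_nhds h2,
    nhdsWithin_le_nhds (h4.eventually_const_lt h0)] with y hy1 hy2 hy3
  have h5 : finalLine G y = (bounce G)^[bounceCount G x] y := by
    rw [← hG.finalLine_iterate hy1 hy2, finalLine_of_nonneg hy3.le]
  exact ⟨h5, by rwa [h5]⟩

/-- A function of the final line is continuous as soon as it takes the same value on an asymptotic
line and on its mirror image. -/
theorem continuousOn_comp_finalLine (hG : IsConeFunction m G ℓ e) {J : V × V → ℝ}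
    (hJ : ∀ z : V × V, z.1 ≠ 0 → 0 ≤ G z.1 → ContinuousAt J z)
    (hJ' : ∀ z : V × V, z.1 ≠ 0 → G z.1 = 0 → J (z.1, reflectAlong (∇ G z.1) z.2) = J z) :
    ContinuousOn (fun x => J (finalLine G x)) (crossingLines G) := by
  have key : ∀ z ∈ crossingLines G, 0 ≤ G z.1 →
      Tendsto (fun x => J (finalLine G x)) (𝓝[crossingLines G] z) (𝓝 (J z)) := by
    intro z hz h0
    have hz1 := hG.ne_zero_of_mem hz
    have hJz : Tendsto J (𝓝[crossingLines G] z) (𝓝 (J z)) :=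
      (hJ z hz1 h0).tendsto.mono_left nhdsWithin_le_nhds
    rcases h0.lt_or_eq with h0 | h0
    · refine hJz.congr' ?_
      have c : ContinuousAt (fun y : V × V => G y.1) z :=
        (hG.continuous.comp continuous_fst).continuousAt
      filter_upwards [nhdsWithin_le_nhds (c.eventually_const_lt h0)] with y hy
      rw [finalLine_of_nonneg hy.le]
    -- On the side `G ≥ 0` a line is its own final line. On the side `G < 0` there is exactly one
    -- more reflection, whose limit is the mirror image of `z`, where `J` takes the same value.
    · have hsplit : 𝓝[crossingLines G] z
          = 𝓝[crossingLines G ∩ {y | 0 ≤ G y.1}] z ⊔ 𝓝[crossingLines G ∩ {y | G y.1 < 0}] z := by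
        rw [← nhdsWithin_union, ← inter_union_distrib_left]
        congr 1
        ext y
        simp [le_or_gt]
      rw [hsplit, tendsto_sup]
      constructor
      · refine (hJz.mono_left (nhdsWithin_mono _ inter_subset_left)).congr' ?_
        filter_upwards [self_mem_nhdsWithin] with y hy
        rw [finalLine_of_nonneg hy.2]
      · have h1 := (hG.bounce_near_asymptotic hz1 h0.symm
          (hG.fderiv_pos_of_asymptotic hz h0.symm)).1
        have h2 : ContinuousAt J (z.1, reflectAlong (∇ G z.1) z.2) := hJ _ hz1 h0.le
        have h3 := (h2.tendsto.comp h1).mono_left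
          (nhdsWithin_mono z (inter_subset_right (s := crossingLines G)))
        rw [hJ' z hz1 h0.symm] at h3
        refine h3.congr' ?_
        have h4 := nhdsWithin_mono z (inter_subset_left (t := {y : V × V | G y.1 < 0}))
          (hG.eventually_finalLine_asymptotic hz h0.symm)
        filter_upwards [self_mem_nhdsWithin, h4] with y hy1 hy2
        rw [(hy2 hy1.2).1, Function.comp]
  intro x hx
  have ha := (hG.bounceCount_spec hx).1
  -- The general case is transported to the final line by the continuous iterate, under which
  -- `finalLine` is invariant.
  have h1 := (key _ (hG.finalLine_mem hx) (hG.bounceCount_spec hx).2).comp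
    (hG.tendsto_iterate_bounce ha)
  refine Tendsto.congr' ?_ h1
  filter_upwards [self_mem_nhdsWithin,
    nhdsWithin_le_nhds (hG.admissible_local hG.one_add_one_le ha).1] with y hy1 hy2
  rw [Function.comp, hG.finalLine_iterate hy1 hy2]

/-- Tilting the direction towards the axis `e` increases `G`; the tilted direction is normalised and
`Q` is projected to its orthogonal complement. -/
theorem frequently_pos (hG : IsConeFunction m G ℓ e) {z : V × V} (hz : z ∈ unitLines V)
    (h0 : 0 ≤ G z.1) : ∃ᶠ y in 𝓝[unitLines V] z, 0 < G y.1 := by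
  have hz1 : z.1 ≠ 0 := by
    intro h
    have := hz.1
    rw [h, norm_zero] at this
    exact zero_ne_one this
  set u : ℝ → V := fun s => ‖z.1 + s • e‖⁻¹ • (z.1 + s • e) with hu
  set c : ℝ → V × V := fun s => (u s, z.2 - inner ℝ z.2 (u s) • u s) with hc
  have hu0 : u 0 = z.1 := by simp [hu, hz.1]
  have huc : ContinuousAt u 0 := by
    refine ContinuousAt.smul (ContinuousAt.inv₀ (by fun_prop) ?_) (by fun_prop)
    simp [hz1]
  have hcc : ContinuousAt c 0 :=
    huc.prodMk (continuousAt_const.sub ((continuousAt_const.inner huc).smul huc))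
  have hc0 : c 0 = z := by
    rw [hc]
    simp only [hu0]
    rw [real_inner_comm, hz.2, zero_smul, sub_zero]
  have hpos : ∀ s : ℝ, 0 < s → 0 < G (z.1 + s • e) := fun s hs => by
    rw [hG.add_axis]; linarith
  have hnn : ∀ s : ℝ, 0 < s → 0 < ‖z.1 + s • e‖ := fun s hs => by
    refine norm_pos_iff.2 fun h => ?_
    have := hpos s hs
    rw [h, hG.map_zero] at this
    exact this.false
  have hlim : Tendsto c (𝓝[>] 0) (𝓝[unitLines V] z) := by
    refine tendsto_nhdsWithin_iff.2 ⟨?_, ?_⟩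
    · have := hcc.tendsto
      rw [hc0] at this
      exact this.mono_left nhdsWithin_le_nhds
    · filter_upwards [self_mem_nhdsWithin] with s hs
      have h1 : ‖u s‖ = 1 := by
        have := (hnn s hs).ne'
        simp only [hu, norm_smul, norm_inv, norm_norm]
        exact inv_mul_cancel₀ this
      refine ⟨h1, ?_⟩
      simp only [hc, inner_sub_right, inner_smul_right, real_inner_self_eq_norm_sq, h1]
      rw [real_inner_comm]; ring
  refine hlim.frequently (Eventually.frequently ?_)
  filter_upwards [self_mem_nhdsWithin] with s hs
  simp only [hc, hu]
  rw [hG.map_smul _ (inv_nonneg.2 (norm_nonneg _))]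
  exact mul_pos (inv_pos.2 (hnn s hs)) (hpos s hs)

/-- Otherwise no line near `x` would have a strictly interior final direction. Openness of the
iterated reflection would carry this to all lines near the final line, against `frequently_pos`. -/
theorem crossingLines_subset_closure (hG : IsConeFunction m G ℓ e) :
    crossingLines G ⊆ closure {x ∈ crossingLines G | 0 < G (finalLine G x).1} := by
  intro x hx
  have ha := (hG.bounceCount_spec hx).1
  by_contra h
  rw [mem_closure_iff_frequently, not_frequently] at h
  have h1 := nhdsWithin_le_nhds (s := unitLines V) h
  have h2 := (hG.admissible_local hG.one_add_one_le ha).1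
  have h3 : ∀ᶠ y in 𝓝[unitLines V] x, ¬ 0 < G ((bounce G)^[bounceCount G x] y).1 := by
    rw [← hG.nhdsWithin_crossingLines hx] at h1 ⊢
    filter_upwards [self_mem_nhdsWithin, h1, nhdsWithin_le_nhds h2] with y hy1 hy2 hy3 hy4
    refine hy2 ⟨hy1, ?_⟩
    rwa [← hG.finalLine_iterate hy1 hy3, finalLine_of_nonneg hy4.le]
  have h4 : ∀ᶠ y in 𝓝[unitLines V] ((bounce G)^[bounceCount G x] x), ¬ 0 < G y.1 :=
    hG.nhdsWithin_iterate_bounce_le ha h3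
  exact hG.frequently_pos (hG.finalLine_mem hx).1 (hG.bounceCount_spec hx).2 h4

end IsConeFunction

end ConeBilliard

/-! ### The billiard of the statement expressed through `G` -/

namespace ConeBilliard

open Filter Topology Set
open scoped ContDiff Gradient

namespace IsConeFunction

variable {n : ℕ} {m : ℕ∞ω} {G : E n → ℝ} {ℓ : E n →L[ℝ] ℝ} {e : E n}

/-- The boundary of the cone `{G ≥ 0}` without the vertex. -/
def boundary (G : E n → ℝ) : Set (E n) := {x | x ≠ 0 ∧ G x = 0}

theorem tangentConeAt_boundary (hG : IsConeFunction m G ℓ e) {p : E n} (hp : p ∈ boundary G) :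
    tangentConeAt ℝ (boundary G) p = {w | fderiv ℝ G p w = 0} := by
  have hne := hG.ne_height hp.1 hp.2
  have hd := (hG.differentiableAt hne).hasFDerivAt
  ext w
  constructor
  · intro hw
    have h1 : HasFDerivWithinAt G (fderiv ℝ G p) (boundary G) p := hd.hasFDerivWithinAt
    have h2 : HasFDerivWithinAt G (0 : E n →L[ℝ] ℝ) (boundary G) p :=
      (hasFDerivWithinAt_const (0 : ℝ) p (boundary G)).congr (fun x hx => hx.2) hp.2
    exact h1.unique_on h2 hw
  · intro hw
    have hw' : fderiv ℝ G p w = 0 := hw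
    have hl : HasDerivAt (fun s : ℝ => G (p + s • w)) 0 0 := by
      have := hG.hasDerivAt_line (p := p) (v := w) (t := 0) (by rwa [zero_smul, add_zero])
      rwa [zero_smul, add_zero, hw'] at this
    have hslope := hasDerivAt_iff_tendsto_slope.1 hl
    -- The correction along `e` puts the point exactly on `{G = 0}`, since `G` has unit speed along
    -- the axis; it is of order `o(s)` because `DG(p) w = 0`.
    refine mem_tangentConeAt_of_seq (𝓝[≠] (0 : ℝ)) (fun s => s⁻¹)
      (fun s => s • w - G (p + s • w) • e) ?_ ?_ ?_
    · have hc : ContinuousAt (fun s : ℝ => s • w - G (p + s • w) • e) 0 := by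
        exact (continuousAt_id.smul continuousAt_const).sub
          (hl.continuousAt.smul continuousAt_const)
      have := hc.tendsto
      simp only [zero_smul, add_zero, hp.2, sub_zero] at this
      exact this.mono_left nhdsWithin_le_nhds
    · have hc : ContinuousAt (fun s : ℝ => p + (s • w - G (p + s • w) • e)) 0 := by
        exact continuousAt_const.add ((continuousAt_id.smul continuousAt_const).sub
          (hl.continuousAt.smul continuousAt_const))
      have h3 : ∀ᶠ s in 𝓝 (0 : ℝ), p + (s • w - G (p + s • w) • e) ≠ 0 :=
        hc.eventually_ne (by simpa [hp.2] using hp.1)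
      filter_upwards [nhdsWithin_le_nhds h3] with s hs
      refine ⟨hs, ?_⟩
      have e1 : p + (s • w - G (p + s • w) • e) = (p + s • w) + (-G (p + s • w)) • e := by module
      rw [e1, hG.add_axis]; ring
    · have h4 : Tendsto (fun s : ℝ => w - slope (fun s : ℝ => G (p + s • w)) 0 s • e) (𝓝[≠] 0)
          (𝓝 (w - (0 : ℝ) • e)) := tendsto_const_nhds.sub (hslope.smul_const e)
      rw [zero_smul, sub_zero] at h4
      refine h4.congr' ?_
      filter_upwards [self_mem_nhdsWithin] with s hs
      have hs0 : s ≠ 0 := hs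
      rw [slope_def_field, zero_smul, add_zero, hp.2, sub_zero, sub_zero, smul_sub, smul_smul,
        smul_smul, inv_mul_cancel₀ hs0, one_smul, div_eq_inv_mul]

theorem convexHull_boundary_subset (hG : IsConeFunction m G ℓ e) :
    convexHull ℝ (boundary G) ⊆ {x | 0 ≤ G x} := by
  refine convexHull_min (fun x hx => hx.2.ge) ?_
  intro x hx y hy a b ha hb _
  have hx' : 0 ≤ G x := hx
  have hy' : 0 ≤ G y := hy
  have := hG.concave ha hb x y
  have h1 : 0 ≤ a * G x := by positivity
  have h2 : 0 ≤ b * G y := by positivity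
  exact le_trans (by linarith) this

theorem exists_boundary_ray (hG : IsConeFunction m G ℓ e) {x w : E n} (hx : 0 < G x)
    (hw : ℓ w = 0) (hw0 : w ≠ 0) : ∃ s : ℝ, 0 < s ∧ x + s • w ∈ boundary G := by
  have hneg : G w < 0 := by
    by_contra! h
    exact (hG.height_pos w hw0 h).ne' hw
  obtain ⟨h1, h2⟩ := hG.exit_spec (x := (w, x)) (t₀ := 0) hneg (by simpa using hx)
  refine ⟨exitTime G (w, x), h1, fun h => ?_, h2⟩
  have h3 := congrArg ℓ h
  rw [map_add, _root_.map_smul, hw, smul_zero, add_zero, _root_.map_zero] at h3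
  linarith [hG.le_height x]

/-- A horizontal line through an interior point meets the boundary on both sides of it. The
dimension must be at least two for a horizontal direction to exist. -/
theorem subset_interior_convexHull (hG : IsConeFunction m G ℓ e) (hn : 2 ≤ n) :
    {x | 0 < G x} ⊆ interior (convexHull ℝ (boundary G)) := by
  refine interior_maximal ?_ (isOpen_lt continuous_const hG.continuous)
  intro x hx
  obtain ⟨w, hw, hw0⟩ : ∃ w : E n, ℓ w = 0 ∧ w ≠ 0 := by
    have h1 : LinearMap.ker (ℓ : E n →ₗ[ℝ] ℝ) ≠ ⊥ := by
      refine LinearMap.ker_ne_bot_of_finrank_lt ?_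
      simp; omega
    obtain ⟨w, hw, hw0⟩ := Submodule.exists_mem_ne_zero_of_ne_bot h1
    exact ⟨w, hw, hw0⟩
  obtain ⟨s, hs, hs'⟩ := hG.exists_boundary_ray hx hw hw0
  obtain ⟨t, ht, ht'⟩ := hG.exists_boundary_ray hx (w := -w) (by simp [hw]) (by simpa using hw0)
  refine segment_subset_convexHull hs' ht' ⟨t / (s + t), s / (s + t), by positivity, by positivity,
    by field_simp; ring, ?_⟩
  have e1 : t / (s + t) + s / (s + t) = 1 := by field_simp; ring
  have e2 : t / (s + t) * s - s / (s + t) * t = 0 := by field_simp; ring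
  calc _ = (t / (s + t) + s / (s + t)) • x + (t / (s + t) * s - s / (s + t) * t) • w := by module
    _ = x := by rw [e1, e2]; simp

theorem isInwardUnitNormal_gradient (hG : IsConeFunction m G ℓ e) (hn : 2 ≤ n) {p : E n}
    (hp : p ∈ boundary G) :
    IsInwardUnitNormal (boundary G) p (‖∇ G p‖⁻¹ • ∇ G p) := by
  have hne := hG.ne_height hp.1 hp.2
  have hν := hG.gradient_ne_zero hne
  have hν' : 0 < ‖∇ G p‖ := norm_pos_iff.2 hν
  refine ⟨by rw [norm_smul, norm_inv, norm_norm, inv_mul_cancel₀ hν'.ne'], ?_, ?_⟩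
  · intro w hw
    rw [hG.tangentConeAt_boundary hp] at hw
    have hw' : fderiv ℝ G p w = 0 := hw
    rw [inner_smul_right, real_inner_comm, inner_gradient_left, hw', mul_zero]
  · set u := ‖∇ G p‖⁻¹ • ∇ G p with hu
    have hpos : 0 < fderiv ℝ G p u := by
      rw [← inner_gradient_left, hu, inner_smul_right, real_inner_self_eq_norm_sq]
      positivity
    obtain ⟨s, hs, hs'⟩ := hG.pos_of_fderiv_neg (v := -u) hp.1 hp.2
      (by rw [map_neg]; linarith)
    rw [smul_neg, sub_neg_eq_add] at hs'
    refine ⟨s, hs, fun r hr hrs => hG.subset_interior_convexHull hn ?_⟩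
    have h1 := hG.line_pos_of_lt (x := (-u, p)) (t₀ := -s) (s := -r) (t := 0)
      (by simpa using hs') (by simp [hp.2]) (by linarith) (by linarith)
    simpa using h1

/-- The tangent space is the hyperplane `ker DG(p)`, so a unit normal is unique up to sign, and
pointing into the hull fixes the sign. The arbitrary choice in `inwardNormal` is thereby determined.
-/
theorem inwardNormal_boundary (hG : IsConeFunction m G ℓ e) (hn : 2 ≤ n) {p : E n}
    (hp : p ∈ boundary G) :
    inwardNormal (boundary G) p = ‖∇ G p‖⁻¹ • ∇ G p := by
  have hne := hG.ne_height hp.1 hp.2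
  have hν := hG.gradient_ne_zero hne
  have hν' : 0 < ‖∇ G p‖ := norm_pos_iff.2 hν
  obtain ⟨h1, h2, ε, hε, h3⟩ : IsInwardUnitNormal (boundary G) p (inwardNormal (boundary G) p) :=
    Classical.epsilon_spec ⟨_, hG.isInwardUnitNormal_gradient hn hp⟩
  set N := inwardNormal (boundary G) p
  set ν := ∇ G p with hνdef
  have hpar : N = (inner ℝ ν N / ‖ν‖ ^ 2) • ν := by
    set w := N - (inner ℝ ν N / ‖ν‖ ^ 2) • ν with hw
    have hwν : inner ℝ ν w = 0 := by
      rw [hw, inner_sub_right, inner_smul_right, real_inner_self_eq_norm_sq]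
      field_simp
      ring
    have hwt : w ∈ tangentConeAt ℝ (boundary G) p := by
      rw [hG.tangentConeAt_boundary hp]
      show fderiv ℝ G p w = 0
      rw [← inner_gradient_left]; exact hwν
    have hwN := h2 w hwt
    have hww : inner ℝ w w = 0 := by
      conv_lhs => rw [hw]
      rw [inner_sub_left, inner_smul_left, hwν, real_inner_comm, hwN]
      simp
    exact sub_eq_zero.1 (inner_self_eq_zero.1 hww)
  have hpos : 0 < inner ℝ ν N := by
    have h4 := hG.convexHull_boundary_subset (interior_subset (h3 (ε / 2) (by linarith)
      (by linarith)))
    have h5 : 0 ≤ G (p + (ε / 2) • N) := h4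
    have h6 := h5.trans (hG.le_fderiv hne _)
    rw [map_add, hG.fderiv_self hne, hp.2, zero_add, _root_.map_smul, smul_eq_mul,
      ← inner_gradient_left] at h6
    have h7 : 0 ≤ inner ℝ ν N := nonneg_of_mul_nonneg_right h6 (by linarith)
    refine lt_of_le_of_ne h7 fun h8 => ?_
    rw [← h8, zero_div, zero_smul] at hpar
    rw [hpar, norm_zero] at h1
    exact zero_ne_one h1
  have h4 : inner ℝ ν N = ‖ν‖ := by
    have h5 := congrArg norm hpar
    rw [h1, norm_smul, Real.norm_of_nonneg (by positivity)] at h5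
    field_simp at h5
    linarith
  rw [hpar, h4]
  congr 1
  field_simp

theorem inner_inwardNormal (hG : IsConeFunction m G ℓ e) (hn : 2 ≤ n) {p : E n}
    (hp : p ∈ boundary G) (w : E n) :
    inner ℝ (inwardNormal (boundary G) p) w = ‖∇ G p‖⁻¹ * fderiv ℝ G p w := by
  rw [hG.inwardNormal_boundary hn hp, real_inner_smul_left, inner_gradient_left]

theorem inv_norm_gradient_pos (hG : IsConeFunction m G ℓ e) {p : E n} (hp : p ∈ boundary G) :
    0 < ‖∇ G p‖⁻¹ :=
  inv_pos.2 (norm_pos_iff.2 (hG.gradient_ne_zero (hG.ne_height hp.1 hp.2)))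

theorem reflectVector_inwardNormal (hG : IsConeFunction m G ℓ e) (hn : 2 ≤ n) {p : E n}
    (hp : p ∈ boundary G) (w : E n) :
    reflectVector (inwardNormal (boundary G) p) w = reflectAlong (∇ G p) w := by
  have h := norm_pos_iff.2 (hG.gradient_ne_zero (hG.ne_height hp.1 hp.2))
  rw [reflectVector, reflectAlong, hG.inwardNormal_boundary hn hp, inner_smul_right, smul_smul]
  congr 2
  field_simp

theorem phaseSpace_boundary (hG : IsConeFunction m G ℓ e) :
    phaseSpace (boundary G) = crossingLines G := by
  ext x
  constructor
  · rintro ⟨hx, p, hp, ⟨t, rfl⟩, htr⟩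
    rw [hG.tangentConeAt_boundary hp] at htr
    have htr' : fderiv ℝ G (x.2 + t • x.1) x.1 ≠ 0 := htr
    have hne := hG.ne_height hp.1 hp.2
    -- A line through the vertex that meets the cone at another point contains a ruling there, so it
    -- would be tangent to the cone.
    refine ⟨hx, fun h => ?_, ?_⟩
    · have h1 := hG.fderiv_self hne
      rw [hp.2] at h1
      nth_rw 2 [h] at h1
      rw [zero_add, _root_.map_smul, smul_eq_mul] at h1
      have ht : t ≠ 0 := by
        rintro rfl
        exact hp.1 (by simp [h])
      exact htr' ((mul_eq_zero.1 h1).resolve_left ht)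
    · rcases lt_or_gt_of_ne htr' with h | h
      · obtain ⟨s, -, hs⟩ := hG.pos_of_fderiv_neg hp.1 hp.2 h
        refine ⟨t - s, ?_⟩
        convert hs using 2
        module
      · obtain ⟨s, -, hs⟩ := hG.pos_of_fderiv_neg (v := -x.1) hp.1 hp.2
          (by rw [map_neg]; linarith)
        refine ⟨t + s, ?_⟩
        convert hs using 2
        module
  · intro hx
    refine ⟨hx.1, ?_⟩
    have exit_case : ∀ y ∈ crossingLines G, G y.1 < 0 →
        ∃ p ∈ boundary G, p ∈ line y ∧ fderiv ℝ G p y.1 ≠ 0 := by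
      intro y hy h
      have hD := hG.mem_exitDomain_of_neg hy h
      exact ⟨exitPoint G y, ⟨hD.2.2, hG.exitPoint_zero hD⟩, ⟨exitTime G y, rfl⟩,
        (hG.fderiv_exitPoint_neg hD).ne⟩
    have hx0 := hG.ne_zero_of_mem hx
    have hconv : ∀ p ∈ boundary G, fderiv ℝ G p x.1 ≠ 0 →
        x.1 ∉ tangentConeAt ℝ (boundary G) p := by
      intro p hp h
      rw [hG.tangentConeAt_boundary hp]
      exact h
    by_cases h : G x.1 < 0
    · obtain ⟨p, hp, hpl, hpd⟩ := exit_case x hx h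
      exact ⟨p, hp, hpl, hconv p hp hpd⟩
    -- Only one of `v` and `-v` can lie in the solid cone, by the sign of the height. A line that
    -- never exits therefore exits when reversed.
    · have h' : G (-x.1) < 0 := by
        by_contra! h2
        have h3 := hG.height_pos _ hx0 (not_lt.1 h)
        have h4 := hG.height_pos _ (neg_ne_zero.2 hx0) h2
        rw [map_neg] at h4
        linarith
      have hrx : reverseLine x ∈ crossingLines G := by
        obtain ⟨h1, h2, t, ht⟩ := hx
        exact ⟨reverseLine_mem_unitLines h1, h2, -t, by simpa [reverseLine] using ht⟩
      obtain ⟨p, hp, ⟨t, ht⟩, hpd⟩ := exit_case (reverseLine x) hrx h'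
      refine ⟨p, hp, ⟨-t, by simpa [reverseLine] using ht⟩, hconv p hp ?_⟩
      simpa [reverseLine] using hpd

theorem isExitPoint_iff (hG : IsConeFunction m G ℓ e) (hn : 2 ≤ n) {x : E n × E n} {p : E n} :
    IsExitPoint (boundary G) x p ↔ x ∈ exitDomain G ∧ p = exitPoint G x := by
  constructor
  · rintro ⟨hp, ⟨t, rfl⟩, h⟩
    rw [real_inner_comm, hG.inner_inwardNormal hn hp] at h
    have h1 : fderiv ℝ G (x.2 + t • x.1) x.1 < 0 := by
      by_contra! h2
      exact h.not_ge (mul_nonneg (hG.inv_norm_gradient_pos hp).le h2)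
    obtain ⟨h2, -, h3⟩ := hG.mem_exitDomain_of_fderiv_neg hp.1 hp.2 h1
    exact ⟨h2, h3.symm⟩
  · rintro ⟨hx, rfl⟩
    have hp : exitPoint G x ∈ boundary G := ⟨hx.2.2, hG.exitPoint_zero hx⟩
    refine ⟨hp, ⟨exitTime G x, rfl⟩, ?_⟩
    rw [real_inner_comm, hG.inner_inwardNormal hn hp]
    exact mul_neg_of_pos_of_neg (hG.inv_norm_gradient_pos hp) (hG.fderiv_exitPoint_neg hx)

theorem billiardMap_of_mem (hG : IsConeFunction m G ℓ e) (hn : 2 ≤ n) {x : E n × E n}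
    (hx : x ∈ unitLines (E n)) (hD : x ∈ exitDomain G) :
    billiardMap (boundary G) x = bounce G x := by
  have h : ∃ p, IsExitPoint (boundary G) x p := ⟨_, (hG.isExitPoint_iff hn).2 ⟨hD, rfl⟩⟩
  have hc : h.choose = exitPoint G x := ((hG.isExitPoint_iff hn).1 h.choose_spec).2
  have hp : exitPoint G x ∈ boundary G := ⟨hD.2.2, hG.exitPoint_zero hD⟩
  rw [billiardMap, dif_pos h, hc, hG.reflectVector_inwardNormal hn hp, lineThrough]
  have hb := bounce_mem_unitLines (G := G) hx
  refine Prod.ext rfl ?_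
  show exitPoint G x - inner ℝ (exitPoint G x) (bounce G x).1 • (bounce G x).1 = (bounce G x).2
  have h1 := hG.bounce_line_exitTime hD
  have h2 : inner ℝ (exitPoint G x) (bounce G x).1 = exitTime G x := by
    rw [← h1, inner_add_left, real_inner_smul_left, real_inner_comm, hb.2,
      real_inner_self_eq_norm_sq, hb.1]
    ring
  rw [h2, ← h1]
  abel

theorem billiardMap_of_notMem (hG : IsConeFunction m G ℓ e) (hn : 2 ≤ n) {x : E n × E n}
    (hD : x ∉ exitDomain G) : billiardMap (boundary G) x = x := by
  rw [billiardMap, dif_neg]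
  rintro ⟨p, hp⟩
  exact hD ((hG.isExitPoint_iff hn).1 hp).1

theorem billiardMap_mem (hG : IsConeFunction m G ℓ e) (hn : 2 ≤ n) {x : E n × E n}
    (hx : x ∈ crossingLines G) : billiardMap (boundary G) x ∈ crossingLines G ∧
      finalLine G (billiardMap (boundary G) x) = finalLine G x := by
  by_cases hD : x ∈ exitDomain G
  · rw [hG.billiardMap_of_mem hn hx.1 hD]
    exact ⟨hG.bounce_mem_crossingLines hx hD, hG.finalLine_bounce hx hD⟩
  · rw [hG.billiardMap_of_notMem hn hD]
    exact ⟨hx, rfl⟩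

theorem iterate_billiardMap_mem (hG : IsConeFunction m G ℓ e) (hn : 2 ≤ n) (i : ℕ)
    {x : E n × E n} (hx : x ∈ crossingLines G) :
    (billiardMap (boundary G))^[i] x ∈ crossingLines G ∧
      finalLine G ((billiardMap (boundary G))^[i] x) = finalLine G x := by
  induction i generalizing x with
  | zero => exact ⟨hx, rfl⟩
  | succ i ih =>
    obtain ⟨h1, h2⟩ := hG.billiardMap_mem hn hx
    rw [Function.iterate_succ_apply]
    exact ⟨(ih h1).1, (ih h1).2.trans h2⟩

theorem iterate_billiardMap_eq (hG : IsConeFunction m G ℓ e) (hn : 2 ≤ n) {i : ℕ}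
    {x : E n × E n} (hx : x ∈ unitLines (E n)) (h : Admissible G i x) :
    (billiardMap (boundary G))^[i] x = (bounce G)^[i] x := by
  induction i generalizing x with
  | zero => rfl
  | succ i ih =>
    rw [admissible_succ_iff] at h
    rw [Function.iterate_succ_apply, Function.iterate_succ_apply,
      hG.billiardMap_of_mem hn hx h.1, ih (bounce_mem_unitLines hx) h.2]

/-- The extended billiard map preserves the final line. Conversely, of two lines with the same final
line, the one with more reflections remaining reaches the other. -/
theorem trajectory_boundary (hG : IsConeFunction m G ℓ e) (hn : 2 ≤ n) {x : E n × E n}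
    (hx : x ∈ crossingLines G) : trajectory (boundary G) x =
      {y ∈ crossingLines G | finalLine G y = finalLine G x} := by
  ext y
  rw [trajectory, hG.phaseSpace_boundary]
  constructor
  · rintro ⟨hy, i, h | h⟩
    · exact ⟨hy, by rw [← h, (hG.iterate_billiardMap_mem hn i hx).2]⟩
    · exact ⟨hy, by rw [← h, (hG.iterate_billiardMap_mem hn i hy).2]⟩
  · rintro ⟨hy, h⟩
    refine ⟨hy, ?_⟩
    rcases le_total (bounceCount G y) (bounceCount G x) with hle | hle
    · obtain ⟨i, h1, h2⟩ := hG.eq_iterate_of_finalLine_eq hx hy h.symm hle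
      exact ⟨i, Or.inl (by rw [hG.iterate_billiardMap_eq hn hx.1 h1, h2])⟩
    · obtain ⟨i, h1, h2⟩ := hG.eq_iterate_of_finalLine_eq hy hx h hle
      exact ⟨i, Or.inr (by rw [hG.iterate_billiardMap_eq hn hy.1 h1, h2])⟩

theorem mem_Delta0_boundary_iff (hG : IsConeFunction m G ℓ e) (hn : 2 ≤ n) {x : E n × E n} :
    x ∈ Delta0 (boundary G) ↔ x ∈ crossingLines G ∧ G x.1 = 0 := by
  constructor
  · rintro ⟨h1, h2, h3⟩
    rw [hG.inner_inwardNormal hn h2] at h3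
    refine ⟨hG.mem_crossingLines_of_fderiv_pos h1 h2.2 ?_, h2.2⟩
    exact pos_of_mul_pos_right h3 (hG.inv_norm_gradient_pos h2).le
  · rintro ⟨h1, h2⟩
    have hb : x.1 ∈ boundary G := ⟨hG.ne_zero_of_mem h1, h2⟩
    refine ⟨h1.1, hb, ?_⟩
    rw [hG.inner_inwardNormal hn hb]
    exact mul_pos (hG.inv_norm_gradient_pos hb) (hG.fderiv_pos_of_asymptotic h1 h2)

theorem Delta_boundary (hG : IsConeFunction m G ℓ e) (hn : 2 ≤ n) :
    Delta (boundary G) = {x ∈ crossingLines G | G (finalLine G x).1 = 0} := by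
  ext x
  rw [Delta, hG.phaseSpace_boundary]
  constructor
  · rintro ⟨hx, i, hi⟩
    rw [hG.mem_Delta0_boundary_iff hn] at hi
    refine ⟨hx, ?_⟩
    rw [← (hG.iterate_billiardMap_mem hn i hx).2, finalLine_of_nonneg hi.2.ge]
    exact hi.2
  · rintro ⟨hx, h⟩
    refine ⟨hx, bounceCount G x, ?_⟩
    rw [hG.mem_Delta0_boundary_iff hn,
      hG.iterate_billiardMap_eq hn hx.1 (hG.bounceCount_spec hx).1]
    exact ⟨hG.finalLine_mem hx, h⟩

theorem phaseSpace_diff_Delta (hG : IsConeFunction m G ℓ e) (hn : 2 ≤ n) :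
    phaseSpace (boundary G) \ Delta (boundary G) =
      {x ∈ crossingLines G | 0 < G (finalLine G x).1} := by
  ext x
  rw [hG.phaseSpace_boundary, hG.Delta_boundary hn]
  constructor
  · rintro ⟨h1, h2⟩
    exact ⟨h1, lt_of_le_of_ne (hG.bounceCount_spec h1).2 fun h => h2 ⟨h1, h.symm⟩⟩
  · rintro ⟨h1, h2⟩
    exact ⟨h1, fun h => h2.ne' h.2⟩

theorem isOpen_phaseSpace_diff_Delta (hG : IsConeFunction m G ℓ e) (hn : 2 ≤ n) :
    ∃ U, IsOpen U ∧ phaseSpace (boundary G) \ Delta (boundary G) = orientedLines n ∩ U := by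
  rw [hG.phaseSpace_diff_Delta hn]
  set S := {x ∈ crossingLines G | 0 < G (finalLine G x).1}
  refine ⟨interior {y | y ∈ orientedLines n → y ∈ S}, isOpen_interior, ?_⟩
  ext x
  constructor
  · rintro hx
    refine ⟨hx.1.1, mem_interior_iff_mem_nhds.2 ?_⟩
    have h1 := hG.eventually_finalLine_eq hx.1 hx.2
    have h2 := eventually_mem_nhdsWithin (a := x) (s := crossingLines G)
    have h3 := h1.and h2
    rw [hG.nhdsWithin_crossingLines hx.1, eventually_nhdsWithin_iff] at h3
    filter_upwards [h3] with y hy hyo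
    exact ⟨(hy hyo).2, (hy hyo).1.2⟩
  · rintro ⟨h1, h2⟩
    exact interior_subset h2 h1

theorem isCodimOneSubmanifold_Delta (hG : IsConeFunction m G ℓ e) (hn : 2 ≤ n) {k : ℕ∞}
    (hk0 : k ≠ 0) (hk : (k : ℕ∞ω) + 1 ≤ m) : IsCodimOneSubmanifold k (Delta (boundary G)) := by
  have hkm : (k : ℕ∞ω) ≤ m := le_trans le_self_add hk
  have hk0' : (k : ℕ∞ω) ≠ 0 := by exact_mod_cast hk0
  rw [hG.Delta_boundary hn]
  refine ⟨fun x hx => hx.1.1, fun x hx => ?_⟩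
  obtain ⟨hx, h0⟩ := hx
  have ha := (hG.bounceCount_spec hx).1
  set N := bounceCount G x with hN
  have hz := hG.finalLine_mem hx
  have hzne := hG.ne_height (hG.ne_zero_of_mem hz) h0
  have hcont : ContinuousAt (fun y => ((bounce G)^[N] y).1) x :=
    (hG.admissible_local hk ha).2.continuousAt.fst
  have h1 := hG.eventually_zero_iff hx h0
  have h2 := h1.and (eventually_mem_nhdsWithin (a := x) (s := crossingLines G))
  rw [hG.nhdsWithin_crossingLines hx, eventually_nhdsWithin_iff] at h2
  have h3 := hcont.eventually (hG.eventually_ne_height hzne)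
  obtain ⟨U, hU, hUo, hxU⟩ := eventually_nhds_iff.1
    (h2.and (h3.and (hG.admissible_local hk ha).1))
  have hsm : ∀ y ∈ U, ContDiffAt ℝ k (fun y => G ((bounce G)^[N] y).1) y := by
    intro y hy
    obtain ⟨-, hy2, hy3⟩ := hU y hy
    have h4 : ContDiffAt ℝ k (fun y => ((bounce G)^[N] y).1) y :=
      contDiffAt_fst.comp y (hG.admissible_local hk hy3).2
    exact ((hG.contDiffAt _ hy2).of_le hkm).comp y h4
  refine ⟨U, fun y => G ((bounce G)^[N] y).1, hUo, hxU,
    fun y hy => (hsm y hy).contDiffWithinAt, ?_, ?_⟩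
  · ext y
    constructor
    · rintro ⟨⟨hy1, hy2⟩, hyU⟩
      exact ⟨⟨hy1.1, hyU⟩, ((hU y hyU).1 hy1.1).1.1 hy2⟩
    · rintro ⟨⟨hy1, hyU⟩, hy2⟩
      obtain ⟨h5, h6⟩ := (hU y hyU).1 hy1
      exact ⟨⟨h6, h5.2 hy2⟩, hyU⟩
  · set z := (bounce G)^[N] x with hzdef
    have hzl : finalLine G x = z := rfl
    rw [hzl] at hz h0 hzne
    set B := fderiv ℝ (bounce G)^[N] x with hB
    have hinj : Function.Injective (B : E n × E n →ₗ[ℝ] E n × E n) := by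
      rw [← LinearMap.ker_eq_bot, LinearMap.ker_eq_bot']
      exact fun w hw => (hG.fderiv_iterate_bounce ha w).1 hw
    -- The target vector is `∇G` in the direction component, with a position component chosen to
    -- keep it tangent to the space of lines. Its preimage is then tangent as well, and the defining
    -- function has derivative `‖∇G‖²` along it.
    obtain ⟨w, hw⟩ := LinearMap.surjective_of_injective hinj
      (∇ G z.1, -(inner ℝ (∇ G z.1) z.2 : ℝ) • z.1)
    have hw' : B w = (∇ G z.1, -(inner ℝ (∇ G z.1) z.2 : ℝ) • z.1) := hw
    obtain ⟨-, t1, t2⟩ := hG.fderiv_iterate_bounce ha w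
    rw [← hB, hw'] at t1 t2
    refine ⟨w, ⟨?_, ?_⟩, ?_⟩
    · rw [← t1]
      exact (hG.inner_gradient_self hzne).trans h0
    · rw [← t2]
      simp only [inner_smul_right, ← hzdef, real_inner_self_eq_norm_sq, hz.1.1]
      ring
    · have hBd : HasFDerivAt (bounce G)^[N] B x :=
        ((hG.admissible_local hk ha).2.differentiableAt hk0').hasFDerivAt
      have hGd : HasFDerivAt G (fderiv ℝ G z.1) ((bounce G)^[N] x).1 :=
        (hG.differentiableAt hzne).hasFDerivAt
      have h7 : HasFDerivAt (fun y => G ((bounce G)^[N] y).1) _ x := hGd.comp x hBd.fst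
      rw [h7.fderiv]
      simp only [ContinuousLinearMap.comp_apply, hw', ContinuousLinearMap.coe_fst']
      rw [← inner_gradient_left, real_inner_self_eq_norm_sq]
      have := norm_pos_iff.2 (hG.gradient_ne_zero hzne)
      positivity

end IsConeFunction

end ConeBilliard

/-! ### Smoothness of the gauge of a convex body -/

namespace ConeBilliard

open Filter Topology Set
open scoped ContDiff Gradient Pointwise

section Coordinates

variable {d : ℕ}

/-- The first `d` coordinates of a vector of `ℝᵈ⁺¹`. -/
def dropLast : E (d + 1) →L[ℝ] E d :=
  LinearMap.toContinuousLinearMap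
    { toFun := fun x => WithLp.toLp 2 fun i => x i.castSucc
      map_add' := fun x y => by ext i; simp
      map_smul' := fun t x => by ext i; simp }

/-- The last coordinate of a vector of `ℝᵈ⁺¹`. -/
def height : E (d + 1) →L[ℝ] ℝ := EuclideanSpace.proj (Fin.last d)

@[simp] theorem dropLast_apply (x : E (d + 1)) (i : Fin d) : dropLast x i = x i.castSucc := rfl

theorem dropLast_lift (y : E d) : dropLast (lift y) = y := by
  ext i; simp [lift]

theorem height_lift (y : E d) : height (lift y) = 1 := by
  simp [height, lift]

theorem ext_dropLast_height {x y : E (d + 1)} (h1 : dropLast x = dropLast y)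
    (h2 : height x = height y) : x = y := by
  ext i
  refine Fin.lastCases h2 (fun j => ?_) i
  rw [← dropLast_apply, h1, dropLast_apply]

theorem eq_height_smul_lift {x : E (d + 1)} (h : height x ≠ 0) :
    x = height x • lift ((height x)⁻¹ • dropLast x) := by
  refine ext_dropLast_height ?_ ?_
  · rw [map_smul, dropLast_lift, smul_smul, mul_inv_cancel₀ h, one_smul]
  · rw [map_smul, height_lift, smul_eq_mul, mul_one]

end Coordinates

section Gauge

variable {d : ℕ} {C : Set (E d)} {c : E d}

/-- The translate of `C` that moves `c` to the origin. -/
def recenter (C : Set (E d)) (c : E d) : Set (E d) := {y | c + y ∈ C}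

theorem recenter_mem_nhds (hc : c ∈ interior C) : recenter C c ∈ 𝓝 (0 : E d) := by
  have h1 : C ∈ 𝓝 (c + 0) := by rw [add_zero]; exact mem_interior_iff_mem_nhds.1 hc
  have h2 : ContinuousAt (fun y : E d => c + y) 0 := by fun_prop
  exact h2 h1

theorem convex_recenter (hC : Convex ℝ C) : Convex ℝ (recenter C c) :=
  hC.translate_preimage_right c

theorem gauge_recenter_eq_one_iff (hC : Convex ℝ C) (hc : c ∈ interior C) {y : E d} :
    gauge (recenter C c) y = 1 ↔ c + y ∈ frontier C := by
  rw [gauge_eq_one_iff_mem_frontier (convex_recenter hC) (recenter_mem_nhds hc)]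
  have h1 : recenter C c = Homeomorph.addLeft c ⁻¹' C := rfl
  rw [h1, ← (Homeomorph.addLeft c).preimage_frontier]
  rfl

theorem gauge_recenter_lt_one_iff (hC : Convex ℝ C) (hc : c ∈ interior C) {y : E d} :
    gauge (recenter C c) y < 1 ↔ c + y ∈ interior C := by
  rw [gauge_lt_one_iff_mem_interior (convex_recenter hC) (recenter_mem_nhds hc)]
  have h1 : recenter C c = Homeomorph.addLeft c ⁻¹' C := rfl
  rw [h1, ← (Homeomorph.addLeft c).preimage_interior]
  rfl

theorem gauge_recenter_pos (hCc : IsCompact C) (hc : c ∈ interior C) {y : E d} (hy : y ≠ 0) :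
    0 < gauge (recenter C c) y := by
  refine (gauge_pos (absorbent_nhds_zero (recenter_mem_nhds hc)) ?_).2 hy
  rw [NormedSpace.isVonNBounded_iff]
  obtain ⟨R, hR⟩ := hCc.isBounded.exists_norm_le
  refine (Metric.isBounded_closedBall (x := (0 : E d)) (r := R + ‖c‖)).subset fun y hy => ?_
  rw [mem_closedBall_zero_iff]
  have h1 := hR _ hy
  have h2 := norm_sub_le (c + y) c
  rw [add_sub_cancel_left] at h2
  linarith

/-- The radial direction is transversal to the boundary of a convex body. -/
theorem fderiv_radial_ne_zero (hC : Convex ℝ C) (hc : c ∈ interior C)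
    {q : E d} (hq : q ∈ frontier C) {U : Set (E d)} {h : E d → ℝ} (hU : IsOpen U) (hqU : q ∈ U)
    (hh : ContDiffOn ℝ 1 h U) (hγ : frontier C ∩ U = {y ∈ U | h y = 0})
    (hd : fderiv ℝ h q ≠ 0) : fderiv ℝ h q (q - c) ≠ 0 := by
  intro h0
  have hhq : h q = 0 := by
    have : q ∈ {y ∈ U | h y = 0} := hγ ▸ ⟨hq, hqU⟩
    exact this.2
  obtain ⟨w, hw⟩ : ∃ w, fderiv ℝ h q w = 1 := by
    obtain ⟨w, hw⟩ : ∃ w, fderiv ℝ h q w ≠ 0 := by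
      by_contra! hcon
      exact hd (by ext w; simp [hcon w])
    exact ⟨(fderiv ℝ h q w)⁻¹ • w, by simp [hw]⟩
  -- If the radial derivative vanished, the centres `c - θ w` with `|θ| ≤ ε` would all be interior,
  -- and `h` along the ray from such a centre through `q` would have derivative `θ` at `q`. By the
  -- intermediate value theorem in `θ`, some ray meets the boundary again beyond `q`.
  obtain ⟨r, hr, hball⟩ := Metric.isOpen_iff.1 isOpen_interior c hc
  set ε := r / (2 * (‖w‖ + 1)) with hε
  have hε0 : 0 < ε := by positivity
  have hεw : ∀ θ ∈ Icc (-ε) ε, c - θ • w ∈ interior C := by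
    intro θ hθ
    refine hball ?_
    rw [mem_ball_iff_norm, sub_sub_cancel_left, norm_neg, norm_smul, Real.norm_eq_abs]
    calc |θ| * ‖w‖ ≤ ε * (‖w‖ + 1) := by
          gcongr
          · exact abs_le.2 ⟨hθ.1, hθ.2⟩
          · linarith
      _ = r / 2 := by rw [hε]; field_simp
      _ < r := by linarith
  have hdiff : DifferentiableAt ℝ h q :=
    (hh.contDiffAt (hU.mem_nhds hqU)).differentiableAt one_ne_zero
  have hderiv : ∀ θ : ℝ, HasDerivAt (fun s : ℝ => h (q + s • (q - c + θ • w))) θ 0 := by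
    intro θ
    have h1 : HasDerivAt (fun s : ℝ => q + s • (q - c + θ • w)) (q - c + θ • w) 0 := by
      simpa using ((hasDerivAt_id (0 : ℝ)).smul_const (q - c + θ • w)).const_add q
    have h2 : HasFDerivAt h (fderiv ℝ h q) (q + (0 : ℝ) • (q - c + θ • w)) := by
      simpa using hdiff.hasFDerivAt
    have h3 := h2.comp_hasDerivAt (0 : ℝ) h1
    rw [map_add, h0, map_smul, hw, smul_eq_mul, mul_one, zero_add] at h3
    exact h3
  have hsl : ∀ θ : ℝ, Tendsto (fun s : ℝ => h (q + s • (q - c + θ • w)) / s) (𝓝[>] 0) (𝓝 θ) := by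
    intro θ
    have h1 := (hderiv θ).hasDerivWithinAt (s := Ioi 0)
    rw [hasDerivWithinAt_iff_tendsto_slope' (by simp)] at h1
    refine h1.congr fun s => ?_
    rw [slope_def_field, zero_smul, add_zero, hhq, sub_zero, sub_zero]
  have hnear : ∀ᶠ s in 𝓝[>] (0 : ℝ), ∀ θ ∈ Icc (-ε) ε, q + s • (q - c + θ • w) ∈ U := by
    have h1 : ∀ᶠ s in 𝓝 (0 : ℝ), ∀ θ ∈ Icc (-ε) ε, q + s • (q - c + θ • w) ∈ U := by
      refine (isCompact_Icc (a := -ε) (b := ε)).eventually_forall_of_forall_eventually ?_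
      intro θ _
      have hcont : ContinuousAt (fun z : ℝ × ℝ => q + z.1 • (q - c + z.2 • w)) (0, θ) := by
        fun_prop
      exact hcont.eventually (by simpa using hU.mem_nhds hqU)
    exact nhdsWithin_le_nhds h1
  obtain ⟨s, hsU, hs1, hs2, hs0⟩ := (hnear.and (((hsl ε).eventually_const_lt hε0).and
    (((hsl (-ε)).eventually_lt_const (neg_lt_zero.2 hε0)).and self_mem_nhdsWithin))).exists
  have hs : 0 < s := hs0
  have hp : 0 ≤ h (q + s • (q - c + ε • w)) := by
    have := (lt_div_iff₀ hs).1 hs1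
    linarith
  have hn : h (q + s • (q - c + (-ε) • w)) ≤ 0 := by
    have := (div_lt_iff₀ hs).1 hs2
    linarith
  have hcont : ContinuousOn (fun θ : ℝ => h (q + s • (q - c + θ • w))) (Icc (-ε) ε) :=
    hh.continuousOn.comp (by fun_prop) fun θ hθ => hsU θ hθ
  obtain ⟨θ, hθ, hθ0⟩ := intermediate_value_Icc (by linarith) hcont ⟨hn, hp⟩
  have hmem : q + s • (q - c + θ • w) ∈ frontier C := by
    have : q + s • (q - c + θ • w) ∈ frontier C ∩ U := by
      rw [hγ]; exact ⟨hsU θ hθ, hθ0⟩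
    exact this.1
  -- The point `q` lies strictly between the interior point `c - θ • w` and a boundary point, hence
  -- is interior, a contradiction.
  have hint : q ∈ interior C := by
    have h1 := hC.combo_interior_closure_mem_interior (hεw θ hθ) (frontier_subset_closure hmem)
      (a := s / (1 + s)) (b := 1 / (1 + s)) (by positivity) (by positivity) (by field_simp; ring)
    convert h1 using 1
    have e1 : s / (1 + s) = s * (1 / (1 + s)) := by ring
    have e2 : (1 / (1 + s)) * (1 + s) = 1 := by field_simp
    calc q = ((1 / (1 + s)) * (1 + s)) • q := by rw [e2, one_smul]
      _ = _ := by rw [e1]; module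
  exact hq.2 hint

/-- The gauge value `N y` solves `h (c + N⁻¹ • y) = 0`. The derivative of this equation in `N` is a
nonzero multiple of the radial derivative of `h`, so the implicit function theorem applies. -/
theorem contDiffAt_gauge_recenter {m : ℕ∞ω} (hm : 1 ≤ m) (hC : Convex ℝ C) (hCc : IsCompact C)
    (hc : c ∈ interior C)
    (hloc : ∀ q ∈ frontier C, ∃ (U : Set (E d)) (h : E d → ℝ), IsOpen U ∧ q ∈ U ∧
      ContDiffOn ℝ m h U ∧ frontier C ∩ U = {y ∈ U | h y = 0} ∧ fderiv ℝ h q ≠ 0)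
    {y₀ : E d} (hy₀ : y₀ ≠ 0) : ContDiffAt ℝ m (gauge (recenter C c)) y₀ := by
  set N := gauge (recenter C c) with hN
  have hm0 : m ≠ 0 := by rintro rfl; simp at hm
  have hNc : Continuous N := continuous_gauge (convex_recenter hC) (recenter_mem_nhds hc)
  have hpos : ∀ y, y ≠ 0 → 0 < N y := fun y hy => gauge_recenter_pos hCc hc hy
  have hfr : ∀ y, y ≠ 0 → c + (N y)⁻¹ • y ∈ frontier C := by
    intro y hy
    rw [← gauge_recenter_eq_one_iff hC hc,
      gauge_smul_of_nonneg (inv_nonneg.2 (hpos y hy).le), smul_eq_mul]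
    exact inv_mul_cancel₀ (hpos y hy).ne'
  set q := c + (N y₀)⁻¹ • y₀ with hq
  obtain ⟨U, h, hU, hqU, hh, hγ, hd⟩ := hloc q (hfr y₀ hy₀)
  have hg := hpos y₀ hy₀
  let f : E d × ℝ → ℝ := fun z => h (c + z.2⁻¹ • z.1)
  have hhq : ContDiffAt ℝ m h q := hh.contDiffAt (hU.mem_nhds hqU)
  have hf : ContDiffAt ℝ m f (y₀, N y₀) := by
    have h1 : ContDiffAt ℝ m (fun z : E d × ℝ => c + z.2⁻¹ • z.1) (y₀, N y₀) :=
      contDiffAt_const.add ((contDiffAt_snd.inv hg.ne').smul contDiffAt_fst)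
    exact ContDiffAt.comp (g := h) (y₀, N y₀) hhq h1
  have hinr : (fderiv ℝ f (y₀, N y₀) ∘L .inr ℝ (E d) ℝ) 1 ≠ 0 := by
    have h1 : HasFDerivAt (fun s : ℝ => f (y₀, s))
        (fderiv ℝ f (y₀, N y₀) ∘L .inr ℝ (E d) ℝ) (N y₀) :=
      (hf.differentiableAt hm0).hasFDerivAt.comp (N y₀) (hasFDerivAt_prodMk_right y₀ (N y₀))
    have h2 : HasDerivAt (fun s : ℝ => c + s⁻¹ • y₀) ((-(N y₀ ^ 2)⁻¹) • y₀) (N y₀) :=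
      ((hasDerivAt_inv hg.ne').smul_const y₀).const_add c
    have h3 : HasFDerivAt h (fderiv ℝ h q) (c + (N y₀)⁻¹ • y₀) :=
      (hhq.differentiableAt hm0).hasFDerivAt
    rw [h1.hasDerivAt.unique (h3.comp_hasDerivAt (N y₀) h2)]
    have h4 := fderiv_radial_ne_zero hC hc (hfr y₀ hy₀) hU hqU (hh.of_le hm) hγ hd
    intro h6
    rw [map_smul, smul_eq_mul, mul_eq_zero] at h6
    have h7 := h6.resolve_left (neg_ne_zero.2 (inv_ne_zero (pow_ne_zero 2 hg.ne')))
    refine h4 ?_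
    rw [add_sub_cancel_left, map_smul]
    exact (congrArg ((N y₀)⁻¹ • ·) h7).trans (smul_zero _)
  have hinv : (fderiv ℝ f (y₀, N y₀) ∘L .inr ℝ (E d) ℝ).IsInvertible :=
    isInvertible_of_apply_one_ne_zero hinr
  refine (hf.contDiffAt_implicitFunction hm0 hinv).congr_of_eventuallyEq ?_
  have h2 := hf.eventually_apply_eq_iff_implicitFunction hm0 hinv
  have hcont : ContinuousAt (fun y => (y, N y)) y₀ := (continuous_id.prodMk hNc).continuousAt
  have hcq : ContinuousAt (fun y => c + (N y)⁻¹ • y) y₀ :=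
    continuousAt_const.add ((hNc.continuousAt.inv₀ hg.ne').smul continuousAt_id)
  have hzero : ∀ y, y ≠ 0 → c + (N y)⁻¹ • y ∈ U → f (y, N y) = 0 := by
    intro y hy hyU
    have : c + (N y)⁻¹ • y ∈ {y ∈ U | h y = 0} := hγ ▸ ⟨hfr y hy, hyU⟩
    exact this.2
  filter_upwards [hcont.eventually h2, hcq.eventually (hU.mem_nhds hqU),
    isOpen_ne.mem_nhds hy₀] with y hy1 hy2 hy3
  exact (hy1.1 ((hzero y hy3 hy2).trans (hzero y₀ hy₀ hqU).symm)).symm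

end Gauge

end ConeBilliard

/-! ### The cone function of a strictly convex body -/

namespace ConeBilliard

open Filter Topology Set
open scoped ContDiff Gradient

variable {d : ℕ} {C : Set (E d)} {c : E d} {m : ℕ∞ω}

/-- The concave homogeneous function whose zero set is the cone over the boundary of `C`. -/
def coneFunction (C : Set (E d)) (c : E d) (x : E (d + 1)) : ℝ :=
  height x - gauge (recenter C c) (dropLast x - height x • c)

theorem coneFunction_of_height_pos {x : E (d + 1)}
    (h : 0 < height x) : coneFunction C c x =
      height x * (1 - gauge (recenter C c) ((height x)⁻¹ • dropLast x - c)) := by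
  have h1 : dropLast x - height x • c = height x • ((height x)⁻¹ • dropLast x - c) := by
    rw [smul_sub, smul_smul, mul_inv_cancel₀ h.ne', one_smul]
  rw [coneFunction, h1, gauge_smul_of_nonneg h.le, smul_eq_mul]
  ring

theorem coneFunction_eq_zero_iff (hC : Convex ℝ C) (hc : c ∈ interior C) {x : E (d + 1)}
    (h : 0 < height x) :
    coneFunction C c x = 0 ↔ (height x)⁻¹ • dropLast x ∈ frontier C := by
  have h1 := gauge_recenter_eq_one_iff hC hc (y := (height x)⁻¹ • dropLast x - c)
  rw [add_sub_cancel] at h1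
  rw [coneFunction_of_height_pos h, mul_eq_zero, or_iff_right h.ne', sub_eq_zero, eq_comm, h1]

theorem coneFunction_pos_iff (hC : Convex ℝ C) (hc : c ∈ interior C) {x : E (d + 1)}
    (h : 0 < height x) :
    0 < coneFunction C c x ↔ (height x)⁻¹ • dropLast x ∈ interior C := by
  have h1 := gauge_recenter_lt_one_iff hC hc (y := (height x)⁻¹ • dropLast x - c)
  rw [add_sub_cancel] at h1
  rw [coneFunction_of_height_pos h, mul_pos_iff_of_pos_left h, sub_pos, h1]

theorem height_pos_of_coneFunction_nonneg (hCc : IsCompact C) (hc : c ∈ interior C)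
    {x : E (d + 1)} (hx : x ≠ 0) (h : 0 ≤ coneFunction C c x) : 0 < height x := by
  have h1 := gauge_nonneg (s := recenter C c) (dropLast x - height x • c)
  rw [coneFunction] at h
  refine lt_of_le_of_ne (by linarith) fun h0 => hx ?_
  rw [← h0, zero_smul, sub_zero] at h
  have h2 : dropLast x = 0 := by
    by_contra h3
    linarith [gauge_recenter_pos hCc hc h3]
  exact ext_dropLast_height (by rw [h2, map_zero]) (by rw [← h0, map_zero])

theorem isConcaveConeFunction_coneFunction (hm : 3 ≤ m) (hC : StrictConvex ℝ C)
    (hCc : IsCompact C) (hc : c ∈ interior C)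
    (hloc : ∀ q ∈ frontier C, ∃ (U : Set (E d)) (h : E d → ℝ), IsOpen U ∧ q ∈ U ∧
      ContDiffOn ℝ m h U ∧ frontier C ∩ U = {y ∈ U | h y = 0} ∧ fderiv ℝ h q ≠ 0) :
    IsConcaveConeFunction m (coneFunction C c) height (lift c) where
  three_le := hm
  map_smul t ht x := by
    have h1 : dropLast (t • x) - height (t • x) • c = t • (dropLast x - height x • c) := by
      simp only [map_smul, smul_eq_mul, smul_sub, smul_smul]
    rw [coneFunction, h1, gauge_smul_of_nonneg ht, map_smul, coneFunction]
    simp only [smul_eq_mul]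
    ring
  superadd x y := by
    have h1 : dropLast (x + y) - height (x + y) • c
        = (dropLast x - height x • c) + (dropLast y - height y • c) := by
      simp only [map_add, add_smul]; abel
    have h2 := gauge_add_le (convex_recenter (c := c) hC.convex)
      (absorbent_nhds_zero (recenter_mem_nhds hc))
      (dropLast x - height x • c) (dropLast y - height y • c)
    rw [← h1] at h2
    simp only [coneFunction, map_add] at h2 ⊢
    linarith
  continuous := by
    refine height.continuous.sub ((continuous_gauge (convex_recenter hC.convex)
      (recenter_mem_nhds hc)).comp ?_)
    fun_prop
  add_axis x r := by
    have h1 : dropLast (x + r • lift c) - height (x + r • lift c) • c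
        = dropLast x - height x • c := by
      rw [map_add, map_add, map_smul, map_smul, dropLast_lift, height_lift, smul_eq_mul]
      module
    rw [coneFunction, h1, map_add, map_smul, height_lift, coneFunction, smul_eq_mul]
    ring
  le_height x := by
    have := gauge_nonneg (s := recenter C c) (dropLast x - height x • c)
    rw [coneFunction]
    linarith
  height_pos x hx h := height_pos_of_coneFunction_nonneg hCc hc hx h
  contDiffAt x hx := by
    have h1 : dropLast x - height x • c ≠ 0 := by
      intro h
      rw [coneFunction, h, gauge_zero, sub_zero] at hx
      exact hx rfl
    have h2 := contDiffAt_gauge_recenter (le_trans (by norm_num) hm) hC.convex hCc hc hloc h1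
    have h3 : ContDiffAt ℝ m (fun x : E (d + 1) => dropLast x - height x • c) x := by fun_prop
    exact height.contDiff.contDiffAt.sub
      (ContDiffAt.comp (g := gauge (recenter C c)) x h2 h3)
  strict p q hp hq hpq hne := by
    have hp0 : p ≠ 0 := by
      rintro rfl
      refine hne ?_
      by_contra hq0
      have := height_pos_of_coneFunction_nonneg hCc hc (Ne.symm hq0) hq.ge
      rw [← hpq, map_zero] at this
      exact this.false
    have hhp := height_pos_of_coneFunction_nonneg hCc hc hp0 hp.ge
    have hhq : 0 < height q := hpq ▸ hhp
    rw [coneFunction_eq_zero_iff hC.convex hc hhp] at hp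
    rw [coneFunction_eq_zero_iff hC.convex hc hhq] at hq
    rw [coneFunction_pos_iff hC.convex hc (by rw [map_add]; linarith)]
    have h1 : (height p)⁻¹ • dropLast p ≠ (height q)⁻¹ • dropLast q := by
      intro h
      rw [← hpq] at h
      exact hne (ext_dropLast_height (smul_right_injective _ (inv_ne_zero hhp.ne') h) hpq)
    have hcl : IsClosed C := hCc.isClosed
    have h2 := hC (hcl.frontier_subset hp) (hcl.frontier_subset hq) h1
      (a := 1 / 2) (b := 1 / 2) (by norm_num) (by norm_num) (by norm_num)
    convert h2 using 1
    rw [map_add, map_add, ← hpq]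
    have e1 : (height p + height p)⁻¹ = (1 / 2) * (height p)⁻¹ := by field_simp; norm_num
    rw [e1]
    module

/-- A negative semidefinite symmetric form vanishes on every vector on which its quadratic form
vanishes. -/
theorem apply_eq_zero_of_nonpos {V : Type*} [NormedAddCommGroup V] [NormedSpace ℝ V]
    {B : V →L[ℝ] V →L[ℝ] ℝ} (hB : ∀ u, B u u ≤ 0) (hs : ∀ u w, B u w = B w u) {u : V}
    (hu : B u u = 0) (w : V) : B u w = 0 := by
  by_contra h
  set β := B u w with hβ
  have hb := hB w
  set b := B w w with hbdef
  have key : ∀ t : ℝ, t * (2 * β + t * b) ≤ 0 := by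
    intro t
    have h1 := hB (u + t • w)
    simp only [map_add, map_smul, add_apply, smul_apply, smul_eq_mul, hu, hs w u] at h1
    rw [← hβ, ← hbdef] at h1
    linarith
  have h1 : 0 < 1 - b := by linarith
  -- As `b ≤ 0`, this value of `t` is defined and makes the left side of `key` strictly positive
  -- when `β ≠ 0`.
  have h2 := key (β / (1 - b))
  have h3 : β / (1 - b) * (2 * β + β / (1 - b) * b) = β ^ 2 * (2 - b) / (1 - b) ^ 2 := by
    field_simp
    ring
  rw [h3] at h2
  have h4 : 0 < β ^ 2 * (2 - b) / (1 - b) ^ 2 := by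
    have := sq_pos_of_ne_zero h
    have h5 : 0 < 2 - b := by linarith
    positivity
  linarith

/-- The first two derivatives of a local defining function of the boundary of `C` along the
radial projection of a line, in terms of the cone function. -/
theorem fderiv_defining_function (hG : IsConcaveConeFunction m (coneFunction C c) height (lift c))
    (hC : Convex ℝ C) (hc : c ∈ interior C)
    {p : E (d + 1)} (hp : p ≠ 0) (hp0 : coneFunction C c p = 0) {U : Set (E d)} {h : E d → ℝ}
    (hU : IsOpen U) (hqU : (height p)⁻¹ • dropLast p ∈ U) (hh : ContDiffOn ℝ 2 h U)
    (hγ : frontier C ∩ U = {y ∈ U | h y = 0}) {v : E (d + 1)} (hv : height v = 0) :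
    height p * fderiv ℝ h ((height p)⁻¹ • dropLast p) (dropLast v) =
      -fderiv ℝ (coneFunction C c) p v *
        fderiv ℝ h ((height p)⁻¹ • dropLast p) (dropLast p - height p • c) ∧
    (fderiv ℝ (coneFunction C c) p v = 0 →
      fderiv ℝ (fderiv ℝ h) ((height p)⁻¹ • dropLast p) (dropLast v) (dropLast v) =
        -fderiv ℝ (fderiv ℝ (coneFunction C c)) p v v *
          fderiv ℝ h ((height p)⁻¹ • dropLast p) (dropLast p - height p • c)) := by
  set G := coneFunction C c with hGdef
  have hne := hG.ne_height hp hp0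
  have ht : 0 < height p := hG.height_pos p hp hp0.ge
  set t := height p
  set q := t⁻¹ • dropLast p with hq
  set y₀ := dropLast p - t • c with hy₀
  set w := dropLast v
  set g : ℝ → ℝ := fun s => G (p + s • v) with hg
  have hg0 : g 0 = 0 := by simp [hg, hp0]
  have hline : Continuous fun s : ℝ => p + s • v := by fun_prop
  have hev : ∀ᶠ s in 𝓝 (0 : ℝ), G (p + s • v) ≠ height (p + s • v) := by
    refine (hline.tendsto 0).eventually (p := fun x => G x ≠ height x) ?_
    rw [zero_smul, add_zero]
    exact hG.eventually_ne_height hne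
  have hgc : Continuous g := hG.continuous.comp hline
  have hglt : ∀ᶠ s in 𝓝 (0 : ℝ), 0 < t - g s := by
    filter_upwards [hgc.continuousAt.eventually_lt_const (by rw [hg0]; exact ht)] with s hs
    linarith
  set g' : ℝ → ℝ := fun s => fderiv ℝ G (p + s • v) v with hg'
  have hgd : ∀ᶠ s in 𝓝 (0 : ℝ), HasDerivAt g (g' s) s := by
    filter_upwards [hev] with s hs
    exact hG.hasDerivAt_line hs
  set g2 := fderiv ℝ (fderiv ℝ G) p v v
  have hg'd : HasDerivAt g' g2 0 := by
    have := hG.hasDerivAt_fderiv_line (p := p) (v := v) (t := 0)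
      (by rw [zero_smul, add_zero]; exact hne) v
    rwa [zero_smul, add_zero] at this
  have hg'0 : g' 0 = fderiv ℝ G p v := by simp [hg']
  set a : ℝ → ℝ := fun s => (t - g s)⁻¹ with ha
  set a' : ℝ → ℝ := fun s => g' s / (t - g s) ^ 2 with ha'
  have had : ∀ᶠ s in 𝓝 (0 : ℝ), HasDerivAt a (a' s) s := by
    filter_upwards [hgd, hglt] with s hs1 hs2
    convert! (hs1.const_sub t).inv hs2.ne' using 1
    rw [neg_neg]
  set r : ℝ → E d := fun s => y₀ + s • w with hr
  have hrd : ∀ s, HasDerivAt r w s := fun s => by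
    have h1 := ((hasDerivAt_id s).smul_const w).const_add y₀
    rwa [one_smul] at h1
  -- The curve `p + s v - g(s) e` lies on the cone, and `γ` is its radial projection to height one,
  -- hence a curve on the boundary of `C`. Both identities come from differentiating `h ∘ γ = 0`,
  -- once and twice.
  set γ : ℝ → E d := fun s => c + a s • r s with hγdef
  set γ' : ℝ → E d := fun s => a s • w + a' s • r s with hγ'
  have hγd : ∀ᶠ s in 𝓝 (0 : ℝ), HasDerivAt γ (γ' s) s := by
    filter_upwards [had] with s hs
    exact (hs.smul (hrd s)).const_add c
  have ha0 : a 0 = t⁻¹ := by simp [ha, hg0]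
  have hr0 : r 0 = y₀ := by simp [hr]
  have hγ0 : γ 0 = q := by
    rw [hγdef, hq]
    simp only [ha0, hr0, hy₀, smul_sub, smul_smul, inv_mul_cancel₀ ht.ne', one_smul]
    abel
  have hγcont : ContinuousAt γ 0 := hγd.self_of_nhds.continuousAt
  have hγU : ∀ᶠ s in 𝓝 (0 : ℝ), γ s ∈ U := by
    refine hγcont.eventually ?_
    rw [hγ0]
    exact hU.mem_nhds hqU
  have hzero : ∀ᶠ s in 𝓝 (0 : ℝ), h (γ s) = 0 := by
    filter_upwards [hγU, hglt] with s hs1 hs2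
    have hmem : γ s ∈ frontier C := by
      have e1 : height (p + s • v + (-g s) • lift c) = t - g s := by
        rw [map_add, map_add, map_smul, map_smul, hv, height_lift]
        simp only [smul_eq_mul]; ring
      have e2 : (t - g s)⁻¹ • dropLast (p + s • v + (-g s) • lift c) = γ s := by
        have e3 : (t - g s)⁻¹ * (t - g s) = 1 := inv_mul_cancel₀ hs2.ne'
        have e4 : dropLast (p + s • v + (-g s) • lift c) = (t - g s) • c + (y₀ + s • w) := by
          rw [map_add, map_add, map_smul, map_smul, dropLast_lift, hy₀]
          module
        rw [e4, smul_add, smul_smul, e3, one_smul]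
      have h1 := (coneFunction_eq_zero_iff hC hc (x := p + s • v + (-g s) • lift c)
        (by rw [e1]; exact hs2)).1 (by rw [← hGdef, hG.add_axis]; simp [hg])
      rwa [e1, e2] at h1
    have : γ s ∈ {y ∈ U | h y = 0} := hγ ▸ ⟨hmem, hs1⟩
    exact this.2
  have hhd : ∀ y ∈ U, HasFDerivAt h (fderiv ℝ h y) y := fun y hy =>
    ((hh.contDiffAt (hU.mem_nhds hy)).differentiableAt two_ne_zero).hasFDerivAt
  have hcomp : ∀ᶠ s in 𝓝 (0 : ℝ), HasDerivAt (fun s => h (γ s)) (fderiv ℝ h (γ s) (γ' s)) s := by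
    filter_upwards [hγU, hγd] with s hs1 hs2
    exact (hhd _ hs1).comp_hasDerivAt s hs2
  have hfirst : ∀ᶠ s in 𝓝 (0 : ℝ), fderiv ℝ h (γ s) (γ' s) = 0 := by
    filter_upwards [hcomp, hzero.eventually_nhds] with s hs1 hs2
    exact hs1.unique ((hasDerivAt_const s (0 : ℝ)).congr_of_eventuallyEq hs2)
  have ha'0 : a' 0 = fderiv ℝ G p v / t ^ 2 := by simp [ha', hg0, hg'0]
  have hγ'0 : γ' 0 = t⁻¹ • w + (fderiv ℝ G p v / t ^ 2) • y₀ := by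
    simp [hγ', ha0, ha'0, hr0]
  have h1 := hfirst.self_of_nhds
  rw [hγ0, hγ'0, map_add, map_smul, map_smul, smul_eq_mul, smul_eq_mul] at h1
  constructor
  · field_simp at h1
    linarith
  · intro hv0
    have hg'00 : g' 0 = 0 := hg'0.trans hv0
    have ha'd : HasDerivAt a' (g2 / t ^ 2) 0 := by
      have h2 : HasDerivAt (fun s => (t - g s) ^ 2) _ 0 :=
        (hgd.self_of_nhds.const_sub t).pow 2
      convert! hg'd.div h2 (by rw [hg0, sub_zero]; positivity) using 1
      rw [hg0, hg'00, sub_zero]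
      field_simp
      ring
    have hγ'd : HasDerivAt γ' ((g2 / t ^ 2) • y₀) 0 := by
      have h2 := (had.self_of_nhds.smul_const w).add (ha'd.smul (hrd 0))
      convert! h2 using 1
      simp [ha'0, hv0, hr0]
    have hh2 : HasFDerivAt (fderiv ℝ h) (fderiv ℝ (fderiv ℝ h) q) (γ 0) := by
      rw [hγ0]
      have h3 : ContDiffAt ℝ 1 (fderiv ℝ h) q :=
        (hh.contDiffAt (hU.mem_nhds hqU)).fderiv_right (by norm_num)
      exact (h3.differentiableAt one_ne_zero).hasFDerivAt
    have h4 := (hh2.comp_hasDerivAt (0 : ℝ) hγd.self_of_nhds).clm_apply hγ'd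
    have h5 := h4.unique ((hasDerivAt_const (0 : ℝ) (0 : ℝ)).congr_of_eventuallyEq hfirst)
    simp only [Function.comp, hγ'0, hv0, hγ0, zero_div, zero_smul, add_zero, map_smul, smul_apply,
      smul_eq_mul] at h5
    field_simp at h5
    linarith

/-- Up to a nonzero factor, the second fundamental form of the boundary of `C` is the Hessian of `G`
on horizontal tangent vectors. That Hessian is semidefinite by concavity, so a vector on which its
quadratic form vanishes lies in its kernel, and nondegeneracy forces the vector to be zero. -/
theorem isConeFunction_coneFunction (hm : 3 ≤ m) (hC : StrictConvex ℝ C)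
    (hCc : IsCompact C) (hc : c ∈ interior C)
    (hloc : ∀ q ∈ frontier C, ∃ (U : Set (E d)) (h : E d → ℝ), IsOpen U ∧ q ∈ U ∧
      ContDiffOn ℝ m h U ∧ frontier C ∩ U = {y ∈ U | h y = 0} ∧ fderiv ℝ h q ≠ 0 ∧
      ∀ w, fderiv ℝ h q w = 0 →
        (∀ u, fderiv ℝ h q u = 0 → fderiv ℝ (fderiv ℝ h) q w u = 0) → w = 0) :
    IsConeFunction m (coneFunction C c) height (lift c) := by
  have hG : IsConcaveConeFunction m (coneFunction C c) height (lift c) := by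
    refine isConcaveConeFunction_coneFunction hm hC hCc hc fun q hq => ?_
    obtain ⟨U, h, h1, h2, h3, h4, h5, -⟩ := hloc q hq
    exact ⟨U, h, h1, h2, h3, h4, h5⟩
  refine ⟨hG, fun p hp hp0 u hu hu1 hu2 => ?_⟩
  have ht := hG.height_pos p hp hp0.ge
  have hne := hG.ne_height hp hp0
  have hfr := (coneFunction_eq_zero_iff hC.convex hc ht).1 hp0
  obtain ⟨U, h, hU, hqU, hh, hγ, hd, hnd⟩ := hloc _ hfr
  have h2m : (2 : ℕ∞ω) ≤ m := le_trans (by norm_num) hm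
  have hh2 := hh.of_le h2m
  have key := fun {v : E (d + 1)} (hv : height v = 0) =>
    fderiv_defining_function hG hC.convex hc hp hp0 hU hqU hh2 hγ hv
  set q := (height p)⁻¹ • dropLast p with hq
  set y₀ := dropLast p - height p • c with hy₀
  set G := coneFunction C c
  have hrad : fderiv ℝ h q y₀ ≠ 0 := by
    have h1 := fderiv_radial_ne_zero hC.convex hc hfr hU hqU (hh2.of_le (by norm_num)) hγ hd
    have h2 : y₀ = height p • (q - c) := by
      rw [hq, smul_sub, smul_smul, mul_inv_cancel₀ ht.ne', one_smul]
    rw [h2, map_smul]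
    exact smul_ne_zero ht.ne' h1
  have hsymG : ∀ a b, fderiv ℝ (fderiv ℝ G) p a b = fderiv ℝ (fderiv ℝ G) p b a := fun a b =>
    (hG.contDiffAt p hne).isSymmSndFDerivAt (by simpa using h2m) a b
  have hsymh : ∀ a b, fderiv ℝ (fderiv ℝ h) q a b = fderiv ℝ (fderiv ℝ h) q b a := fun a b =>
    (hh2.contDiffAt (hU.mem_nhds hqU)).isSymmSndFDerivAt (by simp) a b
  have hu0 : fderiv ℝ h q (dropLast u) = 0 := by
    have h1 := (key hu).1
    rw [hu1, neg_zero, zero_mul] at h1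
    exact (mul_eq_zero.1 h1).resolve_left ht.ne'
  have hdu : dropLast u = 0 := by
    refine hnd _ hu0 fun w hw => ?_
    set v := lift w - lift 0 with hv
    have hv0 : height v = 0 := by rw [hv, map_sub, height_lift, height_lift, sub_self]
    have hvw : dropLast v = w := by rw [hv, map_sub, dropLast_lift, dropLast_lift, sub_zero]
    have hv1 : fderiv ℝ G p v = 0 := by
      have h1 := (key hv0).1
      rw [hvw, hw, mul_zero] at h1
      have := (mul_eq_zero.1 h1.symm).resolve_right hrad
      linarith
    have h3 := (key hu).2 hu1
    have h4 := (key hv0).2 hv1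
    -- Polarisation: the identity is known on the diagonal only, and comparing `u`, `v` and `u + v`
    -- yields the mixed derivative.
    have h5 := (key (v := u + v) (by rw [map_add, hu, hv0, add_zero])).2
      (by rw [map_add, hu1, hv1, add_zero])
    have h6 : fderiv ℝ (fderiv ℝ G) p u v = 0 :=
      apply_eq_zero_of_nonpos (fun x => hG.hess_nonpos hne x) hsymG hu2 v
    rw [hvw] at h4
    simp only [map_add, add_apply, hvw, hsymh w, hsymG v u, h6] at h5
    rw [hu2] at h3 h5
    linarith
  exact ext_dropLast_height (by rw [hdu, map_zero]) (by rw [hu, map_zero])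

theorem cone_frontier_eq_boundary (hC : Convex ℝ C) (hCc : IsCompact C) (hc : c ∈ interior C) :
    cone (frontier C) = IsConeFunction.boundary (coneFunction C c) := by
  ext x
  constructor
  · rintro ⟨t, ht, q, hq, rfl⟩
    have h1 : height (t • lift q) = t := by rw [map_smul, height_lift, smul_eq_mul, mul_one]
    refine ⟨fun h => ?_, ?_⟩
    · rw [h, map_zero] at h1
      exact ht.ne h1
    · rw [coneFunction_eq_zero_iff hC hc (by rw [h1]; exact ht), h1, map_smul, dropLast_lift,
        smul_smul, inv_mul_cancel₀ ht.ne', one_smul]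
      exact hq
  · rintro ⟨hx, hx0⟩
    have ht := height_pos_of_coneFunction_nonneg hCc hc hx hx0.ge
    exact ⟨height x, ht, _, (coneFunction_eq_zero_iff hC hc ht).1 hx0, eq_height_smul_lift ht.ne'⟩

end ConeBilliard

/-! ### The integrals -/

namespace ConeBilliard

open Filter Topology Set
open scoped ContDiff Gradient

section Integrals

variable {d : ℕ} {m k : ℕ∞ω} {G : E (d + 1) → ℝ} {c : E d}

theorem inner_eq_inner_dropLast_add (x y : E (d + 1)) :
    inner ℝ x y = inner ℝ (dropLast x) (dropLast y) + height x * height y := by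
  simp [height, PiLp.inner_apply, Fin.sum_univ_castSucc, mul_comm]

theorem eq_zero_of_dropLast_eq_zero {v w : E (d + 1)} (hv : height v ≠ 0)
    (hw : dropLast w = 0) (h : inner ℝ v w = 0) : w = 0 := by
  rw [inner_eq_inner_dropLast_add, hw, inner_zero_right, zero_add] at h
  exact ext_dropLast_height (by rw [hw, map_zero])
    (by rw [map_zero]; exact (mul_eq_zero.1 h).resolve_left hv)

/-- The point in which the ray spanned by a vector meets the hyperplane at height one. -/
def slope (v : E (d + 1)) : E d := (height v)⁻¹ • dropLast v

/-- A smooth function of the direction that is equal to one exactly on the boundary of the cone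
and vanishes near the axis. -/
def cutoff (G : E (d + 1) → ℝ) (v : E (d + 1)) : ℝ :=
  Real.smoothTransition (1 - 2 * G v / height v)

/-- The horizontal part of the position of a line, with the component normal to the level set of
`G` damped by the cutoff. -/
def dampedPosition (G : E (d + 1) → ℝ) (z : E (d + 1) × E (d + 1)) : E d :=
  dropLast z.2 - (cutoff G z.1 * inner ℝ (dropLast z.2) (dropLast (∇ G z.1)) /
    ‖dropLast (∇ G z.1)‖ ^ 2) • dropLast (∇ G z.1)

theorem dampedPosition_add_smul (v Q w : E (d + 1)) (s : ℝ) :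
    dampedPosition G (v, Q + s • w) = dampedPosition G (v, Q) + s • dampedPosition G (v, w) := by
  simp only [dampedPosition, map_add, map_smul, inner_add_left, real_inner_smul_left]
  module

/-- Damping multiplies the component along the horizontal normal by `1 - cutoff G v` and leaves the
orthogonal components alone, so it is invertible when the cutoff is below one. -/
theorem dropLast_eq_zero_of_dampedPosition {v w : E (d + 1)} (hv : cutoff G v < 1)
    (h : dampedPosition G (v, w) = 0) : dropLast w = 0 := by
  rw [dampedPosition, sub_eq_zero] at h
  rcases eq_or_ne (dropLast (∇ G v)) 0 with h0 | h0
  · rw [h, h0, smul_zero]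
  · have h1 := congrArg (fun u => inner ℝ u (dropLast (∇ G v))) h
    have h2 : ‖dropLast (∇ G v)‖ ≠ 0 := norm_ne_zero_iff.2 h0
    simp only [real_inner_smul_left, real_inner_self_eq_norm_sq] at h1
    field_simp at h1
    have h3 : (1 - cutoff G v) * inner ℝ (dropLast w) (dropLast (∇ G v)) = 0 := by linarith
    rw [(mul_eq_zero.1 h3).resolve_left (by linarith), mul_zero, zero_div, zero_smul] at h
    exact h

theorem exists_dropLast_eq_smul {v w : E (d + 1)} (h : dampedPosition G (v, w) = 0) :
    ∃ s : ℝ, dropLast w = s • dropLast (∇ G v) :=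
  ⟨_, sub_eq_zero.1 h⟩

/-- The coordinates of a line that determine the integrals: the slope, the damped position and the
square of the distance to the origin. -/
def asymptoticData (G : E (d + 1) → ℝ) (z : E (d + 1) × E (d + 1)) (j : Fin (2 * d + 1)) : ℝ :=
  if h : j.1 < d then slope z.1 ⟨j.1, h⟩
  else if h' : j.1 < 2 * d then dampedPosition G z ⟨j.1 - d, by omega⟩
  else ‖z.2‖ ^ 2

theorem asymptoticData_last (z : E (d + 1) × E (d + 1)) :
    asymptoticData G z (Fin.last (2 * d)) = ‖z.2‖ ^ 2 := by
  rw [asymptoticData, dif_neg (by simp; omega), dif_neg (by simp)]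

theorem asymptoticData_slope (z : E (d + 1) × E (d + 1)) (i : Fin d) :
    asymptoticData G z ⟨i, by omega⟩ = slope z.1 i := by
  rw [asymptoticData, dif_pos i.2]

theorem asymptoticData_position (z : E (d + 1) × E (d + 1)) (i : Fin d) :
    asymptoticData G z ⟨d + i, by omega⟩ = dampedPosition G z i := by
  have h1 : ¬ d + i.1 < d := by omega
  have h2 : d + i.1 < 2 * d := by omega
  rw [asymptoticData, dif_neg h1, dif_pos h2]
  exact congrArg (dampedPosition G z) (Fin.ext (Nat.add_sub_cancel_left d i))

theorem slope_eq_of_asymptoticData_eq {z w : E (d + 1) × E (d + 1)}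
    (h : ∀ j : Fin (2 * d), asymptoticData G z j.castSucc = asymptoticData G w j.castSucc) :
    slope z.1 = slope w.1 ∧ dampedPosition G z = dampedPosition G w := by
  constructor
  · ext i
    rw [← asymptoticData_slope (G := G), ← asymptoticData_slope (G := G)]
    exact h ⟨i, by omega⟩
  · ext i
    rw [← asymptoticData_position, ← asymptoticData_position]
    exact h ⟨d + i, by omega⟩

theorem eq_of_slope_eq {v w : E (d + 1)} (hv : ‖v‖ = 1) (hw : ‖w‖ = 1) (hv0 : 0 < height v)
    (hw0 : 0 < height w) (h : slope v = slope w) : v = w := by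
  have h1 : v = height v • lift (slope v) := eq_height_smul_lift hv0.ne'
  have h2 : w = height w • lift (slope w) := eq_height_smul_lift hw0.ne'
  have h3 : height v * ‖lift (slope v)‖ = 1 := by
    rw [← hv]; conv_rhs => rw [h1, norm_smul, Real.norm_of_nonneg hv0.le]
  have h4 : height w * ‖lift (slope v)‖ = 1 := by
    rw [← hw]; conv_rhs => rw [h2, norm_smul, Real.norm_of_nonneg hw0.le, ← h]
  have h5 : ‖lift (slope v)‖ ≠ 0 := by
    intro h0
    rw [h0, mul_zero] at h3
    exact zero_ne_one h3
  rw [h1, h2, mul_right_cancel₀ h5 (h3.trans h4.symm), h]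

namespace IsConeFunction

theorem cutoff_lt_one (hG : IsConeFunction m G height (lift c)) {v : E (d + 1)}
    (h : 0 < G v) : cutoff G v < 1 := by
  have h1 : 0 < height v := h.trans_le (hG.le_height v)
  refine Real.smoothTransition.lt_one_of_lt_one ?_
  have : 0 < 2 * G v / height v := div_pos (by linarith) h1
  linarith

theorem cutoff_eq_one {v : E (d + 1)} (h : G v = 0) : cutoff G v = 1 :=
  Real.smoothTransition.one_of_one_le (by rw [h, mul_zero, zero_div, sub_zero])

/-- If the gradient were vertical, `DG(e) = 1` would make it the unit vertical vector, and Euler's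
identity would give `G v = height v`, the excluded axis. -/
theorem dropLast_gradient_ne_zero (hG : IsConeFunction m G height (lift c)) {v : E (d + 1)}
    (h : G v ≠ height v) : dropLast (∇ G v) ≠ 0 := by
  intro h0
  have h1 := hG.fderiv_axis h
  have h2 := hG.inner_gradient_self h
  rw [← inner_gradient_left, inner_eq_inner_dropLast_add, h0, inner_zero_left, zero_add,
    height_lift, mul_one] at h1
  rw [inner_eq_inner_dropLast_add, h0, inner_zero_right, zero_add, h1, mul_one] at h2
  exact h h2.symm

theorem contDiffAt_slope {v : E (d + 1)} (h : height v ≠ 0) : ContDiffAt ℝ k slope v :=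
  (height.contDiff.contDiffAt.inv h).smul dropLast.contDiff.contDiffAt

/-- The bound `k ≤ ∞` is needed because the cutoff is smooth but not analytic. -/
theorem contDiffAt_dampedPosition (hG : IsConeFunction m G height (lift c)) (hk : k + 1 ≤ m)
    (hki : k ≤ ∞) {z : E (d + 1) × E (d + 1)} (h0 : z.1 ≠ 0) (h : 0 ≤ G z.1) :
    ContDiffAt ℝ k (dampedPosition G) z := by
  have hpos := hG.height_pos z.1 h0 h
  have hd2 : ContDiffAt ℝ k (fun z : E (d + 1) × E (d + 1) => dropLast z.2) z := by fun_prop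
  rcases eq_or_ne (G z.1) (height z.1) with he | he
  -- On the axis `G` equals the height and need not be differentiable. The cutoff vanishes nearby,
  -- since its argument is close to `1 - 2 < 0`, and the damped position is just the horizontal part
  -- of `Q`.
  · refine hd2.congr_of_eventuallyEq ?_
    have h1 : ContinuousAt (fun z : E (d + 1) × E (d + 1) => 1 - 2 * G z.1 / height z.1) z := by
      refine continuousAt_const.sub (ContinuousAt.div ?_ ?_ hpos.ne')
      · exact (continuous_const.mul (hG.continuous.comp continuous_fst)).continuousAt
      · fun_prop
    have h2 : 1 - 2 * G z.1 / height z.1 < 0 := by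
      rw [he, mul_div_assoc, div_self hpos.ne']
      norm_num
    filter_upwards [h1.eventually_lt_const h2] with y hy
    rw [dampedPosition, cutoff, Real.smoothTransition.zero_of_nonpos hy.le, zero_mul, zero_div,
      zero_smul, sub_zero]
  · have hGk : ContDiffAt ℝ k G z.1 := (hG.contDiffAt z.1 he).of_le (le_self_add.trans hk)
    have hn : ContDiffAt ℝ k (fun z : E (d + 1) × E (d + 1) => dropLast (∇ G z.1)) z := by
      have h1 : ContDiffAt ℝ k (∇ G) z.1 :=
        contDiffAt_gradient ((hG.contDiffAt z.1 he).fderiv_right hk)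
      exact dropLast.contDiff.contDiffAt.comp z (h1.comp z contDiffAt_fst)
    have hG1 : ContDiffAt ℝ k (fun z : E (d + 1) × E (d + 1) => G z.1) z :=
      hGk.comp z contDiffAt_fst
    have hc : ContDiffAt ℝ k (fun z : E (d + 1) × E (d + 1) => cutoff G z.1) z := by
      have h2 : ContDiffAt ℝ k (fun z : E (d + 1) × E (d + 1) => height z.1) z := by fun_prop
      refine ContDiffAt.comp (g := Real.smoothTransition) z
        (Real.smoothTransition.contDiffAt.of_le hki) ?_
      exact contDiffAt_const.sub ((contDiffAt_const.mul hG1).div h2 hpos.ne')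
    have hne := pow_ne_zero 2 (norm_ne_zero_iff.2 (hG.dropLast_gradient_ne_zero he))
    exact hd2.sub ((((hc.mul (hd2.inner ℝ hn)).div (hn.norm_sq ℝ) hne)).smul hn)

theorem contDiffAt_asymptoticData (hG : IsConeFunction m G height (lift c)) (hk : k + 1 ≤ m)
    (hki : k ≤ ∞) {z : E (d + 1) × E (d + 1)} (h0 : z.1 ≠ 0) (h : 0 ≤ G z.1)
    (j : Fin (2 * d + 1)) : ContDiffAt ℝ k (fun z => asymptoticData G z j) z := by
  have h1 : ContDiffAt ℝ k (fun z : E (d + 1) × E (d + 1) => slope z.1) z :=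
    (contDiffAt_slope (hG.height_pos z.1 h0 h).ne').comp z contDiffAt_fst
  have h2 := hG.contDiffAt_dampedPosition hk hki h0 h
  unfold asymptoticData
  split_ifs with hj hj'
  · exact contDiffAt_euclidean.1 h1 _
  · exact contDiffAt_euclidean.1 h2 _
  · exact contDiffAt_snd.norm_sq ℝ

/-- The asymptotic data of an asymptotic line and of its mirror image agree. -/
theorem asymptoticData_reflectAlong (hG : IsConeFunction m G height (lift c))
    {z : E (d + 1) × E (d + 1)} (h0 : z.1 ≠ 0) (h : G z.1 = 0) (j : Fin (2 * d + 1)) :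
    asymptoticData G (z.1, reflectAlong (∇ G z.1) z.2) j = asymptoticData G z j := by
  have hne := norm_ne_zero_iff.2 (hG.dropLast_gradient_ne_zero (hG.ne_height h0 h))
  have h1 : dampedPosition G (z.1, reflectAlong (∇ G z.1) z.2) = dampedPosition G z := by
    have h2 : dampedPosition G (z.1, ∇ G z.1) = 0 := by
      rw [dampedPosition, cutoff_eq_one h, one_mul, real_inner_self_eq_norm_sq,
        div_self (pow_ne_zero 2 hne), one_smul, sub_self]
    rw [reflectAlong, sub_eq_add_neg, ← neg_smul, dampedPosition_add_smul, h2, smul_zero, add_zero]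
  simp only [asymptoticData, h1, norm_reflectAlong]

/-- The slope determines the unit direction, damping is invertible for `G v > 0`, and a vector
orthogonal to `v` is determined by its horizontal part because `height v ≠ 0`. The norm of `Q` is
not needed. -/
theorem eq_of_asymptoticData_eq_of_pos (hG : IsConeFunction m G height (lift c))
    {z w : E (d + 1) × E (d + 1)} (hz : z ∈ unitLines (E (d + 1)))
    (hw : w ∈ unitLines (E (d + 1))) (hz0 : 0 < G z.1) (hw0 : 0 < G w.1)
    (h : ∀ j : Fin (2 * d), asymptoticData G z j.castSucc = asymptoticData G w j.castSucc) :
    z = w := by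
  obtain ⟨h1, h2⟩ := slope_eq_of_asymptoticData_eq h
  have hzp : 0 < height z.1 := hz0.trans_le (hG.le_height _)
  have h3 := eq_of_slope_eq hz.1 hw.1 hzp (hw0.trans_le (hG.le_height _)) h1
  obtain ⟨v, Q⟩ := z
  obtain ⟨v', Q'⟩ := w
  obtain rfl : v = v' := h3
  have h4 : dampedPosition G (v, Q - Q') = 0 := by
    rw [sub_eq_add_neg, ← neg_one_smul ℝ Q', dampedPosition_add_smul, h2]
    module
  have h5 := dropLast_eq_zero_of_dampedPosition (hG.cutoff_lt_one hz0) h4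
  have h6 := eq_zero_of_dropLast_eq_zero hzp.ne' h5
    (by rw [inner_sub_right, hz.2, hw.2, sub_self])
  rw [sub_eq_zero.1 h6]

theorem eq_of_asymptoticData_eq (hG : IsConeFunction m G height (lift c))
    {z w : E (d + 1) × E (d + 1)} (hz : z ∈ crossingLines G)
    (hw : w ∈ crossingLines G) (hz0 : 0 ≤ G z.1) (hw0 : 0 ≤ G w.1)
    (h : ∀ j, asymptoticData G z j = asymptoticData G w j) : z = w := by
  obtain ⟨h1, h2⟩ := slope_eq_of_asymptoticData_eq fun j => h j.castSucc
  have hzne := hG.ne_zero_of_mem hz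
  have hzp := hG.height_pos _ hzne hz0
  have h3 := eq_of_slope_eq hz.1.1 hw.1.1 hzp (hG.height_pos _ (hG.ne_zero_of_mem hw) hw0) h1
  rcases hz0.lt_or_eq with hpos | hzero
  · exact hG.eq_of_asymptoticData_eq_of_pos hz.1 hw.1 hpos (h3 ▸ hpos) fun j => h j.castSucc
  have hdz := hG.fderiv_pos_of_asymptotic hz hzero.symm
  have hdw := hG.fderiv_pos_of_asymptotic hw (h3 ▸ hzero.symm)
  have hnorm := h (Fin.last (2 * d))
  rw [asymptoticData_last, asymptoticData_last] at hnorm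
  have hself := hG.inner_gradient_self (hG.ne_height hzne hzero.symm)
  have hzo := hz.1.2
  have hwo := hw.1.2
  clear hz hw h
  obtain ⟨v, Q⟩ := z
  obtain ⟨v', Q'⟩ := w
  obtain rfl : v = v' := h3
  dsimp only at *
  have h4 : dampedPosition G (v, Q - Q') = 0 := by
    rw [sub_eq_add_neg, ← neg_one_smul ℝ Q', dampedPosition_add_smul, h2]
    module
  obtain ⟨s, hs⟩ := exists_dropLast_eq_smul h4
  have h5 : Q - Q' - s • ∇ G v = 0 := by
    refine eq_zero_of_dropLast_eq_zero hzp.ne' ?_ ?_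
    · rw [map_sub dropLast (Q - Q'), hs, map_smul, sub_self]
    · rw [inner_sub_right, inner_sub_right, hzo, hwo, real_inner_smul_right, hself, ← hzero]
      ring
  have h6 : Q = Q' + s • ∇ G v := by
    rw [sub_sub, sub_eq_zero] at h5
    exact h5
  rw [← inner_gradient_left, real_inner_comm] at hdz hdw
  rw [h6, inner_add_left, real_inner_smul_left, real_inner_self_eq_norm_sq] at hdz
  rw [h6, norm_add_sq_real, real_inner_smul_right, norm_smul, mul_pow, Real.norm_eq_abs,
    sq_abs] at hnorm
  have h7 : s * (2 * inner ℝ Q' (∇ G v) + s * ‖∇ G v‖ ^ 2) = 0 := by linarith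
  -- The second factor is `⟪Q, ∇G⟫ + ⟪Q', ∇G⟫`, positive because both lines enter the open cone. Its
  -- vanishing would mean that `Q` and `Q'` are mirror images.
  have h8 : s = 0 := (mul_eq_zero.1 h7).resolve_right (by linarith)
  rw [h6, h8, zero_smul, add_zero]

/-- Selection of coordinates. -/
def selectCoords {a b : ℕ} (f : Fin a → Fin b) : E b →L[ℝ] E a :=
  LinearMap.toContinuousLinearMap
    { toFun := fun x => WithLp.toLp 2 fun i => x (f i)
      map_add' := fun x y => by ext i; simp
      map_smul' := fun t x => by ext i; simp }

theorem fderiv_asymptoticData_injective (hG : IsConeFunction m G height (lift c))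
    {z : E (d + 1) × E (d + 1)} (hz : z ∈ unitLines (E (d + 1))) (h0 : 0 < G z.1)
    {w : E (d + 1) × E (d + 1)} (hw : w ∈ tangentTS z)
    (h : fderiv ℝ (fun z => WithLp.toLp 2 (asymptoticData G z)) z w = 0) : w = 0 := by
  set F : E (d + 1) × E (d + 1) → E (2 * d + 1) := fun z => WithLp.toLp 2 (asymptoticData G z)
    with hF
  have hz0 : z.1 ≠ 0 := by
    intro h1
    rw [h1, hG.map_zero] at h0
    exact h0.false
  have hzp : 0 < height z.1 := h0.trans_le (hG.le_height _)
  have hFd : DifferentiableAt ℝ F z := by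
    refine ContDiffAt.differentiableAt (n := 1) (contDiffAt_euclidean.2 fun j => ?_) one_ne_zero
    exact hG.contDiffAt_asymptoticData hG.one_add_one_le (by exact_mod_cast le_top) hz0 h0.le j
  have hsel : ∀ f : Fin d → Fin (2 * d + 1),
      HasFDerivAt (fun y => selectCoords f (F y)) ((selectCoords f).comp (fderiv ℝ F z)) z :=
    fun f => (selectCoords f).hasFDerivAt.comp z hFd.hasFDerivAt
  have hs1 : (fun y => selectCoords (fun i : Fin d => (⟨i, by omega⟩ : Fin (2 * d + 1))) (F y)) =
      fun y => slope y.1 := by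
    ext y i
    exact asymptoticData_slope y i
  have hs2 : (fun y => selectCoords (fun i : Fin d => (⟨d + i, by omega⟩ : Fin (2 * d + 1))) (F y))
      = dampedPosition G := by
    ext y i
    exact asymptoticData_position y i
  have hline : ∀ {f : E (d + 1) × E (d + 1) → E d} {f' : E (d + 1) × E (d + 1) →L[ℝ] E d},
      HasFDerivAt f f' z → HasDerivAt (fun s : ℝ => f (z + s • w)) (f' w) 0 := by
    intro f f' hf
    have h1 : HasDerivAt (fun s : ℝ => z + s • w) w 0 := by
      have h2 := ((hasDerivAt_id (0 : ℝ)).smul_const w).const_add z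
      rwa [one_smul] at h2
    have h3 : HasFDerivAt f f' (z + (0 : ℝ) • w) := by rwa [zero_smul, add_zero]
    exact h3.comp_hasDerivAt (0 : ℝ) h1
  have hd1 := hline (hs1 ▸ hsel _)
  have hd2 := hline (hs2 ▸ hsel _)
  rw [ContinuousLinearMap.comp_apply, h, map_zero] at hd1 hd2
  obtain ⟨v, Q⟩ := z
  obtain ⟨w₁, w₂⟩ := w
  obtain ⟨ht1, ht2⟩ := hw
  dsimp only at *
  have hw1 : w₁ = 0 := by
    have e1 : HasDerivAt (fun s : ℝ => height (v + s • w₁)) (height w₁) 0 := by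
      have h2 := ((hasDerivAt_id (0 : ℝ)).mul_const (height w₁)).const_add (height v)
      rw [one_mul] at h2
      convert! h2 using 2
    have e2 : HasDerivAt (fun s : ℝ => dropLast (v + s • w₁)) (dropLast w₁) 0 := by
      have h2 := ((hasDerivAt_id (0 : ℝ)).smul_const (dropLast w₁)).const_add (dropLast v)
      rw [one_smul] at h2
      convert! h2 using 2
    have e3 := e1.smul hd1
    have e4 : ∀ᶠ s : ℝ in 𝓝 0, dropLast (v + s • w₁) =
        height (v + s • w₁) • slope (v + s • w₁) := by
      have h2 : 0 < height (v + (0 : ℝ) • w₁) := by rwa [zero_smul, add_zero]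
      filter_upwards [e1.continuousAt.eventually_const_lt h2] with s hs
      rw [slope, smul_smul, mul_inv_cancel₀ hs.ne', one_smul]
    have e5 := e2.unique (e3.congr_of_eventuallyEq e4)
    simp only [zero_smul, add_zero, smul_zero, zero_add] at e5
    -- A direction variation that keeps the slope to first order is radial, and tangency to the unit
    -- sphere kills it. The remaining variation of `Q` enters the damped position linearly.
    have e6 : w₁ = (height w₁ * (height v)⁻¹) • v := by
      refine ext_dropLast_height ?_ ?_
      · rw [e5, map_smul, slope, smul_smul]
      · rw [map_smul, smul_eq_mul, mul_assoc, inv_mul_cancel₀ hzp.ne', mul_one]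
    have e7 : inner ℝ v v = 1 := by rw [real_inner_self_eq_norm_sq, hz.1, one_pow]
    rw [e6, real_inner_smul_right, e7, mul_one] at ht1
    rw [e6, ht1, zero_smul]
  subst hw1
  have e1 : HasDerivAt (fun s : ℝ => dampedPosition G ((v, Q) + s • ((0 : E (d + 1)), w₂)))
      (dampedPosition G (v, w₂)) 0 := by
    have h2 := ((hasDerivAt_id (0 : ℝ)).smul_const (dampedPosition G (v, w₂))).const_add
      (dampedPosition G (v, Q))
    rw [one_smul] at h2
    convert! h2 using 2 with s
    rw [Prod.smul_mk, Prod.mk_add_mk, smul_zero, add_zero, dampedPosition_add_smul]; rfl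
  have e2 := dropLast_eq_zero_of_dampedPosition (hG.cutoff_lt_one h0) (e1.unique hd2)
  rw [inner_zero_left, zero_add] at ht2
  rw [eq_zero_of_dropLast_eq_zero hzp.ne' e2 ht2]
  rfl

/-- Away from the lines with asymptotic final line, the asymptotic data of the final line define
an immersion. -/
theorem isImmersionOn_asymptoticData (hG : IsConeFunction m G height (lift c)) {k : ℕ∞}
    (hk0 : k ≠ 0) (hk : (k : ℕ∞ω) + 1 ≤ m) :
    IsImmersionOn k (fun x => WithLp.toLp 2 fun j => asymptoticData G (finalLine G x) j)
      {x ∈ crossingLines G | 0 < G (finalLine G x).1} := by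
  rintro x ⟨hx, hx0⟩
  have ha := (hG.bounceCount_spec hx).1
  have hk0' : (k : ℕ∞ω) ≠ 0 := by exact_mod_cast hk0
  have hki : (k : ℕ∞ω) ≤ ∞ := by exact_mod_cast le_top
  set N := bounceCount G x with hN
  have hfin : finalLine G x = (bounce G)^[N] x := rfl
  have hev : ∀ᶠ y in 𝓝 x, Admissible G N y ∧ 0 < G ((bounce G)^[N] y).1 ∧
      (y ∈ crossingLines G → finalLine G y = (bounce G)^[N] y) := by
    obtain ⟨h1, h2⟩ := hG.admissible_local hG.one_add_one_le ha
    have h3 : ContinuousAt (fun y => G ((bounce G)^[N] y).1) x :=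
      (hG.continuous.comp continuous_fst).continuousAt.comp h2.continuousAt
    have h4 := eventually_nhdsWithin_iff.1 (hG.eventually_finalLine_eq hx hx0)
    filter_upwards [h1, h3.eventually_const_lt hx0, h4] with y hy1 hy2 hy3
    exact ⟨hy1, hy2, fun hy => (hy3 hy).1⟩
  obtain ⟨U, hU, hUo, hxU⟩ := eventually_nhds_iff.1 hev
  set F : E (d + 1) × E (d + 1) → E (2 * d + 1) := fun z => WithLp.toLp 2 (asymptoticData G z)
  have hF : ∀ z : E (d + 1) × E (d + 1), 0 < G z.1 → ContDiffAt ℝ k F z := by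
    intro z hz
    have hz0 : z.1 ≠ 0 := by
      intro h1
      rw [h1, hG.map_zero] at hz
      exact hz.false
    exact contDiffAt_euclidean.2 fun j => hG.contDiffAt_asymptoticData hk hki hz0 hz.le j
  refine ⟨U, fun y => F ((bounce G)^[N] y), hUo, hxU, fun y hy => ?_, ?_, ?_⟩
  · obtain ⟨h1, h2, -⟩ := hU y hy
    exact (ContDiffAt.comp (g := F) y (hF _ h2) (hG.admissible_local hk h1).2).contDiffWithinAt
  · rintro y ⟨hy1, hy2⟩
    exact congrArg F ((hU y hy2).2.2 hy1.1).symm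
  · intro w hw h
    have h1 := ((hG.admissible_local hk ha).2.differentiableAt hk0')
    have h2 := (hF _ hx0).differentiableAt hk0'
    obtain ⟨i1, i2, i3⟩ := hG.fderiv_iterate_bounce ha w
    refine i1 (hG.fderiv_asymptoticData_injective (z := (bounce G)^[N] x)
      (iterate_bounce_mem_unitLines N hx.1) hx0 ⟨i2.trans hw.1, i3.trans hw.2⟩ ?_)
    rw [← h]
    exact (congrArg (fun L => L w) (fderiv_comp (g := F) (f := (bounce G)^[N]) x h2 h1)).symm

end IsConeFunction

/-- Lagrange's identity, obtained by symmetrising the sum over `i < j`. At any point of a line it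
reduces to `‖Q‖²`, independent of the chosen point. -/
theorem angularIntegral_eq {n : ℕ} (p v : E n) :
    angularIntegral p v = ‖p‖ ^ 2 * ‖v‖ ^ 2 - inner ℝ p v ^ 2 := by
  have hsym : ∑ i, ∑ j, (p i * v j - p j * v i) ^ 2 = 2 * angularIntegral p v := by
    have h1 : ∀ i : Fin n, ∑ j, (p i * v j - p j * v i) ^ 2 =
        ∑ j ∈ Finset.Ioi i, (p i * v j - p j * v i) ^ 2 +
          ∑ j ∈ Finset.Iio i, (p i * v j - p j * v i) ^ 2 := by
      intro i
      rw [← Finset.sum_union (Finset.disjoint_left.2 fun j hj hj' =>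
        lt_asymm (Finset.mem_Ioi.1 hj) (Finset.mem_Iio.1 hj'))]
      refine (Finset.sum_subset (Finset.subset_univ _) fun j _ hj => ?_).symm
      have : j = i := by
        simp only [Finset.mem_union, Finset.mem_Ioi, Finset.mem_Iio, not_or, not_lt] at hj
        exact le_antisymm hj.1 hj.2
      rw [this, sub_self, zero_pow two_ne_zero]
    have h2 : ∑ i : Fin n, ∑ j ∈ Finset.Iio i, (p i * v j - p j * v i) ^ 2 =
        angularIntegral p v := by
      rw [angularIntegral, Finset.sum_comm' (t' := Finset.univ) (s' := fun j => Finset.Ioi j)]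
      · refine Finset.sum_congr rfl fun i _ => Finset.sum_congr rfl fun j _ => ?_
        ring
      · simp
    rw [Finset.sum_congr rfl fun i _ => h1 i, Finset.sum_add_distrib, h2, two_mul]
    rfl
  have hexp : ∑ i, ∑ j, (p i * v j - p j * v i) ^ 2 =
      2 * ((∑ i, p i ^ 2) * ∑ j, v j ^ 2) - 2 * (∑ i, p i * v i) ^ 2 := by
    have h1 : ∀ i j, (p i * v j - p j * v i) ^ 2 =
        p i ^ 2 * v j ^ 2 + v i ^ 2 * p j ^ 2 - 2 * ((p i * v i) * (p j * v j)) := by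
      intro i j; ring
    simp only [h1, Finset.sum_sub_distrib, Finset.sum_add_distrib, ← Finset.mul_sum,
      ← Finset.sum_mul]
    ring
  have h1 : inner ℝ p v = ∑ i, p i * v i := by simp [PiLp.inner_apply, mul_comm]
  rw [EuclideanSpace.real_norm_sq_eq, EuclideanSpace.real_norm_sq_eq, h1]
  linarith

theorem angularIntegral_of_mem_line {n : ℕ} {x : E n × E n} (hx : x ∈ orientedLines n) {p : E n}
    (hp : p ∈ line x) : angularIntegral p x.1 = ‖x.2‖ ^ 2 := by
  obtain ⟨t, rfl⟩ := hp
  have h1 : inner ℝ x.2 x.1 = 0 := by rw [real_inner_comm]; exact hx.2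
  rw [angularIntegral_eq, norm_add_sq_real, inner_add_left, real_inner_smul_left,
    real_inner_smul_right, real_inner_self_eq_norm_sq, norm_smul, h1, hx.1, Real.norm_eq_abs,
    mul_pow, sq_abs]
  ring

end Integrals

end ConeBilliard

end

theorem theorem3 {d : ℕ} (hd : 1 ≤ d) (k : ℕ∞) (hk : 2 ≤ k) (γ : Set (ConeBilliard.E d))
    (hγ : ConeBilliard.IsStrictlyConvexHypersurface (k + 1) γ)
    (K : Set (ConeBilliard.E (d + 1))) (hK : K = ConeBilliard.cone γ) :
    -- `Δ` is a submanifold of codimension one with open dense complement in `Ψ`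
    ConeBilliard.IsCodimOneSubmanifold k (ConeBilliard.Delta K) ∧
    (∃ U, IsOpen U ∧
      ConeBilliard.phaseSpace K \ ConeBilliard.Delta K =
        ConeBilliard.orientedLines (d + 1) ∩ U) ∧
    ConeBilliard.phaseSpace K ⊆
      closure (ConeBilliard.phaseSpace K \ ConeBilliard.Delta K) ∧
    -- the integrals; here `n = d + 1`, so that `2 n - 1 = 2 d + 1`
    ∃ I : Fin (2 * d + 1) → ConeBilliard.E (d + 1) × ConeBilliard.E (d + 1) → ℝ,
      (∀ j, ContinuousOn (I j) (ConeBilliard.phaseSpace K)) ∧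
      (∀ j, ∀ x ∈ ConeBilliard.phaseSpace K, I j (ConeBilliard.billiardMap K x) = I j x) ∧
      (∀ x ∈ ConeBilliard.phaseSpace K, ∀ p ∈ ConeBilliard.line x,
        I (Fin.last (2 * d)) x = ConeBilliard.angularIntegral p x.1) ∧
      -- smoothness and immersion off `Δ`
      ConeBilliard.IsImmersionOn k (fun x => WithLp.toLp 2 (fun j => I j x))
        (ConeBilliard.phaseSpace K \ ConeBilliard.Delta K) ∧
      -- each nonempty level set of `(I₁, …, I₂ₙ₋₁)` is exactly one trajectory
      (∀ x ∈ ConeBilliard.phaseSpace K,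
        {y ∈ ConeBilliard.phaseSpace K | ∀ j, I j y = I j x} = ConeBilliard.trajectory K x) ∧
      -- off `Δ` the first `2 n - 2` integrals suffice
      (∀ x ∈ ConeBilliard.phaseSpace K \ ConeBilliard.Delta K,
        {y ∈ ConeBilliard.phaseSpace K \ ConeBilliard.Delta K |
          ∀ j : Fin (2 * d), I j.castSucc y = I j.castSucc x} = ConeBilliard.trajectory K x) := by
  have hn : 2 ≤ d + 1 := by omega
  obtain ⟨C, hCc, hC, ⟨c, hc⟩, rfl⟩ := hγ.strictConvex
  have hk1 : (k : WithTop ℕ∞) + 1 ≤ ((k + 1 : ℕ∞) : WithTop ℕ∞) := by push_cast; exact le_rfl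
  have hm : (3 : WithTop ℕ∞) ≤ ((k + 1 : ℕ∞) : WithTop ℕ∞) := by
    have h3 : (3 : ℕ∞) ≤ k + 1 := by
      calc (3 : ℕ∞) = 2 + 1 := by norm_num
        _ ≤ k + 1 := by gcongr
    exact WithTop.coe_le_coe.2 h3
  have hk0 : k ≠ 0 := by
    rintro rfl
    simp at hk
  have hki : (k : WithTop ℕ∞) ≤ ((⊤ : ℕ∞) : WithTop ℕ∞) := by exact_mod_cast le_top
  have hG := ConeBilliard.isConeFunction_coneFunction hm hC hCc hc hγ.nondegenerate
  rw [ConeBilliard.cone_frontier_eq_boundary hC.convex hCc hc] at hK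
  subst hK
  set G := ConeBilliard.coneFunction C c
  have hΨ := hG.phaseSpace_boundary
  have hΨΔ := hG.phaseSpace_diff_Delta hn
  have hspec := fun {x} hx => hG.bounceCount_spec (x := x) hx
  refine ⟨hG.isCodimOneSubmanifold_Delta hn hk0 hk1, hG.isOpen_phaseSpace_diff_Delta hn, ?_,
    fun j x => ConeBilliard.asymptoticData G (ConeBilliard.finalLine G x) j,
    fun j => ?_, fun j x hx => ?_, fun x hx p hp => ?_, ?_, fun x hx => ?_, fun x hx => ?_⟩
  · rw [hΨΔ, hΨ]
    exact hG.crossingLines_subset_closure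
  · rw [hΨ]
    exact hG.continuousOn_comp_finalLine (J := fun z => ConeBilliard.asymptoticData G z j)
      (fun z h0 h => (hG.contDiffAt_asymptoticData hk1 hki h0 h j).continuousAt)
      (fun z h0 h => hG.asymptoticData_reflectAlong h0 h j)
  · rw [hΨ] at hx
    dsimp only
    rw [(hG.billiardMap_mem hn hx).2]
  · dsimp only
    rw [ConeBilliard.angularIntegral_of_mem_line hx.1 hp, ConeBilliard.asymptoticData_last,
      ConeBilliard.finalLine, ConeBilliard.norm_iterate_bounce_snd]
  · rw [hΨΔ]
    exact hG.isImmersionOn_asymptoticData hk0 hk1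
  · rw [hΨ] at hx ⊢
    rw [hG.trajectory_boundary hn hx]
    ext y
    refine and_congr_right fun hy => ⟨fun h => ?_, fun h j => congrArg
      (fun z => ConeBilliard.asymptoticData G z j) h⟩
    exact hG.eq_of_asymptoticData_eq (hG.finalLine_mem hy) (hG.finalLine_mem hx)
      (hspec hy).2 (hspec hx).2 h
  · rw [hΨΔ] at hx ⊢
    rw [hG.trajectory_boundary hn hx.1]
    ext y
    constructor
    · rintro ⟨hy, h⟩
      exact ⟨hy.1, hG.eq_of_asymptoticData_eq_of_pos (hG.finalLine_mem hy.1).1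
        (hG.finalLine_mem hx.1).1 hy.2 hx.2 h⟩
    · rintro ⟨hy, h⟩
      refine ⟨⟨hy, by rw [h]; exact hx.2⟩, fun j => ?_⟩
      exact congrArg (fun z => ConeBilliard.asymptoticData G z j.castSucc) h
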